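/- Let $\mathcal X\subset[0,r]^d$ ($r>0$) be compact and convex, and let $f\sim\mathcal{GP}(0,k)$ on $\mathcal X$, where $k$ is a stationary kernel with $k(x,x)=1$. Assume that the sample paths of $f$ are almost surely differentiable on $\mathcal X$ and that there are constants $a,b>0$ such that $$\Pr\Bigl(\sup_{x\in\mathcal X}\bigl|\tfrac{\partial f}{\partial x_j}\bigr|>L\Bigr)\le a\exp\bigl(-(L/b)^2\bigr)\qquad\text{for all } L>0,\ j=1,\dots,d.$$ Fix $\eta>0$ and $\sigma>0$, and put $$s_\eta=2d\log\Bigl(\frac{2bdr(\sqrt{\log(ad)}+\sqrt\pi/2)}{\eta}\Bigr)-2\log2,\qquad C_1=\frac{2}{\log(1+\sigma^{-2})}.$$ IRGP-UCB with parameters $s_\eta$ and $\lambda=1/2$ is the following algorithm. At iteration $t=1,2,\dots$, draw $\zeta_t=s_\eta+Z_t$ with $Z_t\sim\mathrm{Exp}(1/2)$, query a point $$x_t\in\operatorname*{argmax}_{x\in\mathcal X}\ \mu_{t-1}(x)+\zeta_t^{1/2}\sigma_{t-1}(x),$$ chosen by a measurable rule from the past data and the values $\zeta_1,\dots,\zeta_t$,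 and observe $y_t=f(x_t)+\epsilon_t$, $\epsilon_t\sim\mathcal N(0,\sigma^2)$. Here $\mu_{t-1}$ and $\sigma_{t-1}^2$ are the posterior mean and variance of the Gaussian process given $(x_i,y_i)_{i<t}$ with noise variance $\sigma^2$. The $\epsilon_t$ are i.i.d., the $\zeta_t$ are i.i.d., and $f$, $(\epsilon_t)_t$, $(\zeta_t)_t$ are independent. Let $$\mathrm{BSR}_T=\mathbb E\bigl[f(x^*)-\max_{t\le T}f(x_t)\bigr],\qquad x^*\in\operatorname*{argmax}_{x\in\mathcal X}f(x),$$ and let $\gamma_T=\sup_{A\subset\mathcal X,\,|A|=T}I(y_A;f_A)$ be the maximum information gain, where $I$ is Shannon mutual information, $f_A=(f(x))_{x\in A}$, and $y_A=f_A+\epsilon_A$ with independent $\epsilon_A\sim\mathcal N(0,\sigma^2 I_T)$. (Square roots of negative numbers are read as $0$.) Then, for every $T\ge1$, $\gamma_T$ is finite, the regret in the definition of $\mathrm{BSR}_T$ is integrable, and $$\mathrm{BSR}_T\le\frac\eta2+\sqrt{\frac{C_1(2+s_\eta)\gamma_T}{T}}.$$ Consequently, if $T\ge1$ satisfies $\sqrt{C_1(2+s_\eta)\gamma_T/T}\le\eta/2$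 (in particular, if $T$ is the smallest such integer), then $\mathrm{BSR}_n\le\eta$ for every $n\ge T$. The left-hand side of this condition is $O(\sqrt{\gamma_T/T})$ in $T$, since $C_1$ and $s_\eta$ do not depend on $T$. -/

import Mathlib

open MeasureTheory ProbabilityTheory Set
open scoped NNReal ENNReal Matrix

namespace GPBandit

noncomputable section

/-- `ℝ^d`. -/
abbrev Pt (d : ℕ) : Type := EuclideanSpace ℝ (Fin d)

/-! ### Gaussian process prior -/

/-- `f ∼ GP(0, k)` on the domain `X`: `(f · z)_{z ∈ X}` is a Gaussian process on `(Ω, P)` with zero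
mean and covariance kernel `k`. Values of `f` and `k` outside `X` are irrelevant. -/
structure IsCenteredGP {Ω : Type*} [MeasurableSpace Ω] {d : ℕ} (X : Set (Pt d))
    (k : Pt d → Pt d → ℝ) (f : Ω → Pt d → ℝ) (P : Measure Ω) : Prop where
  measurable : ∀ z ∈ X, Measurable (fun ω => f ω z)
  gaussian : IsGaussianProcess (fun (z : X) (ω : Ω) => f ω z) P
  mean_zero : ∀ z ∈ X, ∫ ω, f ω z ∂P = 0
  covariance_eq : ∀ z ∈ X, ∀ w ∈ X, cov[fun ω => f ω z, fun ω => f ω w; P] = k z w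

/-- `k` is stationary on `X`: `k z w` depends on `z - w` only. -/
def IsStationaryOn {d : ℕ} (X : Set (Pt d)) (k : Pt d → Pt d → ℝ) : Prop :=
  ∃ κ : Pt d → ℝ, ∀ z ∈ X, ∀ w ∈ X, k z w = κ (z - w)

/-- The regularity assumption on domain and sample paths: `X ⊆ [0, r]^d` is compact and convex,
almost every sample path is differentiable on `X` with gradient `∇f`, and
`Pr (sup_{z ∈ X} |∂f/∂z_j| > L) ≤ a exp (-(L/b)²)` for every coordinate `j` and every `L > 0`.
(`∃ z ∈ X, L < |∂_j f(z)|` says that the supremum, possibly infinite, exceeds `L`. If `X` has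
empty interior, any gradient relative to `X` may be used.) -/
structure RegularDomain {Ω : Type*} [MeasurableSpace Ω] {d : ℕ} (X : Set (Pt d))
    (f : Ω → Pt d → ℝ) (P : Measure Ω) (r a b : ℝ) : Prop where
  r_pos : 0 < r
  a_pos : 0 < a
  b_pos : 0 < b
  subset_cube : ∀ z ∈ X, ∀ j, z j ∈ Icc 0 r
  compact : IsCompact X
  convex : Convex ℝ X
  gradient_tail : ∃ gradf : Ω → Pt d → Pt d,
    (∀ᵐ ω ∂P, ∀ z ∈ X, HasGradientWithinAt (f ω) (gradf ω z) X z) ∧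
    ∀ j : Fin d, ∀ L : ℝ, 0 < L →
      P {ω | ∃ z ∈ X, L < |gradf ω z j|} ≤ ENNReal.ofReal (a * Real.exp (-(L / b) ^ 2))

/-! ### Maximum information gain -/

/-- Shannon mutual information of the two components of a pair with joint law `ρ`: the
Kullback-Leibler divergence of `ρ` from the product of its marginals. -/
def mutualInfo {α β : Type*} [MeasurableSpace α] [MeasurableSpace β] (ρ : Measure (α × β)) :
    ℝ≥0∞ :=
  InformationTheory.klDiv ρ (ρ.fst.prod ρ.snd)

/-- `I(y_A ; f_A)` for `A = {a_1, …, a_T}`, where `f_A = (f(a_i))_i`, `y_A = f_A + ε_A`, and `ε_A`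
has i.i.d. `N(0, σ²)` entries and is independent of `f_A`. -/
def infoGain {Ω : Type*} [MeasurableSpace Ω] {d : ℕ} (f : Ω → Pt d → ℝ) (P : Measure Ω)
    (σ : ℝ≥0) {T : ℕ} (A : Fin T → Pt d) : ℝ≥0∞ :=
  mutualInfo (((P.map (fun ω i => f ω (A i))).prod
    (Measure.pi (fun _ : Fin T => gaussianReal 0 (σ ^ 2)))).map
      (fun p : (Fin T → ℝ) × (Fin T → ℝ) => (p.1 + p.2, p.1)))

/-- The maximum information gain `γ_T`: the supremum of `I(y_A ; f_A)` over the sets `A` of `T`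
(distinct) points of `X`. -/
def maxInfoGain {Ω : Type*} [MeasurableSpace Ω] {d : ℕ} (X : Set (Pt d)) (f : Ω → Pt d → ℝ)
    (P : Measure Ω) (σ : ℝ≥0) (T : ℕ) : ℝ≥0∞ :=
  ⨆ (A : Fin T → Pt d) (_ : Function.Injective A) (_ : ∀ i, A i ∈ X), infoGain f P σ A

/-! ### GP posterior and the algorithm -/

/-- Regularised kernel matrix `K + σ² I` at the points `xs`. -/
def regGram {d n : ℕ} (k : Pt d → Pt d → ℝ) (σ : ℝ≥0) (xs : Fin n → Pt d) :
    Matrix (Fin n) (Fin n) ℝ :=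
  (Matrix.of fun i j => k (xs i) (xs j)) + ((σ : ℝ) ^ 2) • (1 : Matrix (Fin n) (Fin n) ℝ)

/-- Posterior mean at `z` given the data `(xs i, ys i)`. -/
def postMean {d n : ℕ} (k : Pt d → Pt d → ℝ) (σ : ℝ≥0) (xs : Fin n → Pt d) (ys : Fin n → ℝ)
    (z : Pt d) : ℝ :=
  (fun i => k z (xs i)) ⬝ᵥ ((regGram k σ xs)⁻¹ *ᵥ ys)

/-- Posterior variance at `z` given the query points `xs`. -/
def postVar {d n : ℕ} (k : Pt d → Pt d → ℝ) (σ : ℝ≥0) (xs : Fin n → Pt d) (z : Pt d) : ℝ :=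
  k z z - (fun i => k z (xs i)) ⬝ᵥ ((regGram k σ xs)⁻¹ *ᵥ (fun i => k z (xs i)))

/-- The acquisition function `μ(z) + c^{1/2} σ(z)`. A square root of a negative number is read
as `0`. -/
def ucb {d n : ℕ} (k : Pt d → Pt d → ℝ) (σ : ℝ≥0) (xs : Fin n → Pt d) (ys : Fin n → ℝ)
    (c : ℝ) (z : Pt d) : ℝ :=
  postMean k σ xs ys z + √c * √(postVar k σ xs z)

/-- The two-parameter exponential distribution: the law of `s + Z` with `Z ∼ Exp(lam)`. -/
def twoParamExp (s lam : ℝ) : Measure ℝ :=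
  (expMeasure lam).map (fun z => s + z)

/-- The randomness of the model beside the prior: i.i.d. noise `ε_t ∼ N(0, σ²)` and i.i.d.
`ζ_t` with the two-parameter exponential distribution; `(f(z))_{z ∈ X}`, `(ε_t)_t` and `(ζ_t)_t` are
mutually independent. -/
structure IsNoiseModel {Ω : Type*} [MeasurableSpace Ω] {d : ℕ} (X : Set (Pt d))
    (f : Ω → Pt d → ℝ) (P : Measure Ω) (σ : ℝ≥0) (s lam : ℝ) (ε ζ : ℕ → Ω → ℝ) : Prop where
  measurable_ε : ∀ t, Measurable (ε t)
  measurable_ζ : ∀ t, Measurable (ζ t)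
  law_ε : ∀ t, HasLaw (ε t) (gaussianReal 0 (σ ^ 2)) P
  law_ζ : ∀ t, HasLaw (ζ t) (twoParamExp s lam) P
  indep_ε : iIndepFun ε P
  indep_ζ : iIndepFun ζ P
  indep_noise : IndepFun (fun ω t => ε t ω) (fun ω t => ζ t ω) P
  indep_prior : IndepFun (fun ω (z : X) => f ω z)
    (fun ω => ((fun t => ε t ω), (fun t => ζ t ω))) P

/-- The sequences `x` (queries) and `y` (observations) are produced by IRGP-UCB with confidence
parameters `ζ`. Time starts at `0`, so that `x t`, `y t`, `ζ t` belong to the iteration `t + 1`.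
The query is a maximiser over `X` of the acquisition function given the data obtained so far; which
maximiser is taken is decided by a measurable rule `select` that sees only what the algorithm has
seen: the past observations and the values of `ζ` generated so far (which determine the past
queries). -/
structure IsIRGPUCBRun {Ω : Type*} {d : ℕ} (X : Set (Pt d)) (k : Pt d → Pt d → ℝ)
    (f : Ω → Pt d → ℝ) (σ : ℝ≥0) (ε ζ : ℕ → Ω → ℝ) (x : ℕ → Ω → Pt d) (y : ℕ → Ω → ℝ) :
    Prop where
  observe : ∀ t ω, y t ω = f ω (x t ω) + ε t ω
  mem : ∀ t ω, x t ω ∈ X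
  argmax : ∀ t ω, IsMaxOn
    (ucb k σ (fun i : Fin t => x i ω) (fun i : Fin t => y i ω) (ζ t ω)) X (x t ω)
  nonanticipating : ∃ select : (t : ℕ) → (Fin t → ℝ) × (Fin (t + 1) → ℝ) → Pt d,
    (∀ t, Measurable (select t)) ∧
    ∀ t ω, x t ω = select t (fun i : Fin t => y i ω, fun i : Fin (t + 1) => ζ i ω)

/-! ### Simple regret -/

/-- `f(x*) - max_{t ≤ T} f(x_t)` (for `T ≥ 1`). -/
def simpleRegret {Ω : Type*} {d : ℕ} (f : Ω → Pt d → ℝ) (xstar : Ω → Pt d)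
    (x : ℕ → Ω → Pt d) (T : ℕ) (ω : Ω) : ℝ :=
  f ω (xstar ω) - ⨆ t : Fin T, f ω (x t ω)

/-- The Bayesian simple regret `BSR_T`. -/
def BSR {Ω : Type*} [MeasurableSpace Ω] {d : ℕ} (f : Ω → Pt d → ℝ) (P : Measure Ω)
    (xstar : Ω → Pt d) (x : ℕ → Ω → Pt d) (T : ℕ) : ℝ :=
  ∫ ω, simpleRegret f xstar x T ω ∂P

/-! ### Constants -/

/-- `s_η = 2 d log (2 b d r (√(log (a d)) + √π / 2) / η) - 2 log 2`. -/
def shift (d : ℕ) (r a b η : ℝ) : ℝ :=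
  2 * d * Real.log (2 * b * d * r * (√(Real.log (a * d)) + √Real.pi / 2) / η) - 2 * Real.log 2

/-- `C₁ = 2 / log (1 + σ⁻²)`. -/
def C₁ (σ : ℝ≥0) : ℝ := 2 / Real.log (1 + ((σ : ℝ) ^ 2)⁻¹)

/-- `√(C₁ (2 + s_η) γ_T / T)`; the root of a negative number is read as `0`. -/
def widthBound {Ω : Type*} [MeasurableSpace Ω] {d : ℕ} (X : Set (Pt d)) (f : Ω → Pt d → ℝ)
    (P : Measure Ω) (σ : ℝ≥0) (r a b η : ℝ) (T : ℕ) : ℝ :=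
  √(C₁ σ * (2 + shift d r a b η) * (maxInfoGain X f P σ T).toReal / T)

end

end GPBandit

open MeasureTheory ProbabilityTheory Set
open scoped NNReal ENNReal Matrix

namespace GPBandit

/-! ### Tail bounds -/

-- Fix an iteration `t` and a finite `S ⊆ X` with `|S| / 2 ≤ exp (s / 2)`. Given the data, `f z` has
-- law `N(μ(z), σ(z)²)`. If `q ≥ 0` is the least value of `(c - μ(z)) / σ(z)` over `S`, the union
-- bound and the Gaussian tail give `Pr(max_S f > c) ≤ (|S| / 2) exp (-q² / 2) ≤ exp (-(q² - s) /
-- 2)`. The last expression, cut off at 1, is `Pr(ζ > q²)`, and `ζ > q²` lifts the upper confidence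
-- bound above `c` at the minimising point. So at every level `c` the maximum of `f` over `S` is
-- stochastically dominated by the maximum of the randomised upper confidence bound
-- (`min_sum_gaussianReal_le`, `IsAdaptiveModel.meas_exists_lt_le`). No confidence event of high
-- probability is needed. Since `x_t` maximises the bound and `E μ(x_t) = E f(x_t)`, taking means
-- gives `E max_S f - E f(x_t) ≤ E √ζ_t σ(x_t)` (`IsAdaptiveModel.integral_sup_sub_query_le`).
--
-- Averaging over `t` and applying Cauchy-Schwarz leaves the mean of `ζ⁺` times the sum of the
-- posterior variances at the queries. By concavity of the logarithm that sum is at most `C₁` times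
-- the mutual information of the design (`IsPrior.sum_predVar_le`, `IsPrior.infoGain_eq`), hence at
-- most `C₁ γ_T`. Repeated queries are covered because designs of distinct points are dense and the
-- information is continuous.
--
-- A grid with `n` points per axis has `n ^ d` points and loses an amount proportional to `1 / n`
-- and to the mean bound on the partial derivatives. The shift `s_η` is such that the largest
-- admissible `n` makes this loss at most `η / 2`. If `s_η < 0`, then `E ζ⁺ = 2 exp (s_η / 2)`
-- exceeds `2 + s_η`, and a separate interpolation with the trivial bound by the oscillation of `f`
-- is needed (`le_half_add_sqrt`).
--
-- What remains is to justify the Gaussian posterior although queries depend on earlier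
-- observations. The likelihood of observations `y` under an adaptive rule is the likelihood of the
-- fixed design that the rule would choose on seeing `y`. Bayes' rule for fixed designs is proved
-- for every `y`, not only almost every `y`, so the design may be chosen as a function of `y`
-- (`IsPrior.lintegral_mul_designLikelihood`, `IsAdaptiveModel.map_data_prod`).

lemma gaussianReal_zero_Ioi_zero_le (v : ℝ≥0) :
    gaussianReal 0 v (Ioi 0) ≤ ENNReal.ofReal (1 / 2) := by
  have hneg : gaussianReal 0 v (Iio 0) = gaussianReal 0 v (Ioi 0) := by
    have h := gaussianReal_map_neg (μ := 0) (v := v)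
    rw [neg_zero] at h
    conv_lhs => rw [← h, Measure.map_apply measurable_neg measurableSet_Iio]
    congr 1
    ext x; simp
  have hsum : gaussianReal 0 v (Iio 0) + gaussianReal 0 v (Ioi 0) ≤ 1 := by
    rw [← measure_union (by
      rw [Set.disjoint_left]
      intro x hx hx'
      exact lt_asymm (mem_Iio.1 hx) (mem_Ioi.1 hx')) measurableSet_Ioi]
    exact prob_le_one
  rw [hneg, ← two_mul] at hsum
  have h2 : ENNReal.ofReal (1 / 2) = 2⁻¹ := by
    rw [one_div, ENNReal.ofReal_inv_of_pos two_pos]; simp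
  rw [h2, ← one_div, ENNReal.le_div_iff_mul_le (by simp) (by simp), mul_comm]
  exact hsum

/-- The Gaussian tail bound `Q(a) ≤ exp (-a² / 2) / 2`. -/
lemma gaussianReal_Ioi_le (μ : ℝ) {v : ℝ≥0} (hv : v ≠ 0) {b : ℝ} (hb : 0 ≤ b) :
    gaussianReal μ v (Ioi (μ + b)) ≤ ENNReal.ofReal (1 / 2 * Real.exp (-(b ^ 2 / (2 * v)))) := by
  have h0 : gaussianReal μ v (Ioi (μ + b)) = gaussianReal (-b) v (Ioi 0) := by
    have h := gaussianReal_map_const_add (μ := -b) (v := v) (μ + b)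
    rw [show -b + (μ + b) = μ by ring] at h
    rw [← h, Measure.map_apply (measurable_const_add _) measurableSet_Ioi]
    congr 1
    ext x; simp
  -- For `x > 0` and `b ≥ 0` one has `(x + b)² ≥ x² + b²`. The factor `1 / 2` of the tail bound
  -- comes from the mass of the half line.
  have hpdf : ∀ x ∈ Ioi (0 : ℝ), gaussianPDF (-b) v x ≤
      ENNReal.ofReal (Real.exp (-(b ^ 2 / (2 * v)))) * gaussianPDF 0 v x := by
    intro x hx
    rw [gaussianPDF, gaussianPDF, ← ENNReal.ofReal_mul (by positivity)]
    apply ENNReal.ofReal_le_ofReal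
    rw [gaussianPDFReal, gaussianPDFReal, mul_left_comm, ← Real.exp_add]
    gcongr
    have hv' : (0 : ℝ) < v := by positivity
    rw [neg_div, neg_div, ← neg_add, neg_le_neg_iff, ← add_div]
    gcongr
    have : 0 ≤ b * x := mul_nonneg hb (le_of_lt hx)
    nlinarith
  rw [h0, gaussianReal_apply _ hv]
  calc ∫⁻ x in Ioi 0, gaussianPDF (-b) v x
      ≤ ∫⁻ x in Ioi 0, ENNReal.ofReal (Real.exp (-(b ^ 2 / (2 * v)))) * gaussianPDF 0 v x :=
        setLIntegral_mono ((measurable_gaussianPDF _ _).const_mul _) hpdf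
    _ = ENNReal.ofReal (Real.exp (-(b ^ 2 / (2 * v)))) * gaussianReal 0 v (Ioi 0) := by
        rw [lintegral_const_mul _ (measurable_gaussianPDF _ _), ← gaussianReal_apply _ hv]
    _ ≤ ENNReal.ofReal (Real.exp (-(b ^ 2 / (2 * v)))) * ENNReal.ofReal (1 / 2) := by
        gcongr; exact gaussianReal_zero_Ioi_zero_le v
    _ = _ := by rw [← ENNReal.ofReal_mul (by positivity), mul_comm]

-- Tail and mean of the two-parameter exponential law.

instance isProbabilityMeasure_twoParamExp (s : ℝ) :
    IsProbabilityMeasure (twoParamExp s (1 / 2)) := by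
  have := isProbabilityMeasure_expMeasure (r := 1 / 2) (by norm_num)
  exact Measure.isProbabilityMeasure_map (measurable_const_add s).aemeasurable

lemma twoParamExp_Ioi (s c : ℝ) :
    twoParamExp s (1 / 2) (Ioi c) = if s ≤ c then ENNReal.ofReal (Real.exp (-((c - s) / 2)))
      else 1 := by
  have := isProbabilityMeasure_expMeasure (r := 1 / 2) (by norm_num)
  have hpre : (fun z : ℝ => s + z) ⁻¹' Ioi c = (Iic (c - s))ᶜ := by
    ext z; simp [sub_lt_iff_lt_add']
  have hcdf := cdf_expMeasure_eq (r := 1 / 2) (by norm_num) (c - s)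
  rw [cdf_eq_real] at hcdf
  rw [twoParamExp, Measure.map_apply (measurable_const_add s) measurableSet_Ioi, hpre,
    ← ofReal_measureReal (h := measure_ne_top _ _), measureReal_compl measurableSet_Iic, hcdf]
  simp only [sub_nonneg, probReal_univ]
  split_ifs
  · congr 1; ring_nf
  · simp

lemma lintegral_exp_half (s : ℝ) (c : ℝ) :
    ∫⁻ x in Ioi c, ENNReal.ofReal (Real.exp (-((x - s) / 2))) =
      ENNReal.ofReal (2 * Real.exp (-((c - s) / 2))) := by
  have hfun : ∀ x : ℝ, Real.exp (-((x - s) / 2)) = Real.exp (s / 2) * Real.exp (-(1 / 2) * x) := by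
    intro x; rw [← Real.exp_add]; ring_nf
  have hint : IntegrableOn (fun x : ℝ => Real.exp (-((x - s) / 2))) (Ioi c) := by
    simp_rw [hfun]
    exact (integrableOn_exp_mul_Ioi (by norm_num) c).const_mul _
  rw [← ofReal_integral_eq_lintegral_ofReal hint (ae_of_all _ fun _ => (Real.exp_pos _).le)]
  congr 1
  simp_rw [hfun]
  rw [integral_const_mul, integral_exp_mul_Ioi (by norm_num)]
  ring

/-- The mean of `ζ⁺` for `ζ` with law `twoParamExp s (1 / 2)`. -/
lemma lintegral_twoParamExp (s : ℝ) :
    ∫⁻ z, ENNReal.ofReal z ∂twoParamExp s (1 / 2) =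
      ENNReal.ofReal (if 0 ≤ s then 2 + s else 2 * Real.exp (s / 2)) := by
  have h1 : ∫⁻ z, ENNReal.ofReal z ∂twoParamExp s (1 / 2) =
      ∫⁻ c in Ioi 0, twoParamExp s (1 / 2) (Ioi c) := by
    have h := lintegral_eq_lintegral_meas_lt (twoParamExp s (1 / 2))
      (f := fun z => max z 0) (ae_of_all _ fun z => le_max_right _ _)
      (measurable_id.max measurable_const).aemeasurable
    have hl : ∀ z : ℝ, ENNReal.ofReal (max z 0) = ENNReal.ofReal z := by
      intro z; rw [ENNReal.ofReal_max]; simp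
    simp_rw [hl] at h
    rw [h]
    refine setLIntegral_congr_fun measurableSet_Ioi fun c hc => ?_
    congr 1
    ext z
    simp only [mem_ofPred_eq, lt_max_iff, mem_Ioi]
    exact or_iff_left (not_lt.2 (le_of_lt hc))
  rw [h1]
  simp_rw [twoParamExp_Ioi]
  -- For `s ≥ 0` the tail is 1 on `(0, s]`, which contributes `s`, and the exponential part beyond
  -- contributes 2. For `s < 0` only the exponential part from 0 on is left, which gives `2 exp (s /
  -- 2)`.
  split_ifs with hs
  · rw [← Ioc_union_Ioi_eq_Ioi hs, lintegral_union measurableSet_Ioi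
      (by rw [Set.disjoint_left]; intro x hx hx'; exact not_lt.2 hx.2 hx')]
    have e1 : ∫⁻ c in Ioc 0 s, (if s ≤ c then ENNReal.ofReal (Real.exp (-((c - s) / 2))) else 1) =
        ENNReal.ofReal s := by
      have : ∀ c ∈ Ioc 0 s, (if s ≤ c then ENNReal.ofReal (Real.exp (-((c - s) / 2))) else 1) =
          (1 : ℝ≥0∞) := by
        intro c hc
        split_ifs with h
        · rw [le_antisymm hc.2 h]; simp
        · rfl
      rw [setLIntegral_congr_fun measurableSet_Ioc this]
      simp
    have e2 : ∫⁻ c in Ioi s, (if s ≤ c then ENNReal.ofReal (Real.exp (-((c - s) / 2))) else 1) =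
        ENNReal.ofReal 2 := by
      rw [setLIntegral_congr_fun measurableSet_Ioi
        (g := fun c => ENNReal.ofReal (Real.exp (-((c - s) / 2))))
        (fun c hc => if_pos (le_of_lt hc)), lintegral_exp_half]
      simp
    rw [e1, e2, ← ENNReal.ofReal_add hs (by norm_num), add_comm]
  · rw [setLIntegral_congr_fun measurableSet_Ioi
      (g := fun c => ENNReal.ofReal (Real.exp (-((c - s) / 2))))
      (fun c hc => if_pos ((not_le.1 hs).le.trans (le_of_lt hc))), lintegral_exp_half]
    congr 3
    ring

/-- A union bound over `S` for Gaussians is dominated by the tail of the randomised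
upper confidence bound. -/
lemma min_sum_gaussianReal_le {α : Type*} (S : Finset α) (μ : α → ℝ) (v : α → ℝ≥0) (s c : ℝ)
    (hS : (S.card : ℝ) / 2 ≤ Real.exp (s / 2)) :
    min 1 (∑ z ∈ S, gaussianReal (μ z) (v z) (Ioi c)) ≤
      twoParamExp s (1 / 2) {ζ | ∃ z ∈ S, c < μ z + √ζ * √(v z)} := by
  -- If some mean already exceeds `c`, the event on the right is certain, because `√ζ` is
  -- nonnegative even where `ζ < 0`.
  by_cases hc : ∃ z ∈ S, c < μ z
  · obtain ⟨z, hz, hcz⟩ := hc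
    have : {ζ : ℝ | ∃ z ∈ S, c < μ z + √ζ * √(v z)} = univ := by
      ext ζ
      simp only [mem_ofPred_eq, mem_univ, iff_true]
      exact ⟨z, hz, lt_add_of_lt_of_nonneg hcz (by positivity)⟩
    rw [this, measure_univ]
    exact min_le_left _ _
  push Not at hc
  -- Degenerate Gaussians sit at a mean `≤ c` and contribute nothing. Discarding them allows
  -- division by `√(v z)`.
  set S' := S.filter (fun z => v z ≠ 0) with hS'
  have hzero : ∀ z ∈ S, v z = 0 → gaussianReal (μ z) (v z) (Ioi c) = 0 := by
    intro z hz hv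
    rw [hv, gaussianReal_zero_var, Measure.dirac_apply' _ measurableSet_Ioi]
    simp [hc z hz]
  have hsum : ∑ z ∈ S, gaussianReal (μ z) (v z) (Ioi c) =
      ∑ z ∈ S', gaussianReal (μ z) (v z) (Ioi c) := by
    rw [hS', Finset.sum_filter]
    refine Finset.sum_congr rfl fun z hz => ?_
    split_ifs with h
    · rfl
    · exact hzero z hz (not_not.1 h)
  rw [hsum]
  rcases S'.eq_empty_or_nonempty with he | hne
  · simp [he]
  -- `z₀` is the point whose mean lies the fewest standard deviations below `c`. Its quotient `q`
  -- bounds every Gaussian term, and `ζ > q²` alone already produces an exceedance at `z₀`.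
  obtain ⟨z₀, hz₀, hmin⟩ := S'.exists_min_image (fun z => (c - μ z) / √(v z)) hne
  have hz₀S := (Finset.mem_filter.1 hz₀).1
  have hv₀ : (0 : ℝ) < v z₀ := by
    have := (Finset.mem_filter.1 hz₀).2
    positivity
  set q := (c - μ z₀) / √(v z₀) with hq
  have hq0 : 0 ≤ q := div_nonneg (sub_nonneg.2 (hc _ hz₀S)) (Real.sqrt_nonneg _)
  have hterm : ∀ z ∈ S', gaussianReal (μ z) (v z) (Ioi c) ≤
      ENNReal.ofReal (1 / 2 * Real.exp (-(q ^ 2 / 2))) := by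
    intro z hz
    obtain ⟨hzS, hvz⟩ := Finset.mem_filter.1 hz
    have hvz' : (0 : ℝ) < v z := by positivity
    have h := gaussianReal_Ioi_le (μ z) hvz (sub_nonneg.2 (hc z hzS))
    rw [show μ z + (c - μ z) = c by ring] at h
    refine h.trans (ENNReal.ofReal_le_ofReal ?_)
    have h1 : (c - μ z) ^ 2 / (2 * v z) = ((c - μ z) / √(v z)) ^ 2 / 2 := by
      rw [div_pow, Real.sq_sqrt hvz'.le]; field_simp
    rw [h1]
    gcongr
    exact hmin z hz
  have hset : Ioi (q ^ 2) ⊆ {ζ : ℝ | ∃ z ∈ S, c < μ z + √ζ * √(v z)} := by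
    intro ζ hζ
    refine ⟨z₀, hz₀S, ?_⟩
    have h1 : q < √ζ := (Real.lt_sqrt hq0).2 hζ
    have h2 : c - μ z₀ = q * √(v z₀) := by
      rw [hq, div_mul_cancel₀]; positivity
    have h3 : q * √(v z₀) < √ζ * √(v z₀) :=
      mul_lt_mul_of_pos_right h1 (Real.sqrt_pos.2 hv₀)
    linarith
  refine le_trans ?_ (measure_mono hset)
  rw [twoParamExp_Ioi]
  -- If `s ≤ q²`, the sum is at most `(|S| / 2) exp (-q² / 2)` and the hypothesis on the cardinality
  -- turns this into the exponential tail at `q²`. Otherwise that tail is 1 and the truncation by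
  -- `min 1` suffices.
  split_ifs with h
  · refine (min_le_right _ _).trans ((Finset.sum_le_sum hterm).trans ?_)
    rw [Finset.sum_const, nsmul_eq_mul, ← ENNReal.ofReal_natCast, ← ENNReal.ofReal_mul (by simp)]
    apply ENNReal.ofReal_le_ofReal
    have hcard : (S'.card : ℝ) ≤ S.card := by exact_mod_cast Finset.card_filter_le _ _
    calc (S'.card : ℝ) * (1 / 2 * Real.exp (-(q ^ 2 / 2)))
        ≤ (S.card / 2) * Real.exp (-(q ^ 2 / 2)) := by
          rw [← mul_assoc, mul_one_div]; gcongr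
      _ ≤ Real.exp (s / 2) * Real.exp (-(q ^ 2 / 2)) := by gcongr
      _ = _ := by rw [← Real.exp_add]; ring_nf
  · exact min_le_left _ _

/-! ### Expectations from tails -/

/-- First order stochastic dominance orders the means. -/
lemma integral_le_of_meas_lt_le {Ω : Type*} [MeasurableSpace Ω] {P : Measure Ω}
    [IsProbabilityMeasure P] {U V : Ω → ℝ} (hU : Integrable U P) (hV : Integrable V P)
    (h : ∀ c, P {ω | c < U ω} ≤ P {ω | c < V ω}) : ∫ ω, U ω ∂P ≤ ∫ ω, V ω ∂P := by
  have hpos : ∫⁻ ω, ENNReal.ofReal (U ω) ∂P ≤ ∫⁻ ω, ENNReal.ofReal (V ω) ∂P := by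
    have key : ∀ W : Ω → ℝ, AEMeasurable W P →
        ∫⁻ ω, ENNReal.ofReal (W ω) ∂P = ∫⁻ c in Ioi 0, P {ω | c < W ω} := by
      intro W hW
      have h := lintegral_eq_lintegral_meas_lt P (f := fun ω => max (W ω) 0)
        (ae_of_all _ fun z => le_max_right _ _) (hW.max aemeasurable_const)
      have hl : ∀ z : ℝ, ENNReal.ofReal (max z 0) = ENNReal.ofReal z := by
        intro z; rw [ENNReal.ofReal_max]; simp
      simp_rw [hl] at h
      rw [h]
      refine setLIntegral_congr_fun measurableSet_Ioi fun c hc => ?_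
      congr 1
      ext z
      simp only [mem_ofPred_eq, lt_max_iff]
      exact or_iff_left (not_lt.2 (le_of_lt hc))
    rw [key U hU.aemeasurable, key V hV.aemeasurable]
    exact lintegral_mono fun c => h c
  -- The negative parts are compared through complementary events, so the order is reversed.
  have hneg : ∫⁻ ω, ENNReal.ofReal (-V ω) ∂P ≤ ∫⁻ ω, ENNReal.ofReal (-U ω) ∂P := by
    have key : ∀ W : Ω → ℝ, AEMeasurable W P →
        ∫⁻ ω, ENNReal.ofReal (-W ω) ∂P = ∫⁻ c in Ioi 0, P {ω | -c < W ω}ᶜ := by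
      intro W hW
      have h := lintegral_eq_lintegral_meas_le P (f := fun ω => max (-W ω) 0)
        (ae_of_all _ fun z => le_max_right _ _) (hW.neg.max aemeasurable_const)
      have hl : ∀ z : ℝ, ENNReal.ofReal (max z 0) = ENNReal.ofReal z := by
        intro z; rw [ENNReal.ofReal_max]; simp
      simp_rw [hl] at h
      rw [h]
      refine setLIntegral_congr_fun measurableSet_Ioi fun c hc => ?_
      congr 1
      ext z
      simp only [mem_ofPred_eq, le_max_iff, mem_compl_iff, not_lt]
      rw [or_iff_left (not_le.2 hc), le_neg]
    rw [key U hU.aemeasurable, key V hV.aemeasurable]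
    refine lintegral_mono fun c => ?_
    rw [prob_compl_eq_one_sub₀ (nullMeasurableSet_lt aemeasurable_const hU.aemeasurable),
      prob_compl_eq_one_sub₀ (nullMeasurableSet_lt aemeasurable_const hV.aemeasurable)]
    exact tsub_le_tsub_left (h _) _
  rw [integral_eq_lintegral_pos_part_sub_lintegral_neg_part hU,
    integral_eq_lintegral_pos_part_sub_lintegral_neg_part hV]
  have t1 := ENNReal.toReal_mono hV.lintegral_lt_top.ne hpos
  have t2 := ENNReal.toReal_mono hU.neg.lintegral_lt_top.ne hneg
  simp only [Pi.neg_apply] at t2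
  linarith

/-- A nonnegative variable with a sub-Gaussian tail has a mean bounded accordingly. -/
lemma integrable_and_integral_le_of_tail {Ω : Type*} [MeasurableSpace Ω] {P : Measure Ω}
    [IsProbabilityMeasure P] {R : Ω → ℝ} (hR : AEMeasurable R P) (hR0 : 0 ≤ᵐ[P] R)
    {D A b : ℝ} (hD : 0 ≤ D) (hb : 0 < b)
    (h : ∀ L : ℝ, 0 < L → P {ω | D * L < R ω} ≤ ENNReal.ofReal (A * Real.exp (-(L / b) ^ 2))) :
    Integrable R P ∧ ∫ ω, R ω ∂P ≤ D * (b * (√(Real.log A) + √Real.pi / 2)) := by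
  set q := √(Real.log A) with hq
  have hq0 : 0 ≤ q := Real.sqrt_nonneg _
  -- For `A ≤ 1` the root is 0, by the convention for roots of negative numbers where `log A < 0`,
  -- and the bound still holds.
  have hAq : A ≤ Real.exp (q ^ 2) := by
    rcases le_or_gt A 1 with h1 | h1
    · exact h1.trans (Real.one_le_exp (sq_nonneg _))
    · rw [hq, Real.sq_sqrt (Real.log_nonneg h1.le), Real.exp_log (by linarith)]
  -- `D` may be 0, so the estimate is made with a strictly larger `E`, by which one can divide, and
  -- `E` tends to `D` at the end.
  have hpos : ∀ E : ℝ, D < E → ∫⁻ ω, ENNReal.ofReal (R ω) ∂P ≤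
      ENNReal.ofReal (E * (b * (q + √Real.pi / 2))) := by
    intro E hDE
    have hE : 0 < E := hD.trans_lt hDE
    -- Below `c₀` the tail bound may exceed 1 and is not used; the excess over `c₀` has a Gaussian
    -- tail without prefactor, whose integral gives the term with `√π / 2`.
    set c₀ := E * (b * q) with hc₀
    have hc₀0 : 0 ≤ c₀ := by positivity
    have htail : ∀ t : ℝ, 0 < t → P {ω | t < max (R ω - c₀) 0} ≤
        ENNReal.ofReal (Real.exp (-(1 / (E * b)) ^ 2 * t ^ 2)) := by
      intro t ht
      have hL : 0 < (c₀ + t) / E := by positivity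
      have hsub : {ω | t < max (R ω - c₀) 0} ⊆ {ω | D * ((c₀ + t) / E) < R ω} := by
        intro ω hω
        rw [mem_ofPred_eq] at hω
        rcases lt_max_iff.1 hω with h1 | h1
        · have h2 : D * ((c₀ + t) / E) ≤ E * ((c₀ + t) / E) := by gcongr
          have h3 : E * ((c₀ + t) / E) = c₀ + t := by field_simp
          simp only [mem_ofPred_eq]
          linarith
        · exact absurd h1 (not_lt.2 ht.le)
      refine (measure_mono hsub).trans ((h _ hL).trans (ENNReal.ofReal_le_ofReal ?_))
      have h4 : (c₀ + t) / E / b = q + t * (1 / (E * b)) := by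
        rw [hc₀]; field_simp
      rw [h4]
      -- The prefactor is at most `exp (q²)`, which cancels the square of `q` in the exponent. The
      -- remaining cross term has the right sign.
      calc A * Real.exp (-(q + t * (1 / (E * b))) ^ 2)
          ≤ Real.exp (q ^ 2) * Real.exp (-(q + t * (1 / (E * b))) ^ 2) := by gcongr
        _ = Real.exp (q ^ 2 + -(q + t * (1 / (E * b))) ^ 2) := by rw [Real.exp_add]
        _ ≤ _ := by
          apply Real.exp_le_exp.2
          have : 0 ≤ q * (t * (1 / (E * b))) := by positivity
          nlinarith
    have hexc : ∫⁻ ω, ENNReal.ofReal (max (R ω - c₀) 0) ∂P ≤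
        ENNReal.ofReal (E * b * (√Real.pi / 2)) := by
      rw [lintegral_eq_lintegral_meas_lt P (f := fun ω => max (R ω - c₀) 0)
        (ae_of_all _ fun ω => le_max_right _ _)
        ((hR.sub_const _).max aemeasurable_const)]
      refine (setLIntegral_mono (by fun_prop) fun t ht => htail t (mem_Ioi.1 ht)).trans ?_
      have hβ : 0 < (1 / (E * b)) ^ 2 := by positivity
      rw [← ofReal_integral_eq_lintegral_ofReal
        ((integrable_exp_neg_mul_sq hβ).integrableOn)
        (ae_of_all _ fun _ => (Real.exp_pos _).le), integral_gaussian_Ioi]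
      apply ENNReal.ofReal_le_ofReal
      apply le_of_eq
      rw [Real.sqrt_div Real.pi_pos.le, Real.sqrt_sq (by positivity)]
      field_simp
    calc ∫⁻ ω, ENNReal.ofReal (R ω) ∂P
        ≤ ∫⁻ ω, (ENNReal.ofReal c₀ + ENNReal.ofReal (max (R ω - c₀) 0)) ∂P := by
          refine lintegral_mono fun ω => ?_
          rw [← ENNReal.ofReal_add hc₀0 (le_max_right _ _)]
          apply ENNReal.ofReal_le_ofReal
          have := le_max_left (R ω - c₀) 0
          linarith
      _ = ENNReal.ofReal c₀ + ∫⁻ ω, ENNReal.ofReal (max (R ω - c₀) 0) ∂P := by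
          rw [lintegral_add_left measurable_const]; simp
      _ ≤ ENNReal.ofReal c₀ + ENNReal.ofReal (E * b * (√Real.pi / 2)) := by gcongr
      _ = _ := by
          rw [← ENNReal.ofReal_add hc₀0 (by positivity), hc₀]
          ring_nf
  have hK : 0 < b * (q + √Real.pi / 2) := by
    have := Real.sqrt_pos.2 Real.pi_pos
    positivity
  have hint : Integrable R P := by
    refine ⟨hR.aestronglyMeasurable, ?_⟩
    rw [hasFiniteIntegral_iff_ofReal hR0]
    exact (hpos (D + 1) (by linarith)).trans_lt ENNReal.ofReal_lt_top
  refine ⟨hint, le_of_forall_pos_le_add fun δ hδ => ?_⟩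
  have h1 := hpos (D + δ / (b * (q + √Real.pi / 2))) (by
    have : 0 < δ / (b * (q + √Real.pi / 2)) := by positivity
    linarith)
  rw [← ofReal_integral_eq_lintegral_ofReal hint hR0,
    ENNReal.ofReal_le_ofReal_iff (by positivity), add_mul,
    div_mul_cancel₀ _ hK.ne'] at h1
  exact h1

/-! ### Sequential observations -/

/-- The observations `y_t = m_t (y_0, …, y_{t - 1}) + e_t`. -/
def observations (m : (t : ℕ) → (Fin t → ℝ) → ℝ) : (t : ℕ) → (Fin t → ℝ) → (Fin t → ℝ)
  | 0, _ => Fin.elim0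
  | t + 1, e => Fin.snoc (α := fun _ => ℝ) (observations m t (Fin.init e))
      (m t (observations m t (Fin.init e)) + e (Fin.last t))

/-- The first `i` entries of `y`. -/
def past {α : Type*} {t : ℕ} (y : Fin t → α) (i : Fin t) : Fin i → α :=
  fun j => y ⟨j, j.2.trans i.2⟩

/-- The likelihood of the observations `y` for the conditional means `m` and the noise
variance `v`. -/
noncomputable def likelihood (m : (t : ℕ) → (Fin t → ℝ) → ℝ) (v : ℝ≥0) (t : ℕ) (y : Fin t → ℝ) :
    ℝ≥0∞ :=
  ∏ i : Fin t, gaussianPDF (m i (past y i)) v (y i)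

-- Measurability and density of the recursion.

lemma measurable_gaussianPDF_comp {α : Type*} [MeasurableSpace α] {m x : α → ℝ}
    (hm : Measurable m) (v : ℝ≥0) (hx : Measurable x) :
    Measurable fun a => gaussianPDF (m a) v (x a) :=
  measurable_uncurry_gaussianPDF.comp (hm.prodMk (measurable_const.prodMk hx))

lemma measurable_past {α β : Type*} [MeasurableSpace α] [MeasurableSpace β] {t : ℕ} (i : Fin t)
    {g : α → Fin t → β} (hg : Measurable g) : Measurable fun a => past (g a) i :=
  measurable_pi_lambda _ fun _ => (measurable_pi_apply _).comp hg

lemma measurable_snoc {α : Type*} [MeasurableSpace α] {t : ℕ} {h : α → Fin t → ℝ} {u : α → ℝ}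
    (hh : Measurable h) (hu : Measurable u) :
    Measurable fun a => (Fin.snoc (α := fun _ => ℝ) (h a) (u a) : Fin (t + 1) → ℝ) := by
  refine measurable_pi_lambda _ fun i => ?_
  refine Fin.lastCases ?_ (fun j => ?_) i
  · simpa using hu
  · simpa using measurable_pi_iff.1 hh j

lemma measurable_init {t : ℕ} :
    Measurable fun e : Fin (t + 1) → ℝ => (Fin.init e : Fin t → ℝ) :=
  measurable_pi_lambda _ fun i => measurable_pi_apply i.castSucc

lemma measurable_observations {Θ : Type*} [MeasurableSpace Θ]
    {m : Θ → (t : ℕ) → (Fin t → ℝ) → ℝ}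
    (hm : ∀ t, Measurable fun p : Θ × (Fin t → ℝ) => m p.1 t p.2) (t : ℕ) :
    Measurable fun p : Θ × (Fin t → ℝ) => observations (m p.1) t p.2 := by
  induction t with
  | zero => exact measurable_pi_lambda _ fun i => i.elim0
  | succ t ih =>
    have h1 : Measurable fun p : Θ × (Fin (t + 1) → ℝ) =>
        observations (m p.1) t (Fin.init p.2) :=
      ih.comp (measurable_fst.prodMk (measurable_init.comp measurable_snd))
    exact measurable_snoc h1 (((hm t).comp (measurable_fst.prodMk h1)).add
      ((measurable_pi_apply _).comp measurable_snd))

lemma measurable_likelihood {Θ : Type*} [MeasurableSpace Θ]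
    {m : Θ → (t : ℕ) → (Fin t → ℝ) → ℝ}
    (hm : ∀ t, Measurable fun p : Θ × (Fin t → ℝ) => m p.1 t p.2) (v : ℝ≥0) (t : ℕ) :
    Measurable fun p : Θ × (Fin t → ℝ) => likelihood (m p.1) v t p.2 := by
  unfold likelihood
  refine Finset.measurable_prod _ fun i _ => ?_
  exact measurable_gaussianPDF_comp
    ((hm i).comp (measurable_fst.prodMk (measurable_past i measurable_snd))) v
    ((measurable_pi_apply i).comp measurable_snd)

lemma likelihood_snoc (m : (t : ℕ) → (Fin t → ℝ) → ℝ) (v : ℝ≥0) (t : ℕ) (h : Fin t → ℝ) (u : ℝ) :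
    likelihood m v (t + 1) (Fin.snoc (α := fun _ => ℝ) h u) =
      likelihood m v t h * gaussianPDF (m t h) v u := by
  unfold likelihood
  rw [Fin.prod_univ_castSucc]
  congr 1
  · refine Finset.prod_congr rfl fun i _ => ?_
    have : past (Fin.snoc (α := fun _ => ℝ) h u : Fin (t + 1) → ℝ) i.castSucc = past h i := by
      funext j
      exact Fin.snoc_castSucc (α := fun _ => ℝ) u h ⟨j, j.2.trans i.2⟩
    rw [Fin.snoc_castSucc, this]
    rfl
  · have : past (Fin.snoc (α := fun _ => ℝ) h u : Fin (t + 1) → ℝ) (Fin.last t) = h := by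
      funext j
      exact Fin.snoc_castSucc (α := fun _ => ℝ) u h j
    rw [Fin.snoc_last, this]
    rfl

lemma lintegral_pi_succ (μ : Measure ℝ) [SigmaFinite μ] (t : ℕ)
    {g : (Fin (t + 1) → ℝ) → ℝ≥0∞} (hg : Measurable g) :
    ∫⁻ e, g e ∂Measure.pi (fun _ : Fin (t + 1) => μ) =
      ∫⁻ h, ∫⁻ u, g (Fin.snoc (α := fun _ => ℝ) h u) ∂μ ∂Measure.pi (fun _ : Fin t => μ) := by
  have hmp := (measurePreserving_piFinSuccAbove (fun _ : Fin (t + 1) => μ) (Fin.last t)).symm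
  rw [← hmp.lintegral_comp hg]
  refine (lintegral_prod_symm' _ (hg.comp hmp.measurable)).trans ?_
  refine lintegral_congr fun h => lintegral_congr fun u => ?_
  exact congrArg g (Fin.insertNth_last' _ _)

lemma measurable_observations_const {m : (t : ℕ) → (Fin t → ℝ) → ℝ} (hm : ∀ t, Measurable (m t))
    (t : ℕ) : Measurable (observations m t) :=
  (measurable_observations (Θ := Unit) (m := fun _ => m) (fun t => (hm t).comp measurable_snd)
    t).comp (measurable_prodMk_left (x := ()))

lemma measurable_likelihood_const {m : (t : ℕ) → (Fin t → ℝ) → ℝ} (hm : ∀ t, Measurable (m t))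
    (v : ℝ≥0) (t : ℕ) : Measurable (likelihood m v t) := by
  unfold likelihood
  refine Finset.measurable_prod _ fun i _ => ?_
  exact measurable_gaussianPDF_comp ((hm i).comp (measurable_past i measurable_id)) v
    (measurable_pi_apply i)

/-- The law of the observations, for i.i.d. Gaussian noise, has density `likelihood`. -/
lemma lintegral_observations {m : (t : ℕ) → (Fin t → ℝ) → ℝ} (hm : ∀ t, Measurable (m t))
    {v : ℝ≥0} (hv : v ≠ 0) (t : ℕ) {g : (Fin t → ℝ) → ℝ≥0∞} (hg : Measurable g) :
    ∫⁻ e, g (observations m t e) ∂Measure.pi (fun _ : Fin t => gaussianReal 0 v) =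
      ∫⁻ y, g y * likelihood m v t y := by
  have hobs := measurable_observations_const hm
  have hlik := measurable_likelihood_const hm v
  induction t with
  | zero =>
    have e1 : ∀ e, g (observations m 0 e) = g Fin.elim0 := fun _ =>
      congrArg g (Subsingleton.elim _ _)
    have e2 : ∀ y : Fin 0 → ℝ, g y * likelihood m v 0 y = g Fin.elim0 := fun y => by
      rw [Subsingleton.elim y Fin.elim0]; simp [likelihood]
    simp_rw [e1, e2]
    rw [lintegral_const, lintegral_const, volume_pi, Measure.pi_of_empty _ Fin.elim0,
      Measure.pi_of_empty _ Fin.elim0]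
  | succ t ih =>
    rw [volume_pi, lintegral_pi_succ _ t (g := fun e => g (observations m (t + 1) e)) (hg.comp (hobs _)),
      lintegral_pi_succ _ t (g := fun e => g e * likelihood m v (t + 1) e) (hg.mul (hlik _))]
    have hsn : Measurable fun p : (Fin t → ℝ) × ℝ =>
        (Fin.snoc (α := fun _ => ℝ) p.1 p.2 : Fin (t + 1) → ℝ) :=
      measurable_snoc measurable_fst measurable_snd
    have hG : Measurable fun h : Fin t → ℝ => ∫⁻ u, g (Fin.snoc (α := fun _ => ℝ) h u) *
        gaussianPDF (m t h) v u := by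
      refine Measurable.lintegral_prod_right' (f := fun p : (Fin t → ℝ) × ℝ =>
        g (Fin.snoc (α := fun _ => ℝ) p.1 p.2) * gaussianPDF (m t p.1) v p.2) ?_
      exact (hg.comp hsn).mul (measurable_gaussianPDF_comp
        ((hm t).comp measurable_fst) v measurable_snd)
    -- With the first `t` observations fixed, the last one is the noise translated by its
    -- conditional mean.
    have hstep : ∀ h : Fin t → ℝ, ∫⁻ u, g (observations m (t + 1) (Fin.snoc (α := fun _ => ℝ) h u))
        ∂gaussianReal 0 v = ∫⁻ u, g (Fin.snoc (α := fun _ => ℝ) (observations m t h) u) *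
          gaussianPDF (m t (observations m t h)) v u := by
      intro h
      set h' := observations m t h
      have hgs : Measurable fun u : ℝ => g (Fin.snoc (α := fun _ => ℝ) h' u) :=
        hg.comp (hsn.comp (measurable_const.prodMk measurable_id))
      have e1 : ∀ u, observations m (t + 1) (Fin.snoc (α := fun _ => ℝ) h u) =
          Fin.snoc (α := fun _ => ℝ) h' (m t h' + u) := by
        intro u
        simp [observations, h']
      simp_rw [e1]
      have hmap := gaussianReal_map_const_add (μ := 0) (v := v) (m t h')
      rw [zero_add] at hmap
      rw [← lintegral_map (f := fun u => g (Fin.snoc (α := fun _ => ℝ) h' u)) hgs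
        (measurable_const_add _), hmap, gaussianReal_of_var_ne_zero _ hv,
        lintegral_withDensity_eq_lintegral_mul _ (measurable_gaussianPDF _ _) hgs]
      refine lintegral_congr fun u => ?_
      simp [mul_comm]
    simp_rw [likelihood_snoc]
    calc _ = ∫⁻ h, (∫⁻ u, g (Fin.snoc (α := fun _ => ℝ) (observations m t h) u) *
          gaussianPDF (m t (observations m t h)) v u)
            ∂Measure.pi (fun _ : Fin t => gaussianReal 0 v) := lintegral_congr hstep
      _ = ∫⁻ y : Fin t → ℝ, (∫⁻ u, g (Fin.snoc (α := fun _ => ℝ) y u) * gaussianPDF (m t y) v u) *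
          likelihood m v t y := ih hG
      _ = _ := by
        refine lintegral_congr fun h => ?_
        rw [← lintegral_mul_const _ ?_]
        · refine lintegral_congr fun u => ?_
          ring
        · exact ((hg.comp hsn).comp (measurable_const.prodMk measurable_id)).mul
            (measurable_gaussianPDF _ _)

/-! ### Gaussian priors on continuous paths -/

/-- Continuous functions on `X`, with the σ-algebra generated by the evaluations. -/
abbrev Path {d : ℕ} (X : Set (Pt d)) : Type := {φ : X → ℝ // Continuous φ}

/-- `Q` is the law of a centered Gaussian process with covariance `k` and continuous paths. -/
structure IsPrior {d : ℕ} {X : Set (Pt d)} (k : Pt d → Pt d → ℝ) (Q : Measure (Path X)) :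
    Prop where
  isProbabilityMeasure : IsProbabilityMeasure Q
  gaussian : IsGaussianProcess (fun (z : X) (φ : Path X) => φ.1 z) Q
  mean_zero : ∀ z : X, ∫ φ, φ.1 z ∂Q = 0
  covariance_eq : ∀ z w : X, cov[fun φ => φ.1 z, fun φ => φ.1 w; Q] = k z w

variable {d : ℕ} {X : Set (Pt d)} {k : Pt d → Pt d → ℝ} {Q : Measure (Path X)}

/-- Continuity in the point and measurability in the path give joint measurability. Evaluation at
random queries needs this, and for this reason `Path X` contains continuous functions only. -/
lemma measurable_eval : Measurable fun p : Path X × X => p.1.1 p.2 :=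
  (measurable_uncurry_of_continuous_of_measurable (u := fun (z : X) (φ : Path X) => φ.1 z)
    (fun φ => φ.2) fun z => (measurable_pi_apply z).comp measurable_subtype_coe).comp
    measurable_swap

lemma measurable_eval_const (z : X) : Measurable fun φ : Path X => φ.1 z :=
  (measurable_pi_apply z).comp measurable_subtype_coe

namespace IsPrior

lemma memLp (hQ : IsPrior k Q) (z : X) : MemLp (fun φ : Path X => φ.1 z) 2 Q :=
  (hQ.gaussian.hasGaussianLaw_eval z).memLp_two

lemma symm (hQ : IsPrior k Q) (z w : X) : k z w = k w z := by
  rw [← hQ.covariance_eq, covariance_comm, hQ.covariance_eq]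

lemma hasGaussianLaw_pi (hQ : IsPrior k Q) {ι : Type*} [Fintype ι] (xs : ι → X) :
    HasGaussianLaw (fun (φ : Path X) i => φ.1 (xs i)) Q := by
  classical
  have h := (hQ.gaussian.comp_right xs).hasGaussianLaw Finset.univ
  exact h.map (ContinuousLinearMap.pi fun i =>
    ContinuousLinearMap.proj (R := ℝ) (φ := fun _ : (Finset.univ : Finset ι) => ℝ)
      ⟨i, Finset.mem_univ i⟩)

/-- The quadratic form at `x` is the variance of `∑ i, x i * f (xs i)`. -/
lemma posSemidef (hQ : IsPrior k Q) {n : ℕ} (xs : Fin n → X) :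
    (Matrix.of fun i j => k (xs i) (xs j) : Matrix (Fin n) (Fin n) ℝ).PosSemidef := by
  have := hQ.isProbabilityMeasure
  refine Matrix.PosSemidef.of_dotProduct_mulVec_nonneg ?_ fun x => ?_
  · ext i j
    simpa using hQ.symm (xs j) (xs i)
  · have hv : Var[fun φ : Path X => ∑ i, x i * φ.1 (xs i); Q] =
        star x ⬝ᵥ ((Matrix.of fun i j => k (xs i) (xs j) : Matrix (Fin n) (Fin n) ℝ) *ᵥ x) := by
      have hm : ∀ i, MemLp (fun φ : Path X => x i * φ.1 (xs i)) 2 Q := fun i =>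
        (hQ.memLp (xs i)).const_mul _
      rw [← covariance_self (memLp_finsetSum _ fun i _ => hm i).aestronglyMeasurable.aemeasurable,
        covariance_fun_sum_fun_sum hm hm]
      simp only [dotProduct, Matrix.mulVec, Matrix.of_apply, Finset.mul_sum,
        covariance_const_mul_left, covariance_const_mul_right, hQ.covariance_eq, star_trivial]
      exact Finset.sum_congr rfl fun i _ => Finset.sum_congr rfl fun j _ => by ring
    rw [← hv]
    exact variance_nonneg _ _

lemma posDef_regGram (hQ : IsPrior k Q) {σ : ℝ≥0} (hσ : 0 < σ) {n : ℕ} (xs : Fin n → X) :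
    (regGram k σ (fun i => (xs i : Pt d))).PosDef :=
  (Matrix.PosDef.one.smul (by positivity : (0 : ℝ) < (σ : ℝ) ^ 2)).posSemidef_add
    (hQ.posSemidef xs)

end IsPrior

/-- The weights of the observations in the posterior mean. -/
noncomputable def postWeights {n : ℕ} (k : Pt d → Pt d → ℝ) (σ : ℝ≥0) (xs : Fin n → Pt d)
    (z : Pt d) : Fin n → ℝ :=
  (regGram k σ xs)⁻¹ *ᵥ fun i => k z (xs i)

lemma IsPrior.isSymm_inv (hQ : IsPrior k Q) {σ : ℝ≥0} (hσ : 0 < σ) {n : ℕ} (xs : Fin n → X) :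
    ((regGram k σ (fun i => (xs i : Pt d)))⁻¹)ᵀ = (regGram k σ (fun i => (xs i : Pt d)))⁻¹ := by
  have := (hQ.posDef_regGram hσ xs).inv.isHermitian
  rwa [Matrix.IsHermitian, Matrix.conjTranspose_eq_transpose_of_trivial] at this

lemma IsPrior.postMean_eq (hQ : IsPrior k Q) {σ : ℝ≥0} (hσ : 0 < σ) {n : ℕ} (xs : Fin n → X)
    (ys : Fin n → ℝ) (z : X) :
    postMean k σ (fun i => (xs i : Pt d)) ys z =
      ∑ i, postWeights k σ (fun i => (xs i : Pt d)) z i * ys i := by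
  rw [postMean, Matrix.dotProduct_mulVec, ← Matrix.mulVec_transpose, hQ.isSymm_inv hσ]
  rfl

/-- These are the normal equations of linear prediction; they make the residual uncorrelated with
every observation. -/
lemma IsPrior.regGram_mulVec_postWeights (hQ : IsPrior k Q) {σ : ℝ≥0} (hσ : 0 < σ) {n : ℕ}
    (xs : Fin n → X) (z : X) :
    regGram k σ (fun i => (xs i : Pt d)) *ᵥ postWeights k σ (fun i => (xs i : Pt d)) z =
      fun i => k z (xs i) := by
  have hu := (hQ.posDef_regGram hσ xs).isUnit
  rw [Matrix.isUnit_iff_isUnit_det] at hu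
  rw [postWeights, Matrix.mulVec_mulVec, Matrix.mul_nonsing_inv _ hu, Matrix.one_mulVec]

/-! ### The posterior for a fixed design -/

lemma observations_const (a : ℕ → ℝ) (t : ℕ) (e : Fin t → ℝ) :
    observations (fun t _ => a t) t e = fun i : Fin t => a i + e i := by
  induction t with
  | zero => exact Subsingleton.elim _ _
  | succ t ih =>
    funext i
    refine Fin.lastCases ?_ (fun j => ?_) i
    · simp [observations]
    · simp [observations, ih, Fin.init]

/-- A fixed design is the sequential scheme whose conditional means ignore the past. -/
lemma lintegral_add_gaussian {n : ℕ} (a : Fin n → ℝ) {v : ℝ≥0} (hv : v ≠ 0)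
    {g : (Fin n → ℝ) → ℝ≥0∞} (hg : Measurable g) :
    ∫⁻ e, g (fun i => a i + e i) ∂Measure.pi (fun _ : Fin n => gaussianReal 0 v) =
      ∫⁻ y, g y * ∏ i, gaussianPDF (a i) v (y i) := by
  have h := lintegral_observations (m := fun t _ => if h : t < n then a ⟨t, h⟩ else 0)
    (fun t => measurable_const) hv n hg
  simp_rw [observations_const (fun t => if h : t < n then a ⟨t, h⟩ else 0)] at h
  simpa [likelihood] using h

/-- Two independent Gaussian vectors are jointly Gaussian. The joint law is needed because only
there does vanishing covariance imply independence. -/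
lemma IsPrior.hasGaussianLaw_design (hQ : IsPrior k Q) (v : ℝ≥0) {n : ℕ} (xs : Fin n → X) (z : X) :
    HasGaussianLaw (fun p : Path X × (Fin n → ℝ) =>
      ((p.1.1 z, fun i => p.1.1 (xs i)), p.2))
      (Q.prod (Measure.pi fun _ : Fin n => gaussianReal 0 v)) := by
  have := hQ.isProbabilityMeasure
  have h1 : HasGaussianLaw (fun (φ : Path X) => (φ.1 z, fun i => φ.1 (xs i))) Q := by
    have h := hQ.hasGaussianLaw_pi (Fin.cons (α := fun _ => X) z xs)
    exact h.map ((ContinuousLinearMap.proj (R := ℝ) (φ := fun _ : Fin (n + 1) => ℝ) 0).prod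
      (ContinuousLinearMap.pi fun i =>
        ContinuousLinearMap.proj (R := ℝ) (φ := fun _ : Fin (n + 1) => ℝ) (Fin.succ i)))
  have h2 : HasGaussianLaw (fun e : Fin n → ℝ => e)
      (Measure.pi fun _ : Fin n => gaussianReal 0 v) := by
    refine iIndepFun.hasGaussianLaw (X := fun i (e : Fin n → ℝ) => e i) (fun i => ?_)
      (iIndepFun_pi (X := fun _ => id) fun _ => aemeasurable_id)
    have : (Measure.pi fun _ : Fin n => gaussianReal 0 v).map (fun e => e i) = gaussianReal 0 v :=
      (measurePreserving_eval (fun _ : Fin n => gaussianReal 0 v) i).map_eq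
    exact ⟨by rw [this]; infer_instance⟩
  refine IndepFun.hasGaussianLaw (X := fun p : Path X × (Fin n → ℝ) =>
      (p.1.1 z, fun i => p.1.1 (xs i))) (Y := fun p => p.2) ?_ ?_ ?_
  · refine ⟨?_⟩
    have hm := (measurePreserving_fst (μ := Q)
      (ν := Measure.pi fun _ : Fin n => gaussianReal 0 v)).map_eq
    have h := h1.isGaussian_map
    rw [← hm, Measure.map_map (by
      exact (measurable_eval_const z).prodMk (measurable_pi_lambda _ fun i =>
        measurable_eval_const (xs i))) measurable_fst] at h
    exact h
  · refine ⟨?_⟩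
    have hm := (measurePreserving_snd (μ := Q)
      (ν := Measure.pi fun _ : Fin n => gaussianReal 0 v)).map_eq
    rw [hm]
    simpa using h2.isGaussian_map
  · exact indepFun_prod (X := fun φ : Path X => (φ.1 z, fun i => φ.1 (xs i))) (Y := id)
      ((measurable_eval_const z).prodMk (measurable_pi_lambda _ fun i =>
        measurable_eval_const (xs i))) measurable_id

-- Second moments of values, noise and residual, then Bayes' rule.

section FixedDesign

variable {n : ℕ} (xs : Fin n → X) (z : X) (σ : ℝ≥0)

/-- The joint law of the path and of the noise at `n` points. -/
noncomputable def designMeasure (Q : Measure (Path X)) (σ : ℝ≥0) (n : ℕ) :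
    Measure (Path X × (Fin n → ℝ)) :=
  Q.prod (Measure.pi fun _ : Fin n => gaussianReal 0 (σ ^ 2))

lemma IsPrior.memLp_fst (hQ : IsPrior k Q) (z : X) :
    MemLp (fun p : Path X × (Fin n → ℝ) => p.1.1 z) 2 (designMeasure Q σ n) :=
  (hQ.hasGaussianLaw_design (σ ^ 2) (fun _ : Fin n => z) z).fst.fst.memLp_two

lemma IsPrior.memLp_noise (hQ : IsPrior k Q) (z : X) (i : Fin n) :
    MemLp (fun p : Path X × (Fin n → ℝ) => p.2 i) 2 (designMeasure Q σ n) :=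
  ((hQ.hasGaussianLaw_design (σ ^ 2) (fun _ : Fin n => z) z).snd.eval i).memLp_two

lemma IsPrior.covariance_fst_fst (hQ : IsPrior k Q) (z w : X) :
    cov[fun p : Path X × (Fin n → ℝ) => p.1.1 z, fun p => p.1.1 w; designMeasure Q σ n] =
      k z w := by
  have := hQ.isProbabilityMeasure
  have hm := (measurePreserving_fst (μ := Q)
      (ν := Measure.pi fun _ : Fin n => gaussianReal 0 (σ ^ 2)))
  rw [← hQ.covariance_eq z w]
  conv_rhs => rw [← hm.map_eq]
  rw [covariance_map_fun (measurable_eval_const z).aestronglyMeasurable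
    (measurable_eval_const w).aestronglyMeasurable measurable_fst.aemeasurable]
  rfl

lemma IsPrior.covariance_fst_noise (hQ : IsPrior k Q) (z : X) (i : Fin n) :
    cov[fun p : Path X × (Fin n → ℝ) => p.1.1 z, fun p => p.2 i; designMeasure Q σ n] = 0 := by
  have := hQ.isProbabilityMeasure
  refine IndepFun.covariance_eq_zero ?_ (hQ.memLp_fst σ z) (hQ.memLp_noise σ z i)
  exact indepFun_prod (X := fun φ : Path X => φ.1 z) (Y := fun e : Fin n → ℝ => e i)
    (measurable_eval_const z) (measurable_pi_apply i)

lemma IsPrior.covariance_noise_noise (hQ : IsPrior k Q) (i j : Fin n) :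
    cov[fun p : Path X × (Fin n → ℝ) => p.2 i, fun p => p.2 j; designMeasure Q σ n] =
      if i = j then (σ : ℝ) ^ 2 else 0 := by
  have := hQ.isProbabilityMeasure
  have hm := (measurePreserving_snd (μ := Q)
      (ν := Measure.pi fun _ : Fin n => gaussianReal 0 (σ ^ 2)))
  have hm' := measurePreserving_eval (fun _ : Fin n => gaussianReal 0 (σ ^ 2))
  have hml : ∀ i, MemLp (fun e : Fin n → ℝ => e i) 2
      (Measure.pi fun _ : Fin n => gaussianReal 0 (σ ^ 2)) := fun i =>
    (memLp_id_gaussianReal 2).comp_measurePreserving (hm' i)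
  have hcov : cov[fun p : Path X × (Fin n → ℝ) => p.2 i, fun p => p.2 j; designMeasure Q σ n] =
      cov[fun e : Fin n → ℝ => e i, fun e => e j;
        Measure.pi fun _ : Fin n => gaussianReal 0 (σ ^ 2)] := by
    conv_rhs => rw [← hm.map_eq]
    rw [covariance_map_fun (measurable_pi_apply i).aestronglyMeasurable
      (measurable_pi_apply j).aestronglyMeasurable measurable_snd.aemeasurable]
    rfl
  rw [hcov]
  split_ifs with h
  · subst h
    rw [covariance_self (measurable_pi_apply i).aemeasurable]
    have h2 := variance_fun_id_gaussianReal (μ := 0) (v := σ ^ 2)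
    rw [← (hm' i).map_eq, variance_map aemeasurable_id' (measurable_pi_apply i).aemeasurable] at h2
    simpa [Function.comp_def] using h2
  · exact ((iIndepFun_pi (X := fun _ : Fin n => (id : ℝ → ℝ))
      (μ := fun _ : Fin n => gaussianReal 0 (σ ^ 2))
      fun _ => aemeasurable_id).indepFun h).covariance_eq_zero (hml i) (hml j)

/-- The noisy observation at the `i`-th point. -/
def noisyObs (p : Path X × (Fin n → ℝ)) (i : Fin n) : ℝ := p.1.1 (xs i) + p.2 i

/-- The deviation of the value at `z` from its posterior mean. -/
noncomputable def residual (k : Pt d → Pt d → ℝ) (p : Path X × (Fin n → ℝ)) : ℝ :=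
  p.1.1 z - ∑ i, postWeights k σ (fun i => (xs i : Pt d)) z i * noisyObs xs p i

lemma measurable_noisyObs : Measurable (noisyObs xs) :=
  measurable_pi_lambda _ fun i => ((measurable_eval_const (xs i)).comp measurable_fst).add
    ((measurable_pi_apply i).comp measurable_snd)

lemma measurable_residual : Measurable (residual xs z σ k) := by
  refine ((measurable_eval_const z).comp measurable_fst).sub (Finset.measurable_sum _ fun i _ => ?_)
  exact ((measurable_pi_apply i).comp (measurable_noisyObs xs)).const_mul _

lemma IsPrior.hasGaussianLaw_residual (hQ : IsPrior k Q) :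
    HasGaussianLaw (fun p => (fun _ : Unit => residual xs z σ k p, fun j => noisyObs xs p j))
      (designMeasure Q σ n) := by
  let E := (ℝ × (Fin n → ℝ)) × (Fin n → ℝ)
  let A : E →L[ℝ] ℝ := (ContinuousLinearMap.fst ℝ _ _).comp (ContinuousLinearMap.fst ℝ _ _)
  let B (i : Fin n) : E →L[ℝ] ℝ := (ContinuousLinearMap.proj (R := ℝ) (φ := fun _ : Fin n => ℝ) i).comp
      ((ContinuousLinearMap.snd ℝ _ _).comp (ContinuousLinearMap.fst ℝ _ _)) +
    (ContinuousLinearMap.proj (R := ℝ) (φ := fun _ : Fin n => ℝ) i).comp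
      (ContinuousLinearMap.snd ℝ _ _)
  have h := (hQ.hasGaussianLaw_design (σ ^ 2) xs z).map_fun
    ((ContinuousLinearMap.pi fun _ : Unit =>
      A - ∑ i, postWeights k σ (fun i => (xs i : Pt d)) z i • B i).prod (ContinuousLinearMap.pi B))
  refine h.congr (ae_of_all _ fun p => Prod.ext ?_ ?_)
  · funext j
    simp [residual, A, B, noisyObs, mul_add]
  · funext j
    simp [B, noisyObs]

lemma IsPrior.memLp_noisyObs (hQ : IsPrior k Q) (j : Fin n) :
    MemLp (fun p => noisyObs xs p j) 2 (designMeasure Q σ n) :=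
  (hQ.memLp_fst σ (xs j)).add (hQ.memLp_noise σ (xs j) j)

lemma IsPrior.covariance_fst_noisyObs (hQ : IsPrior k Q) (j : Fin n) :
    cov[fun p : Path X × (Fin n → ℝ) => p.1.1 z, fun p => noisyObs xs p j;
      designMeasure Q σ n] = k z (xs j) := by
  have := hQ.isProbabilityMeasure
  have : IsProbabilityMeasure (designMeasure Q σ n) := by unfold designMeasure; infer_instance
  refine (covariance_add_right (hQ.memLp_fst σ z) (hQ.memLp_fst σ (xs j))
    (hQ.memLp_noise σ z j)).trans ?_
  rw [hQ.covariance_fst_fst, hQ.covariance_fst_noise, add_zero]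

lemma IsPrior.covariance_noisyObs (hQ : IsPrior k Q) (i j : Fin n) :
    cov[fun p => noisyObs xs p i, fun p => noisyObs xs p j; designMeasure Q σ n] =
      regGram k σ (fun i => (xs i : Pt d)) i j := by
  have := hQ.isProbabilityMeasure
  have : IsProbabilityMeasure (designMeasure Q σ n) := by unfold designMeasure; infer_instance
  refine (covariance_add_left (hQ.memLp_fst σ (xs i)) (hQ.memLp_noise σ (xs j) i)
    (hQ.memLp_noisyObs xs σ j)).trans ?_
  rw [hQ.covariance_fst_noisyObs]
  have h2 : cov[fun p : Path X × (Fin n → ℝ) => p.2 i, fun p => noisyObs xs p j;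
      designMeasure Q σ n] = if i = j then (σ : ℝ) ^ 2 else 0 := by
    refine (covariance_add_right (hQ.memLp_noise σ (xs j) i) (hQ.memLp_fst σ (xs j))
      (hQ.memLp_noise σ (xs j) j)).trans ?_
    rw [covariance_comm, hQ.covariance_fst_noise, hQ.covariance_noise_noise, zero_add]
  rw [h2]
  simp [regGram, Matrix.one_apply]

lemma IsPrior.covariance_residual_noisyObs (hQ : IsPrior k Q) (hσ : 0 < σ) (j : Fin n) :
    cov[fun p => residual xs z σ k p, fun p => noisyObs xs p j; designMeasure Q σ n] = 0 := by
  have := hQ.isProbabilityMeasure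
  have : IsProbabilityMeasure (designMeasure Q σ n) := by unfold designMeasure; infer_instance
  have hm : ∀ i, MemLp (fun p => postWeights k σ (fun i => (xs i : Pt d)) z i * noisyObs xs p i) 2
      (designMeasure Q σ n) := fun i => (hQ.memLp_noisyObs xs σ i).const_mul _
  refine (covariance_fun_sub_left (hQ.memLp_fst σ z) (memLp_finsetSum _ fun i _ => hm i)
    (hQ.memLp_noisyObs xs σ j)).trans ?_
  rw [hQ.covariance_fst_noisyObs, covariance_fun_sum_left hm (hQ.memLp_noisyObs xs σ j)]
  simp_rw [covariance_const_mul_left, hQ.covariance_noisyObs]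
  have h := congrFun (hQ.regGram_mulVec_postWeights hσ xs z) j
  rw [← h, Matrix.mulVec, dotProduct, ← Finset.sum_sub_distrib]
  refine Finset.sum_eq_zero fun i _ => ?_
  have hs : regGram k σ (fun i => (xs i : Pt d)) i j = regGram k σ (fun i => (xs i : Pt d)) j i := by
    simp [regGram, Matrix.one_apply, hQ.symm (xs i) (xs j), eq_comm]
  rw [hs]
  ring

/-- The residual is orthogonal to the observations and hence to its own linear correction, so its
variance equals its covariance with the value at `z`. -/
lemma IsPrior.variance_residual (hQ : IsPrior k Q) (hσ : 0 < σ) :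
    Var[residual xs z σ k; designMeasure Q σ n] = postVar k σ (fun i => (xs i : Pt d)) z := by
  have := hQ.isProbabilityMeasure
  have : IsProbabilityMeasure (designMeasure Q σ n) := by unfold designMeasure; infer_instance
  have hm : ∀ i, MemLp (fun p => postWeights k σ (fun i => (xs i : Pt d)) z i * noisyObs xs p i) 2
      (designMeasure Q σ n) := fun i => (hQ.memLp_noisyObs xs σ i).const_mul _
  have hR : MemLp (residual xs z σ k) 2 (designMeasure Q σ n) :=
    (hQ.memLp_fst σ z).sub (memLp_finsetSum _ fun i _ => hm i)
  rw [← covariance_self (measurable_residual xs z σ).aemeasurable]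
  refine (covariance_fun_sub_right hR (hQ.memLp_fst σ z) (memLp_finsetSum _ fun i _ => hm i)).trans ?_
  rw [covariance_fun_sum_right hm hR]
  simp_rw [covariance_const_mul_right]
  have h0 : ∀ i, cov[residual xs z σ k, fun p => noisyObs xs p i; designMeasure Q σ n] = 0 :=
    hQ.covariance_residual_noisyObs xs z σ hσ
  simp only [h0, mul_zero, Finset.sum_const_zero, sub_zero]
  refine (covariance_fun_sub_left (hQ.memLp_fst σ z) (memLp_finsetSum _ fun i _ => hm i)
    (hQ.memLp_fst σ z)).trans ?_
  rw [hQ.covariance_fst_fst, covariance_fun_sum_left hm (hQ.memLp_fst σ z)]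
  simp_rw [covariance_const_mul_left, covariance_comm (fun p => noisyObs xs p _),
    hQ.covariance_fst_noisyObs]
  rw [postVar, dotProduct]
  congr 1
  exact Finset.sum_congr rfl fun i _ => mul_comm _ _

lemma IsPrior.integral_fst (hQ : IsPrior k Q) (z : X) :
    ∫ p : Path X × (Fin n → ℝ), p.1.1 z ∂designMeasure Q σ n = 0 := by
  have := hQ.isProbabilityMeasure
  rw [← hQ.mean_zero z]
  exact (integral_fun_fst (μ := Q) (ν := Measure.pi fun _ : Fin n => gaussianReal 0 (σ ^ 2))
    (fun φ => φ.1 z)).trans (by simp)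

lemma IsPrior.integral_noise (hQ : IsPrior k Q) (i : Fin n) :
    ∫ p : Path X × (Fin n → ℝ), p.2 i ∂designMeasure Q σ n = 0 := by
  have := hQ.isProbabilityMeasure
  refine (integral_fun_snd (μ := Q) (ν := Measure.pi fun _ : Fin n => gaussianReal 0 (σ ^ 2))
    (fun e => e i)).trans ?_
  have hm' := measurePreserving_eval (fun _ : Fin n => gaussianReal 0 (σ ^ 2)) i
  have h3 := integral_id_gaussianReal (μ := 0) (v := σ ^ 2)
  rw [← hm'.map_eq, integral_map hm'.measurable.aemeasurable
    (by fun_prop)] at h3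
  simpa using h3

lemma IsPrior.integral_noisyObs (hQ : IsPrior k Q) (i : Fin n) :
    ∫ p, noisyObs xs p i ∂designMeasure Q σ n = 0 := by
  have := hQ.isProbabilityMeasure
  have : IsProbabilityMeasure (designMeasure Q σ n) := by unfold designMeasure; infer_instance
  refine (integral_add ((hQ.memLp_fst σ (xs i)).integrable one_le_two)
    ((hQ.memLp_noise σ (xs i) i).integrable one_le_two)).trans ?_
  rw [hQ.integral_fst, hQ.integral_noise, add_zero]

lemma IsPrior.integral_residual (hQ : IsPrior k Q) :
    ∫ p, residual xs z σ k p ∂designMeasure Q σ n = 0 := by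
  have := hQ.isProbabilityMeasure
  have : IsProbabilityMeasure (designMeasure Q σ n) := by unfold designMeasure; infer_instance
  have hi : ∀ i, Integrable (fun p => postWeights k σ (fun i => (xs i : Pt d)) z i * noisyObs xs p i)
      (designMeasure Q σ n) := fun i =>
    ((hQ.memLp_noisyObs xs σ i).integrable one_le_two).const_mul _
  refine (integral_sub ((hQ.memLp_fst σ z).integrable one_le_two)
    (integrable_finsetSum _ fun i _ => hi i)).trans ?_
  rw [hQ.integral_fst, integral_finsetSum _ fun i _ => hi i]
  simp [integral_const_mul, hQ.integral_noisyObs]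

lemma IsPrior.postVar_nonneg (hQ : IsPrior k Q) (hσ : 0 < σ) :
    0 ≤ postVar k σ (fun i => (xs i : Pt d)) z := by
  rw [← hQ.variance_residual xs z σ hσ]
  exact variance_nonneg _ _

lemma IsPrior.postVar_le (hQ : IsPrior k Q) (hσ : 0 < σ) :
    postVar k σ (fun i => (xs i : Pt d)) z ≤ k z z := by
  rw [postVar, sub_le_self_iff]
  simpa using (hQ.posDef_regGram hσ xs).inv.posSemidef.dotProduct_mulVec_nonneg
    fun i => k z (xs i)

lemma IsPrior.map_residual (hQ : IsPrior k Q) (hσ : 0 < σ) :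
    (designMeasure Q σ n).map (residual xs z σ k) =
      gaussianReal 0 (postVar k σ (fun i => (xs i : Pt d)) z).toNNReal := by
  have h := ((hQ.hasGaussianLaw_residual xs z σ).fst.eval ()).map_eq_gaussianReal
  rwa [hQ.integral_residual, hQ.variance_residual xs z σ hσ] at h

/-- Uncorrelated and jointly Gaussian, hence independent. -/
lemma IsPrior.indepFun_residual (hQ : IsPrior k Q) (hσ : 0 < σ) :
    IndepFun (residual xs z σ k) (noisyObs xs) (designMeasure Q σ n) := by
  have h := (hQ.hasGaussianLaw_residual xs z σ).indepFun_of_covariance_eval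
    fun _ j => hQ.covariance_residual_noisyObs xs z σ hσ j
  exact h.comp (measurable_pi_apply ()) measurable_id

/-- The value at `z` is the posterior mean plus a residual that is independent of the observations
and has the posterior variance. This is the integrated form of conditioning. -/
lemma IsPrior.lintegral_noisyObs_mul (hQ : IsPrior k Q) (hσ : 0 < σ) {g : (Fin n → ℝ) → ℝ≥0∞}
    (hg : Measurable g) {h : ℝ → ℝ≥0∞} (hh : Measurable h) :
    ∫⁻ p, g (noisyObs xs p) * h (p.1.1 z) ∂designMeasure Q σ n =
      ∫⁻ p, g (noisyObs xs p) * (∫⁻ u, h u ∂gaussianReal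
        (postMean k σ (fun i => (xs i : Pt d)) (noisyObs xs p) z)
        (postVar k σ (fun i => (xs i : Pt d)) z).toNNReal) ∂designMeasure Q σ n := by
  have := hQ.isProbabilityMeasure
  have : IsProbabilityMeasure (designMeasure Q σ n) := by unfold designMeasure; infer_instance
  have hR := measurable_residual (k := k) xs z σ
  have hY := measurable_noisyObs xs
  have hind := (hQ.indepFun_residual xs z σ hσ).map_prod_eq_prod_map_map
    hR.aemeasurable hY.aemeasurable
  rw [hQ.map_residual xs z σ hσ] at hind
  set v := (postVar k σ (fun i => (xs i : Pt d)) z).toNNReal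
  have hm : Measurable fun y : Fin n → ℝ =>
      ∑ i, postWeights k σ (fun i => (xs i : Pt d)) z i * y i := by fun_prop
  set w := fun y : Fin n → ℝ => ∑ i, postWeights k σ (fun i => (xs i : Pt d)) z i * y i with hw
  have hpm : ∀ y, postMean k σ (fun i => (xs i : Pt d)) y z = w y := fun y =>
    hQ.postMean_eq hσ xs y z
  have hG : Measurable fun q : ℝ × (Fin n → ℝ) => g q.2 * h (w q.2 + q.1) := by fun_prop
  calc ∫⁻ p, g (noisyObs xs p) * h (p.1.1 z) ∂designMeasure Q σ n
      = ∫⁻ p, (fun q : ℝ × (Fin n → ℝ) => g q.2 * h (w q.2 + q.1))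
          (residual xs z σ k p, noisyObs xs p) ∂designMeasure Q σ n := by
        refine lintegral_congr fun p => ?_
        simp only [residual, hw]
        congr 2
        ring
    _ = ∫⁻ q, g q.2 * h (w q.2 + q.1)
          ∂(gaussianReal 0 v).prod ((designMeasure Q σ n).map (noisyObs xs)) := by
        rw [← hind, lintegral_map hG (hR.prodMk hY)]
    _ = ∫⁻ y, ∫⁻ r, g y * h (w y + r) ∂gaussianReal 0 v
          ∂(designMeasure Q σ n).map (noisyObs xs) := lintegral_prod_symm' _ hG
    _ = ∫⁻ y, g y * (∫⁻ u, h u ∂gaussianReal (w y) v)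
          ∂(designMeasure Q σ n).map (noisyObs xs) := by
        refine lintegral_congr fun y => ?_
        rw [lintegral_const_mul _ (by fun_prop)]
        congr 1
        have hmap := gaussianReal_map_const_add (μ := 0) (v := v) (w y)
        rw [zero_add] at hmap
        rw [← hmap, lintegral_map hh (measurable_const_add _)]
    _ = _ := by
        simp_rw [hpm]
        rw [lintegral_map _ hY]
        refine hg.mul ?_
        exact (hh.lintegral_kernel (κ := ⟨fun m => gaussianReal m v,
          measurable_gaussianReal.comp (measurable_id.prodMk measurable_const)⟩)).comp hm

/-- The likelihood of the observations `y` at the points `xs` given the path `φ`. -/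
noncomputable def designLikelihood (y : Fin n → ℝ) (φ : Path X) : ℝ≥0∞ :=
  ∏ i, gaussianPDF (φ.1 (xs i)) (σ ^ 2) (y i)

lemma measurable_designLikelihood :
    Measurable fun q : (Fin n → ℝ) × Path X => designLikelihood xs σ q.1 q.2 := by
  unfold designLikelihood
  refine Finset.measurable_prod _ fun i _ => ?_
  exact measurable_gaussianPDF_comp ((measurable_eval_const (xs i)).comp measurable_snd) _
    ((measurable_pi_apply i).comp measurable_fst)

/-- Changing variables from noise to observations and exchanging the integrals makes `y` the outer
variable and leaves an integral over paths for each fixed `y`. -/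
lemma lintegral_designMeasure (hσ : 0 < σ) [IsProbabilityMeasure Q]
    {G : Path X → (Fin n → ℝ) → ℝ≥0∞} (hG : Measurable (Function.uncurry G)) :
    ∫⁻ p, G p.1 (noisyObs xs p) ∂designMeasure Q σ n =
      ∫⁻ y, ∫⁻ φ, G φ y * designLikelihood xs σ y φ ∂Q := by
  have hv : σ ^ 2 ≠ 0 := by positivity
  have hG' : Measurable fun p : Path X × (Fin n → ℝ) => G p.1 (noisyObs xs p) :=
    hG.comp (measurable_fst.prodMk (measurable_noisyObs xs))
  rw [designMeasure, lintegral_prod _ hG'.aemeasurable]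
  have h1 : ∀ φ : Path X, ∫⁻ e, G φ (noisyObs xs (φ, e))
      ∂Measure.pi (fun _ : Fin n => gaussianReal 0 (σ ^ 2)) =
      ∫⁻ y, G φ y * designLikelihood xs σ y φ := fun φ =>
    lintegral_add_gaussian (fun i => φ.1 (xs i)) hv (g := G φ)
      (hG.comp measurable_prodMk_left)
  simp_rw [h1]
  rw [lintegral_lintegral_swap]
  exact (hG.mul ((measurable_designLikelihood xs σ).comp measurable_swap)).aemeasurable

-- Boundedness and continuity of the likelihood in the observations.

lemma gaussianPDF_le (m : ℝ) (v : ℝ≥0) (x : ℝ) :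
    gaussianPDF m v x ≤ ENNReal.ofReal (√(2 * Real.pi * v))⁻¹ := by
  rw [gaussianPDF, gaussianPDFReal]
  apply ENNReal.ofReal_le_ofReal
  refine mul_le_of_le_one_right (by positivity) (Real.exp_le_one_iff.2 ?_)
  exact div_nonpos_of_nonpos_of_nonneg (neg_nonpos.2 (sq_nonneg _)) (by positivity)

lemma designLikelihood_le (y : Fin n → ℝ) (φ : Path X) :
    designLikelihood xs σ y φ ≤ (ENNReal.ofReal (√(2 * Real.pi * (σ ^ 2 : ℝ≥0)))⁻¹) ^ n := by
  refine (Finset.prod_le_pow_card _ _ _ fun i _ => gaussianPDF_le _ _ _).trans_eq ?_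
  simp

lemma continuous_designLikelihood (φ : Path X) :
    Continuous fun y : Fin n → ℝ => designLikelihood xs σ y φ := by
  have h : ∀ y : Fin n → ℝ, designLikelihood xs σ y φ =
      ENNReal.ofReal (∏ i, gaussianPDFReal (φ.1 (xs i)) (σ ^ 2) (y i)) := fun y => by
    rw [ENNReal.ofReal_prod_of_nonneg fun i _ => gaussianPDFReal_nonneg _ _ _]
    rfl
  simp_rw [h]
  refine ENNReal.continuous_ofReal.comp (continuous_finsetProd _ fun i _ => ?_)
  unfold gaussianPDFReal
  fun_prop

lemma measurable_designLikelihood_const (y : Fin n → ℝ) :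
    Measurable (designLikelihood (X := X) xs σ y) := by
  unfold designLikelihood
  refine Finset.measurable_prod _ fun i _ => ?_
  exact measurable_gaussianPDF_comp (measurable_eval_const (xs i)) _ measurable_const

attribute [irreducible] designLikelihood

lemma lintegral_withDensity_comm {α : Type*} [MeasurableSpace α] (μ : Measure α) {f g : α → ℝ≥0∞}
    (hf : Measurable f) (hg : Measurable g) :
    ∫⁻ a, g a ∂μ.withDensity f = ∫⁻ a, g a * f a ∂μ := by
  rw [lintegral_withDensity_eq_lintegral_mul _ hf hg]
  exact lintegral_congr fun a => mul_comm _ _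

/-- Dominated convergence with the uniform bound on the likelihood. Continuity in `y` later removes
the exceptional null set from Bayes' rule. -/
lemma continuous_lintegral_designLikelihood [IsProbabilityMeasure Q] (h : BoundedContinuousFunction ℝ ℝ≥0) :
    Continuous fun y : Fin n → ℝ => ∫⁻ φ, h (φ.1 z) * designLikelihood xs σ y φ ∂Q := by
  refine continuous_iff_continuousAt.2 fun y => ?_
  have hC : ∀ u, (h u : ℝ≥0∞) ≤ nndist h 0 := fun u =>
    ENNReal.coe_le_coe.2 (BoundedContinuousFunction.NNReal.upper_bound h u)
  refine tendsto_lintegral_filter_of_dominated_convergence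
    (fun _ => (nndist h 0 : ℝ≥0∞) * (ENNReal.ofReal (√(2 * Real.pi * (σ ^ 2 : ℝ≥0)))⁻¹) ^ n)
    ?_ ?_ ?_ ?_
  · refine Filter.Eventually.of_forall fun y => ?_
    exact ((h.continuous.measurable.comp (measurable_eval_const z)).coe_nnreal_ennreal).mul
      (measurable_designLikelihood_const xs σ y)
  · exact Filter.Eventually.of_forall fun y => ae_of_all _ fun φ =>
      mul_le_mul' (hC _) (designLikelihood_le xs σ y φ)
  · rw [lintegral_const]
    exact ENNReal.mul_ne_top (ENNReal.mul_ne_top ENNReal.coe_ne_top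
      (ENNReal.pow_ne_top ENNReal.ofReal_ne_top)) (measure_ne_top _ _)
  · exact ae_of_all _ fun φ => ENNReal.Tendsto.const_mul
      ((continuous_designLikelihood xs σ φ).tendsto y) (Or.inr ENNReal.coe_ne_top)

lemma continuous_lintegral_gaussianReal (v : ℝ≥0) (h : BoundedContinuousFunction ℝ ℝ≥0) :
    Continuous fun m : ℝ => ∫⁻ u, h u ∂gaussianReal m v := by
  have h1 : ∀ m : ℝ, ∫⁻ u, h u ∂gaussianReal m v = ∫⁻ r, h (m + r) ∂gaussianReal 0 v := fun m => by
    have hmap := gaussianReal_map_const_add (μ := 0) (v := v) m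
    rw [zero_add] at hmap
    rw [← hmap, lintegral_map (h.continuous.measurable.coe_nnreal_ennreal) (measurable_const_add _)]
  simp_rw [h1]
  refine continuous_iff_continuousAt.2 fun y => ?_
  have hC : ∀ u, (h u : ℝ≥0∞) ≤ nndist h 0 := fun u =>
    ENNReal.coe_le_coe.2 (BoundedContinuousFunction.NNReal.upper_bound h u)
  refine tendsto_lintegral_filter_of_dominated_convergence (fun _ => (nndist h 0 : ℝ≥0∞)) ?_ ?_ ?_ ?_
  · exact Filter.Eventually.of_forall fun y =>
      (h.continuous.measurable.comp (measurable_const_add y)).coe_nnreal_ennreal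
  · exact Filter.Eventually.of_forall fun y => ae_of_all _ fun φ => hC _
  · rw [lintegral_const]
    exact ENNReal.mul_ne_top ENNReal.coe_ne_top (measure_ne_top _ _)
  · refine ae_of_all _ fun r => ?_
    have : Continuous fun m : ℝ => (h (m + r) : ℝ≥0∞) :=
      ENNReal.continuous_coe.comp (h.continuous.comp (by fun_prop))
    exact this.tendsto y

/-- Bayes' rule for a fixed design: integrating against the likelihood of the observations `y`
amounts to integrating against the Gaussian posterior. -/
theorem IsPrior.lintegral_mul_designLikelihood (hQ : IsPrior k Q) (hσ : 0 < σ) (y : Fin n → ℝ)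
    {h : ℝ → ℝ≥0∞} (hh : Measurable h) :
    ∫⁻ φ, h (φ.1 z) * designLikelihood xs σ y φ ∂Q =
      (∫⁻ φ, designLikelihood xs σ y φ ∂Q) * ∫⁻ u, h u ∂gaussianReal
        (postMean k σ (fun i => (xs i : Pt d)) y z)
        (postVar k σ (fun i => (xs i : Pt d)) z).toNNReal := by
  have := hQ.isProbabilityMeasure
  set v := (postVar k σ (fun i => (xs i : Pt d)) z).toNNReal
  set m := fun y : Fin n → ℝ => postMean k σ (fun i => (xs i : Pt d)) y z with hm
  have hmc : Continuous m := by
    have : m = fun y => ∑ i, postWeights k σ (fun i => (xs i : Pt d)) z i * y i :=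
      funext fun y => hQ.postMean_eq hσ xs y z
    rw [this]; fun_prop
  have hLy : ∀ y, Measurable (designLikelihood xs σ y) := 
    measurable_designLikelihood_const xs σ
  have hLi : ∀ y, ∫⁻ φ, designLikelihood xs σ y φ ∂Q ≠ ∞ := fun y => by
    refine ((lintegral_mono (designLikelihood_le xs σ y)).trans_lt ?_).ne
    rw [lintegral_const]
    exact ENNReal.mul_lt_top (ENNReal.pow_lt_top ENNReal.ofReal_lt_top) (measure_lt_top _ _)
  -- the identity for bounded continuous functions
  have hbc : ∀ (h : BoundedContinuousFunction ℝ ℝ≥0) (y : Fin n → ℝ),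
      ∫⁻ φ, h (φ.1 z) * designLikelihood xs σ y φ ∂Q =
        (∫⁻ φ, designLikelihood xs σ y φ ∂Q) * ∫⁻ u, h u ∂gaussianReal (m y) v := by
    intro h
    have hhm : Measurable fun u => (h u : ℝ≥0∞) := h.continuous.measurable.coe_nnreal_ennreal
    have hcont2 : Continuous fun y : Fin n → ℝ => ∫⁻ φ, designLikelihood xs σ y φ ∂Q := by
      simpa using continuous_lintegral_designLikelihood (Q := Q) xs z σ
        (BoundedContinuousFunction.const ℝ 1)
    have hcont3 : Continuous fun y : Fin n → ℝ => ∫⁻ u, h u ∂gaussianReal (m y) v :=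
      (continuous_lintegral_gaussianReal v h).comp hmc
    have hfin3 : ∀ y, ∫⁻ u, h u ∂gaussianReal (m y) v ≠ ∞ := fun y => by
      have hC : ∀ u, (h u : ℝ≥0∞) ≤ nndist h 0 := fun u =>
        ENNReal.coe_le_coe.2 (BoundedContinuousFunction.NNReal.upper_bound h u)
      refine ((lintegral_mono hC).trans_lt ?_).ne
      rw [lintegral_const]
      exact ENNReal.mul_lt_top ENNReal.coe_lt_top (measure_lt_top _ _)
    have hc1 := continuous_lintegral_designLikelihood (Q := Q) xs z σ h
    have hc2 : Continuous fun y : Fin n → ℝ =>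
        (∫⁻ φ, designLikelihood xs σ y φ ∂Q) * ∫⁻ u, h u ∂gaussianReal (m y) v :=
      continuous_iff_continuousAt.2 fun y =>
        ENNReal.Tendsto.mul hcont2.continuousAt (Or.inr (hfin3 y)) hcont3.continuousAt
          (Or.inr (hLi y))
    -- Inserting indicators of sets `B` of observations into the integrated conditioning formula
    -- identifies both sides for almost every `y`. Both are continuous in `y`, so they agree
    -- everywhere. The pointwise form is essential, since later the design `xs` varies with `y`.
    have hae : (fun y : Fin n → ℝ => ∫⁻ φ, h (φ.1 z) * designLikelihood xs σ y φ ∂Q) =ᵐ[volume]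
        fun y => (∫⁻ φ, designLikelihood xs σ y φ ∂Q) * ∫⁻ u, h u ∂gaussianReal (m y) v := by
      refine ae_eq_of_forall_setLIntegral_eq_of_sigmaFinite hc1.measurable hc2.measurable
        fun B hB _ => ?_
      have hg : Measurable (B.indicator (1 : (Fin n → ℝ) → ℝ≥0∞)) := measurable_one.indicator hB
      have key := hQ.lintegral_noisyObs_mul xs z σ hσ hg hhm
      rw [lintegral_designMeasure xs σ hσ (Q := Q)
          (G := fun φ y => B.indicator 1 y * h (φ.1 z)) (by
            exact (hg.comp measurable_snd).mul
              (hhm.comp ((measurable_eval_const z).comp measurable_fst))),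
        lintegral_designMeasure xs σ hσ (Q := Q)
          (G := fun _ y => B.indicator 1 y * ∫⁻ u, h u ∂gaussianReal (m y) v) (by
            exact (hg.comp measurable_snd).mul (hcont3.measurable.comp measurable_snd))] at key
      rw [← lintegral_indicator hB, ← lintegral_indicator hB]
      refine (lintegral_congr fun y => ?_).trans (key.trans (lintegral_congr fun y => ?_))
      · by_cases hy : y ∈ B
        · simp [indicator_of_mem hy]
        · simp [indicator_of_notMem hy]
      · by_cases hy : y ∈ B
        · simp only [indicator_of_mem hy, Pi.one_apply, one_mul]
          rw [lintegral_const_mul _ (hLy y), mul_comm]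
        · simp [indicator_of_notMem hy]
    exact congrFun ((Continuous.ae_eq_iff_eq volume hc1 hc2).1 hae)
  -- Finite measures on the line are determined by their integrals of bounded continuous functions;
  -- this extends the identity to all measurable `h`.
  have hmeas : (Q.withDensity (designLikelihood xs σ y)).map (fun φ => φ.1 z) =
      (∫⁻ φ, designLikelihood xs σ y φ ∂Q) • gaussianReal (m y) v := by
    have : IsFiniteMeasure (Q.withDensity (designLikelihood xs σ y)) :=
      isFiniteMeasure_withDensity (hLi y)
    refine ext_of_forall_lintegral_eq_of_IsFiniteMeasure fun h => ?_
    have hhm : Measurable fun u => (h u : ℝ≥0∞) := h.continuous.measurable.coe_nnreal_ennreal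
    rw [lintegral_map hhm (measurable_eval_const z), lintegral_smul_measure, smul_eq_mul, ← hbc]
    exact lintegral_withDensity_comm _ (hLy y) (hhm.comp (measurable_eval_const z))
  have := congrArg (fun μ => ∫⁻ u, h u ∂μ) hmeas
  simp only [lintegral_smul_measure, smul_eq_mul] at this
  rw [← this, lintegral_map hh (measurable_eval_const z)]
  exact (lintegral_withDensity_comm _ (hLy y) (hh.comp (measurable_eval_const z))).symm

end FixedDesign

/-! ### The law of the observations for a fixed design -/

/-- The convolution of two Gaussians, read off at the level of densities: equality holds almost
everywhere by integrating over sets, and everywhere by continuity. The case `v = 0` is included. -/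
lemma lintegral_gaussianPDF_gaussianReal (m : ℝ) (v : ℝ≥0) {τ : ℝ≥0} (hτ : τ ≠ 0) (u : ℝ) :
    ∫⁻ w, gaussianPDF w τ u ∂gaussianReal m v = gaussianPDF m (v + τ) u := by
  have hpdf : ∀ w τ, Continuous fun u => gaussianPDF w τ u := fun w τ => by
    unfold gaussianPDF gaussianPDFReal
    exact ENNReal.continuous_ofReal.comp (by fun_prop)
  have hmeas : Measurable fun p : ℝ × ℝ => gaussianPDF p.2 τ p.1 :=
    measurable_gaussianPDF_comp measurable_snd τ measurable_fst
  have hmeas' : ∀ u, Measurable fun w : ℝ => gaussianPDF w τ u := fun u =>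
    measurable_gaussianPDF_comp measurable_id τ measurable_const
  have hc : Continuous fun u => ∫⁻ w, gaussianPDF w τ u ∂gaussianReal m v := by
    refine continuous_iff_continuousAt.2 fun u => ?_
    refine tendsto_lintegral_filter_of_dominated_convergence
      (fun _ => ENNReal.ofReal (√(2 * Real.pi * τ))⁻¹) ?_ ?_ ?_ ?_
    · exact Filter.Eventually.of_forall hmeas'
    · exact Filter.Eventually.of_forall fun u => ae_of_all _ fun w => gaussianPDF_le _ _ _
    · rw [lintegral_const]
      exact ENNReal.mul_ne_top ENNReal.ofReal_ne_top (measure_ne_top _ _)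
    · exact ae_of_all _ fun w => (hpdf w τ).tendsto u
  have hne : v + τ ≠ 0 := by positivity
  have hae : (fun u => ∫⁻ w, gaussianPDF w τ u ∂gaussianReal m v) =ᵐ[volume]
      fun u => gaussianPDF m (v + τ) u := by
    refine ae_eq_of_forall_setLIntegral_eq_of_sigmaFinite hc.measurable
      (measurable_gaussianPDF _ _) fun B hB _ => ?_
    rw [← gaussianReal_apply _ hne, lintegral_lintegral_swap]
    · have h := gaussianReal_conv_gaussianReal (m₁ := m) (m₂ := 0) (v₁ := v) (v₂ := τ)
      rw [add_zero] at h
      rw [← h, ← lintegral_indicator_one hB, Measure.lintegral_conv (measurable_one.indicator hB)]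
      refine lintegral_congr fun w => ?_
      rw [← gaussianReal_apply _ hτ]
      have hmap := gaussianReal_map_const_add (μ := 0) (v := τ) w
      rw [zero_add] at hmap
      rw [← hmap, ← lintegral_indicator_one hB, lintegral_map (measurable_one.indicator hB)
        (measurable_const_add _)]
    · exact hmeas.aemeasurable
  exact congrFun ((Continuous.ae_eq_iff_eq volume hc (hpdf _ _)).1 hae) u

/-- The variance of the `i`-th point given the observations at the previous points. -/
noncomputable def predVar (k : Pt d → Pt d → ℝ) (σ : ℝ≥0) {n : ℕ} (xs : Fin n → X) (i : Fin n) : ℝ :=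
  postVar k σ (fun j => ((past xs i j : X) : Pt d)) (xs i)

/-- The mean of the `i`-th point given the observations at the previous points. -/
noncomputable def predMean (k : Pt d → Pt d → ℝ) (σ : ℝ≥0) {n : ℕ} (xs : Fin n → X)
    (y : Fin n → ℝ) (i : Fin n) : ℝ :=
  postMean k σ (fun j => ((past xs i j : X) : Pt d)) (past y i) (xs i)

/-- Chain rule: by Bayes' rule, the last factor of the likelihood integrates against the posterior
of the preceding observations to a Gaussian density with variance `predVar + σ²`. -/
lemma IsPrior.lintegral_designLikelihood (hQ : IsPrior k Q) {σ : ℝ≥0} (hσ : 0 < σ) {n : ℕ}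
    (xs : Fin n → X) (y : Fin n → ℝ) :
    ∫⁻ φ, designLikelihood xs σ y φ ∂Q =
      ∏ i, gaussianPDF (predMean k σ xs y i) ((predVar k σ xs i).toNNReal + σ ^ 2) (y i) := by
  have := hQ.isProbabilityMeasure
  induction n with
  | zero => simp [designLikelihood]
  | succ n ih =>
    rw [Fin.prod_univ_castSucc]
    have h1 : ∀ φ : Path X, designLikelihood xs σ y φ =
        gaussianPDF (φ.1 (xs (Fin.last n))) (σ ^ 2) (y (Fin.last n)) *
          designLikelihood (Fin.init xs) σ (Fin.init y) φ := fun φ => by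
      unfold designLikelihood
      rw [Fin.prod_univ_castSucc, mul_comm]
      rfl
    simp_rw [h1]
    have hm : Measurable fun w : ℝ => gaussianPDF w (σ ^ 2) (y (Fin.last n)) :=
      measurable_gaussianPDF_comp measurable_id _ measurable_const
    rw [hQ.lintegral_mul_designLikelihood (Fin.init xs) (xs (Fin.last n)) σ hσ (Fin.init y) hm,
      lintegral_gaussianPDF_gaussianReal _ _ (by positivity), ih]
    rfl

/-- The innovation of the `i`-th observation. -/
noncomputable def innovation (k : Pt d → Pt d → ℝ) (σ : ℝ≥0) {n : ℕ} (xs : Fin n → X) (i : Fin n)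
    (p : Path X × (Fin n → ℝ)) : ℝ :=
  noisyObs xs p i - predMean k σ xs (noisyObs xs p) i

lemma IsPrior.innovation_eq (hQ : IsPrior k Q) {σ : ℝ≥0} (hσ : 0 < σ) {n : ℕ} (xs : Fin n → X)
    (i : Fin n) : innovation k σ xs i = fun p => noisyObs xs p i -
      ∑ j : Fin i, postWeights k σ (fun j => ((past xs i j : X) : Pt d)) (xs i) j *
        noisyObs xs p ⟨j, j.2.trans i.2⟩ := by
  funext p
  rw [innovation, predMean, hQ.postMean_eq hσ]
  rfl

lemma IsPrior.memLp_innovation (hQ : IsPrior k Q) {σ : ℝ≥0} (hσ : 0 < σ) {n : ℕ} (xs : Fin n → X)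
    (i : Fin n) : MemLp (innovation k σ xs i) 2 (designMeasure Q σ n) := by
  rw [hQ.innovation_eq hσ]
  exact (hQ.memLp_noisyObs xs σ i).sub
    (memLp_finsetSum _ fun j _ => (hQ.memLp_noisyObs xs σ _).const_mul _)

/-- The innovation is centred and, by the normal equations, orthogonal to the earlier observations.
Its second moment is therefore its covariance with the `i`-th observation, whose noise contributes
`σ²`. -/
lemma IsPrior.integral_innovation_sq (hQ : IsPrior k Q) {σ : ℝ≥0} (hσ : 0 < σ) {n : ℕ}
    (xs : Fin n → X) (i : Fin n) :
    ∫ p, innovation k σ xs i p ^ 2 ∂designMeasure Q σ n = predVar k σ xs i + (σ : ℝ) ^ 2 := by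
  have := hQ.isProbabilityMeasure
  have : IsProbabilityMeasure (designMeasure Q σ n) := by unfold designMeasure; infer_instance
  have hI := hQ.memLp_innovation hσ xs i
  have hm : ∀ j : Fin i, MemLp (fun p => postWeights k σ (fun j => ((past xs i j : X) : Pt d)) (xs i) j *
        noisyObs xs p ⟨j, j.2.trans i.2⟩) 2 (designMeasure Q σ n) := fun j =>
    (hQ.memLp_noisyObs xs σ _).const_mul _
  have hmean : ∫ p, innovation k σ xs i p ∂designMeasure Q σ n = 0 := by
    rw [hQ.innovation_eq hσ]
    rw [integral_sub ((hQ.memLp_noisyObs xs σ i).integrable one_le_two)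
      (integrable_finsetSum _ fun j _ => (hm j).integrable one_le_two), hQ.integral_noisyObs,
      integral_finsetSum _ fun j _ => (hm j).integrable one_le_two]
    simp [integral_const_mul, hQ.integral_noisyObs]
  rw [← variance_of_integral_eq_zero hI.aestronglyMeasurable.aemeasurable hmean,
    ← covariance_self hI.aestronglyMeasurable.aemeasurable]
  have hg := hQ.regGram_mulVec_postWeights hσ (past xs i) (xs i)
  have hcov : ∀ l : Fin n, cov[innovation k σ xs i, fun p => noisyObs xs p l; designMeasure Q σ n] =
      regGram k σ (fun i => (xs i : Pt d)) i l -
        ∑ j : Fin i, postWeights k σ (fun j => ((past xs i j : X) : Pt d)) (xs i) j *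
          regGram k σ (fun i => (xs i : Pt d)) ⟨j, j.2.trans i.2⟩ l := by
    intro l
    rw [hQ.innovation_eq hσ]
    rw [covariance_fun_sub_left (hQ.memLp_noisyObs xs σ i) (memLp_finsetSum _ fun j _ => hm j)
      (hQ.memLp_noisyObs xs σ l), covariance_fun_sum_left hm (hQ.memLp_noisyObs xs σ l)]
    simp_rw [covariance_const_mul_left, hQ.covariance_noisyObs]
  have hzero : ∀ j : Fin i, cov[innovation k σ xs i,
      fun p => noisyObs xs p ⟨j, j.2.trans i.2⟩; designMeasure Q σ n] = 0 := by
    intro j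
    have hij : i ≠ ⟨j, j.2.trans i.2⟩ := fun h => j.2.ne (congrArg Fin.val h).symm
    have h := congrFun hg j
    rw [hcov, sub_eq_zero]
    have hl : regGram k σ (fun i => (xs i : Pt d)) i ⟨j, j.2.trans i.2⟩ = k (xs i) ((past xs i j : X) : Pt d) := by
      simp [regGram, hij, past]
    rw [hl, ← h, Matrix.mulVec, dotProduct]
    refine Finset.sum_congr rfl fun l _ => ?_
    rw [mul_comm]
    congr 1
    simp [regGram, Matrix.one_apply, past, Fin.ext_iff, hQ.symm (xs ⟨j, j.2.trans i.2⟩), eq_comm]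
  have hsplit : cov[innovation k σ xs i, innovation k σ xs i; designMeasure Q σ n] =
      cov[innovation k σ xs i, fun p => noisyObs xs p i; designMeasure Q σ n] := by
    conv_lhs => arg 2; rw [hQ.innovation_eq hσ]
    rw [covariance_fun_sub_right hI (hQ.memLp_noisyObs xs σ i) (memLp_finsetSum _ fun j _ => hm j),
      covariance_fun_sum_right hm hI]
    simp_rw [covariance_const_mul_right, hzero]
    simp
  rw [hsplit, hcov, predVar, postVar]
  have hii : regGram k σ (fun i => (xs i : Pt d)) i i = k (xs i) (xs i) + (σ : ℝ) ^ 2 := by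
    simp [regGram]
  rw [hii]
  have : ∑ j : Fin i, postWeights k σ (fun j => ((past xs i j : X) : Pt d)) (xs i) j *
      regGram k σ (fun i => (xs i : Pt d)) ⟨j, j.2.trans i.2⟩ i =
      (fun j => k (xs i) ((past xs i j : X) : Pt d)) ⬝ᵥ
        ((regGram k σ fun j => ((past xs i j : X) : Pt d))⁻¹ *ᵥ fun j => k (xs i) ((past xs i j : X) : Pt d)) := by
    refine Finset.sum_congr rfl fun j _ => ?_
    have hij : (⟨j, j.2.trans i.2⟩ : Fin n) ≠ i := fun h => j.2.ne (congrArg Fin.val h)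
    rw [mul_comm]
    congr 1
    simp [regGram, hij, past, hQ.symm (xs i)]
  rw [this]
  ring

/-! ### Information gain -/

/-- The density of the observations `y` given the values `u` of the path. -/
noncomputable def noiseDensity (σ : ℝ≥0) {n : ℕ} (q : (Fin n → ℝ) × (Fin n → ℝ)) : ℝ≥0∞ :=
  ∏ i, gaussianPDF (q.2 i) (σ ^ 2) (q.1 i)

/-- The density of the observations. -/
noncomputable def obsDensity (k : Pt d → Pt d → ℝ) (σ : ℝ≥0) {n : ℕ} (xs : Fin n → X)
    (y : Fin n → ℝ) : ℝ≥0∞ :=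
  ∏ i, gaussianPDF (predMean k σ xs y i) ((predVar k σ xs i).toNNReal + σ ^ 2) (y i)

lemma measurable_noiseDensity (σ : ℝ≥0) {n : ℕ} : Measurable (noiseDensity σ (n := n)) := by
  unfold noiseDensity
  refine Finset.measurable_prod _ fun i _ => ?_
  exact measurable_gaussianPDF_comp ((measurable_pi_apply i).comp measurable_snd) _
    ((measurable_pi_apply i).comp measurable_fst)

lemma IsPrior.measurable_predMean (hQ : IsPrior k Q) {σ : ℝ≥0} (hσ : 0 < σ) {n : ℕ}
    (xs : Fin n → X) (i : Fin n) : Measurable fun y => predMean k σ xs y i := by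
  simp_rw [predMean, hQ.postMean_eq hσ]
  exact Finset.measurable_sum _ fun j _ => (measurable_pi_apply _).const_mul _

lemma IsPrior.measurable_obsDensity (hQ : IsPrior k Q) {σ : ℝ≥0} (hσ : 0 < σ) {n : ℕ}
    (xs : Fin n → X) : Measurable (obsDensity k σ xs) := by
  unfold obsDensity
  refine Finset.measurable_prod _ fun i _ => ?_
  exact measurable_gaussianPDF_comp (hQ.measurable_predMean hσ xs i) _ (measurable_pi_apply i)

lemma obsDensity_ne_zero {σ : ℝ≥0} (hσ : 0 < σ) {n : ℕ} (xs : Fin n → X) (y : Fin n → ℝ) :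
    obsDensity k σ xs y ≠ 0 :=
  Finset.prod_ne_zero_iff.2 fun _ _ => (gaussianPDF_pos _ (by positivity) _).ne'

lemma obsDensity_ne_top {σ : ℝ≥0} {n : ℕ} (xs : Fin n → X) (y : Fin n → ℝ) :
    obsDensity k σ xs y ≠ ∞ :=
  ENNReal.prod_ne_top fun _ _ => gaussianPDF_ne_top

lemma log_toReal_gaussianPDF (m : ℝ) {v : ℝ≥0} (hv : v ≠ 0) (x : ℝ) :
    Real.log (gaussianPDF m v x).toReal =
      -(1 / 2) * Real.log (2 * Real.pi * v) - (x - m) ^ 2 / (2 * v) := by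
  have hv' : (0 : ℝ) < v := by positivity
  have hpi : 0 < 2 * Real.pi * v := by positivity
  rw [toReal_gaussianPDF, gaussianPDFReal, Real.log_mul (by positivity) (Real.exp_pos _).ne',
    Real.log_exp, Real.log_inv, Real.log_sqrt hpi.le]
  ring

/-- The mutual information between the path and the observations at the points `xs`. -/
noncomputable def designInfo (k : Pt d → Pt d → ℝ) (σ : ℝ≥0) {n : ℕ} (xs : Fin n → X) : ℝ :=
  ∑ i, 1 / 2 * Real.log (1 + ((σ : ℝ) ^ 2)⁻¹ * predVar k σ xs i)

section

variable {σ : ℝ≥0} {n : ℕ} (xs : Fin n → X)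

/-- The values of the path at the points `xs`. -/
def evalAt (φ : Path X) : Fin n → ℝ := fun i => φ.1 (xs i)

lemma measurable_evalAt : Measurable (evalAt xs) :=
  measurable_pi_lambda _ fun i => measurable_eval_const (xs i)

/-- The joint law of the observations and the values of the path. -/
noncomputable def jointLaw (Q : Measure (Path X)) (σ : ℝ≥0) : Measure ((Fin n → ℝ) × (Fin n → ℝ)) :=
  (designMeasure Q σ n).map fun p => (noisyObs xs p, evalAt xs p.1)

lemma measurable_joint :
    Measurable fun p : Path X × (Fin n → ℝ) => (noisyObs xs p, evalAt xs p.1) :=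
  (measurable_noisyObs xs).prodMk ((measurable_evalAt xs).comp measurable_fst)

lemma designLikelihood_eq (y : Fin n → ℝ) (φ : Path X) :
    designLikelihood xs σ y φ = noiseDensity σ (y, evalAt xs φ) := by
  unfold designLikelihood
  rfl

lemma lintegral_jointLaw [IsProbabilityMeasure Q] (hσ : 0 < σ)
    {g : (Fin n → ℝ) × (Fin n → ℝ) → ℝ≥0∞} (hg : Measurable g) :
    ∫⁻ q, g q ∂jointLaw xs Q σ =
      ∫⁻ y, ∫⁻ φ, g (y, evalAt xs φ) * noiseDensity σ (y, evalAt xs φ) ∂Q := by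
  rw [jointLaw, lintegral_map hg (measurable_joint xs),
    lintegral_designMeasure xs σ hσ (G := fun φ y => g (y, evalAt xs φ))]
  · simp_rw [designLikelihood_eq]
  · exact hg.comp (measurable_snd.prodMk ((measurable_evalAt xs).comp measurable_fst))

lemma jointLaw_eq_withDensity [IsProbabilityMeasure Q] (hσ : 0 < σ) :
    jointLaw xs Q σ = (volume.prod (Q.map (evalAt xs))).withDensity (noiseDensity σ) := by
  have : IsProbabilityMeasure (Q.map (evalAt xs)) :=
    Measure.isProbabilityMeasure_map (measurable_evalAt xs).aemeasurable
  refine Measure.ext_of_lintegral _ fun g hg => ?_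
  have hm : Measurable fun q => g q * noiseDensity σ q := hg.mul (measurable_noiseDensity σ)
  rw [lintegral_jointLaw xs hσ hg, lintegral_withDensity_comm _ (measurable_noiseDensity σ) hg,
    lintegral_prod _ hm.aemeasurable]
  refine lintegral_congr fun y => ?_
  exact (lintegral_map (hm.comp measurable_prodMk_left) (measurable_evalAt xs)).symm

lemma IsPrior.fst_jointLaw (hQ : IsPrior k Q) (hσ : 0 < σ) :
    (jointLaw xs Q σ).fst = volume.withDensity (obsDensity k σ xs) := by
  have := hQ.isProbabilityMeasure
  refine Measure.ext_of_lintegral _ fun g hg => ?_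
  rw [Measure.fst, lintegral_map hg measurable_fst,
    lintegral_jointLaw xs hσ (g := fun q => g q.1) (hg.comp measurable_fst),
    lintegral_withDensity_comm _ (hQ.measurable_obsDensity hσ xs) hg]
  refine lintegral_congr fun y => ?_
  rw [obsDensity, ← hQ.lintegral_designLikelihood hσ xs y, ← lintegral_const_mul]
  · simp_rw [designLikelihood_eq]
  · exact measurable_designLikelihood_const xs σ y

lemma snd_jointLaw [IsProbabilityMeasure Q] :
    (jointLaw xs Q σ).snd = Q.map (evalAt xs) := by
  rw [Measure.snd, jointLaw, Measure.map_map measurable_snd (measurable_joint xs)]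
  have hm := (measurePreserving_fst (μ := Q)
      (ν := Measure.pi fun _ : Fin n => gaussianReal 0 (σ ^ 2))).map_eq
  conv_rhs => rw [← hm]
  rw [Measure.map_map (measurable_evalAt xs) measurable_fst]
  rfl

/-- The density relative to the product of the marginals is the conditional density of `y` over its
marginal density. The quotient is harmless because the latter is positive and finite. -/
lemma IsPrior.jointLaw_eq_withDensity_prod (hQ : IsPrior k Q) (hσ : 0 < σ) :
    jointLaw xs Q σ = ((jointLaw xs Q σ).fst.prod (jointLaw xs Q σ).snd).withDensity
      (fun q => noiseDensity σ q / obsDensity k σ xs q.1) := by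
  have := hQ.isProbabilityMeasure
  have : IsProbabilityMeasure (Q.map (evalAt xs)) :=
    Measure.isProbabilityMeasure_map (measurable_evalAt xs).aemeasurable
  have ho := hQ.measurable_obsDensity hσ xs
  rw [hQ.fst_jointLaw xs hσ, snd_jointLaw, prod_withDensity_left ho, jointLaw_eq_withDensity xs hσ]
  refine Eq.trans ?_ (withDensity_mul _ (ho.comp measurable_fst)
    ((measurable_noiseDensity σ).div (ho.comp measurable_fst)))
  congr 1
  funext q
  exact (ENNReal.mul_div_cancel (obsDensity_ne_zero hσ xs _) (obsDensity_ne_top xs _)).symm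

/-- In the log ratio the normalised squares of innovation and noise both have mean `1 / 2` and
cancel. Only the logarithms of the variance ratios remain. -/
lemma IsPrior.integral_log_density (hQ : IsPrior k Q) (hσ : 0 < σ) :
    Integrable (fun q => Real.log (noiseDensity σ q / obsDensity k σ xs q.1).toReal)
      (jointLaw xs Q σ) ∧
    ∫ q, Real.log (noiseDensity σ q / obsDensity k σ xs q.1).toReal ∂jointLaw xs Q σ =
      designInfo k σ xs := by
  have := hQ.isProbabilityMeasure
  have : IsProbabilityMeasure (designMeasure Q σ n) := by unfold designMeasure; infer_instance
  have hσ2 : (0 : ℝ) < (σ : ℝ) ^ 2 := by positivity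
  have hv : ∀ i, 0 ≤ predVar k σ xs i := fun i => hQ.postVar_nonneg _ _ σ hσ
  have hlog : ∀ q : (Fin n → ℝ) × (Fin n → ℝ),
      Real.log (noiseDensity σ q / obsDensity k σ xs q.1).toReal =
        ∑ i, (1 / 2 * Real.log (1 + ((σ : ℝ) ^ 2)⁻¹ * predVar k σ xs i) +
          ((q.1 i - predMean k σ xs q.1 i) ^ 2 / (2 * (predVar k σ xs i + (σ : ℝ) ^ 2)) -
          (q.1 i - q.2 i) ^ 2 / (2 * (σ : ℝ) ^ 2))) := by
    intro q
    have h1 : (noiseDensity σ q).toReal ≠ 0 := by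
      rw [noiseDensity, ENNReal.toReal_prod]
      exact Finset.prod_ne_zero_iff.2 fun i _ => (ENNReal.toReal_pos
        (gaussianPDF_pos _ (by positivity) _).ne' gaussianPDF_ne_top).ne'
    have h2 : (obsDensity k σ xs q.1).toReal ≠ 0 :=
      (ENNReal.toReal_pos (obsDensity_ne_zero hσ xs _) (obsDensity_ne_top xs _)).ne'
    rw [ENNReal.toReal_div, Real.log_div h1 h2, noiseDensity, obsDensity, ENNReal.toReal_prod,
      ENNReal.toReal_prod, Real.log_prod (fun i _ => (ENNReal.toReal_pos
        (gaussianPDF_pos _ (by positivity) _).ne' gaussianPDF_ne_top).ne'),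
      Real.log_prod (fun i _ => (ENNReal.toReal_pos
        (gaussianPDF_pos _ (by positivity) _).ne' gaussianPDF_ne_top).ne'),
      ← Finset.sum_sub_distrib]
    refine Finset.sum_congr rfl fun i _ => ?_
    rw [log_toReal_gaussianPDF _ (by positivity), log_toReal_gaussianPDF _ (by positivity)]
    have hvi := hv i
    have e1 : 1 + ((σ : ℝ) ^ 2)⁻¹ * predVar k σ xs i =
        (2 * Real.pi * (predVar k σ xs i + (σ : ℝ) ^ 2)) / (2 * Real.pi * (σ : ℝ) ^ 2) := by
      field_simp
      ring
    rw [e1, Real.log_div (by positivity) (by positivity)]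
    push_cast
    rw [Real.coe_toNNReal _ hvi]
    ring
  have hint1 : ∀ i, Integrable (fun p : Path X × (Fin n → ℝ) =>
      innovation k σ xs i p ^ 2 / (2 * (predVar k σ xs i + (σ : ℝ) ^ 2))) (designMeasure Q σ n) :=
    fun i => (hQ.memLp_innovation hσ xs i).integrable_sq.div_const _
  have hint2 : ∀ i, Integrable (fun p : Path X × (Fin n → ℝ) =>
      p.2 i ^ 2 / (2 * (σ : ℝ) ^ 2)) (designMeasure Q σ n) :=
    fun i => (hQ.memLp_noise σ (xs i) i).integrable_sq.div_const _
  have hnoise : ∀ i, ∫ p : Path X × (Fin n → ℝ), p.2 i ^ 2 ∂designMeasure Q σ n = (σ : ℝ) ^ 2 := by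
    intro i
    have hm := hQ.memLp_noise σ (xs i) i
    have h := hQ.covariance_noise_noise σ i i
    rw [if_pos rfl, covariance_self hm.aestronglyMeasurable.aemeasurable,
      variance_of_integral_eq_zero hm.aestronglyMeasurable.aemeasurable (hQ.integral_noise σ i)] at h
    exact h
  have hmj := (measurable_joint xs).aemeasurable (μ := designMeasure Q σ n)
  have hmeas : Measurable fun q : (Fin n → ℝ) × (Fin n → ℝ) =>
      Real.log (noiseDensity σ q / obsDensity k σ xs q.1).toReal :=
    Real.measurable_log.comp (((measurable_noiseDensity σ).div
      ((hQ.measurable_obsDensity hσ xs).comp measurable_fst)).ennreal_toReal)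
  have hcomp : ∀ p : Path X × (Fin n → ℝ),
      Real.log (noiseDensity σ (noisyObs xs p, evalAt xs p.1) /
        obsDensity k σ xs (noisyObs xs p)).toReal =
      ∑ i, (1 / 2 * Real.log (1 + ((σ : ℝ) ^ 2)⁻¹ * predVar k σ xs i) +
        (innovation k σ xs i p ^ 2 / (2 * (predVar k σ xs i + (σ : ℝ) ^ 2)) -
          p.2 i ^ 2 / (2 * (σ : ℝ) ^ 2))) := by
    intro p
    rw [hlog]
    refine Finset.sum_congr rfl fun i _ => ?_
    have : noisyObs xs p i - evalAt xs p.1 i = p.2 i := by simp [noisyObs, evalAt]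
    simp only [this]
    rfl
  have hints : ∀ i, Integrable (fun p : Path X × (Fin n → ℝ) =>
      1 / 2 * Real.log (1 + ((σ : ℝ) ^ 2)⁻¹ * predVar k σ xs i) +
        (innovation k σ xs i p ^ 2 / (2 * (predVar k σ xs i + (σ : ℝ) ^ 2)) -
          p.2 i ^ 2 / (2 * (σ : ℝ) ^ 2))) (designMeasure Q σ n) := fun i =>
    (integrable_const _).add ((hint1 i).sub (hint2 i))
  constructor
  · rw [jointLaw, integrable_map_measure hmeas.aestronglyMeasurable hmj]
    refine (integrable_finsetSum Finset.univ fun i _ => hints i).congr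
      (ae_of_all _ fun p => (hcomp p).symm)
  · rw [jointLaw, integral_map hmj hmeas.aestronglyMeasurable]
    simp_rw [hcomp]
    rw [integral_finsetSum _ fun i _ => hints i]
    refine Finset.sum_congr rfl fun i _ => ?_
    have hvi := hv i
    rw [integral_add (f := fun _ => 1 / 2 * Real.log (1 + ((σ : ℝ) ^ 2)⁻¹ * predVar k σ xs i))
      (g := fun p => innovation k σ xs i p ^ 2 / (2 * (predVar k σ xs i + (σ : ℝ) ^ 2)) -
          p.2 i ^ 2 / (2 * (σ : ℝ) ^ 2)) (integrable_const _) ((hint1 i).sub (hint2 i)),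
      integral_sub (hint1 i) (hint2 i), integral_div, integral_div,
      hQ.integral_innovation_sq hσ, hnoise]
    have : predVar k σ xs i + (σ : ℝ) ^ 2 ≠ 0 := by positivity
    simp only [integral_const, probReal_univ, one_smul]
    field_simp
    ring

/-- The divergence is the mean of the log density; its mass correction vanishes since both measures
are probabilities. Only the finite-dimensional law of `f` enters, so a modification of `f` serves
equally well. -/
theorem IsPrior.infoGain_eq (hQ : IsPrior k Q) (hσ : 0 < σ) {Ω : Type*} [MeasurableSpace Ω]
    {P : Measure Ω} {f : Ω → Pt d → ℝ}
    (hlaw : P.map (fun ω i => f ω (xs i)) = Q.map (evalAt xs)) :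
    infoGain f P σ (fun i => (xs i : Pt d)) = ENNReal.ofReal (designInfo k σ xs) := by
  have := hQ.isProbabilityMeasure
  have : IsProbabilityMeasure (designMeasure Q σ n) := by unfold designMeasure; infer_instance
  have hρp : IsProbabilityMeasure (jointLaw xs Q σ) :=
    Measure.isProbabilityMeasure_map (measurable_joint xs).aemeasurable
  have hjoint : ((P.map (fun ω i => f ω (xs i))).prod
      (Measure.pi (fun _ : Fin n => gaussianReal 0 (σ ^ 2)))).map
      (fun p : (Fin n → ℝ) × (Fin n → ℝ) => (p.1 + p.2, p.1)) = jointLaw xs Q σ := by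
    have h := Measure.map_prod_map Q (Measure.pi (fun _ : Fin n => gaussianReal 0 (σ ^ 2)))
      (measurable_evalAt xs) measurable_id
    rw [Measure.map_id] at h
    rw [hlaw, h, Measure.map_map (f := Prod.map (evalAt xs) id) (by fun_prop)
      ((measurable_evalAt xs).prodMap measurable_id)]
    rfl
  rw [infoGain, hjoint, mutualInfo]
  have hden := hQ.jointLaw_eq_withDensity_prod xs hσ
  obtain ⟨hi, hval⟩ := hQ.integral_log_density xs hσ
  set ρ := jointLaw xs Q σ with hρ
  set ν := ρ.fst.prod ρ.snd with hν
  have hdm : Measurable fun q : (Fin n → ℝ) × (Fin n → ℝ) =>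
      noiseDensity σ q / obsDensity k σ xs q.1 :=
    (measurable_noiseDensity σ).div ((hQ.measurable_obsDensity hσ xs).comp measurable_fst)
  have hac : ρ ≪ ν := by
    rw [hden]; exact withDensity_absolutelyContinuous _ _
  have hllr : llr ρ ν =ᵐ[ρ] fun q => Real.log (noiseDensity σ q / obsDensity k σ xs q.1).toReal := by
    have h := Measure.rnDeriv_withDensity ν hdm
    rw [← hden] at h
    filter_upwards [hac.ae_le h] with q hq
    rw [llr, hq]
  rw [InformationTheory.klDiv_of_ac_of_integrable hac (hi.congr hllr.symm), integral_congr_ae hllr,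
    hval]
  simp [hν]

end

/-! ### Continuity of the posterior -/

/-- The determinant never vanishes, even for coinciding points, because of the noise term `σ² I`;
the adjugate formula then gives continuity. -/
lemma IsPrior.continuous_inv_regGram (hQ : IsPrior k Q) {σ : ℝ≥0} (hσ : 0 < σ)
    (hk : Continuous fun q : X × X => k q.1 q.2) {n : ℕ} :
    Continuous fun xs : Fin n → X => (regGram k σ (fun i => (xs i : Pt d)))⁻¹ := by
  have hg : Continuous fun xs : Fin n → X => regGram k σ (fun i => (xs i : Pt d)) := by
    unfold regGram
    refine Continuous.add (continuous_matrix fun i j => ?_) continuous_const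
    have hij : Continuous fun xs : Fin n → X => (xs i, xs j) := by fun_prop
    exact hk.comp hij
  have hdet : ∀ xs : Fin n → X, (regGram k σ (fun i => (xs i : Pt d))).det ≠ 0 := fun xs =>
    ((Matrix.isUnit_iff_isUnit_det _).1 (hQ.posDef_regGram hσ xs).isUnit).ne_zero
  simp_rw [Matrix.inv_def, Ring.inverse_eq_inv']
  exact (hg.matrix_det.inv₀ hdet).smul hg.matrix_adjugate

lemma continuous_kernel_vec (hk : Continuous fun q : X × X => k q.1 q.2) {n : ℕ} :
    Continuous fun q : (Fin n → X) × X => (fun i => k q.2 (q.1 i) : Fin n → ℝ) :=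
  continuous_pi fun i => hk.comp (continuous_snd.prodMk ((continuous_apply i).comp continuous_fst))

lemma IsPrior.continuous_postVar (hQ : IsPrior k Q) {σ : ℝ≥0} (hσ : 0 < σ)
    (hk : Continuous fun q : X × X => k q.1 q.2) {n : ℕ} :
    Continuous fun q : (Fin n → X) × X => postVar k σ (fun i => (q.1 i : Pt d)) q.2 := by
  unfold postVar
  refine (hk.comp (continuous_snd.prodMk continuous_snd)).sub ?_
  exact (continuous_kernel_vec hk).dotProduct
    (((hQ.continuous_inv_regGram hσ hk).comp continuous_fst).matrix_mulVec
      (continuous_kernel_vec hk))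

lemma IsPrior.continuous_postMean (hQ : IsPrior k Q) {σ : ℝ≥0} (hσ : 0 < σ)
    (hk : Continuous fun q : X × X => k q.1 q.2) {n : ℕ} :
    Continuous fun q : ((Fin n → X) × (Fin n → ℝ)) × X =>
      postMean k σ (fun i => (q.1.1 i : Pt d)) q.1.2 q.2 := by
  unfold postMean
  refine ((continuous_kernel_vec hk).comp
    ((continuous_fst.comp continuous_fst).prodMk continuous_snd)).dotProduct ?_
  exact ((hQ.continuous_inv_regGram hσ hk).comp
    (continuous_fst.comp continuous_fst)).matrix_mulVec (continuous_snd.comp continuous_fst)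

/-! ### The posterior for adaptive queries -/

/-- The values observed without noise when the queries are chosen by `sel`. -/
def predictor (sel : (t : ℕ) → (Fin t → ℝ) × (ℕ → ℝ) → X) (θ : Path X × (ℕ → ℝ)) (t : ℕ)
    (h : Fin t → ℝ) : ℝ :=
  θ.1.1 (sel t (h, θ.2))

/-- The queries made by the rule `sel` when the observations are `y`. -/
def queries (sel : (t : ℕ) → (Fin t → ℝ) × (ℕ → ℝ) → X) {t : ℕ} (D : (Fin t → ℝ) × (ℕ → ℝ))
    (i : Fin t) : X :=
  sel i (past D.1 i, D.2)

/-- A path `F`, noise `ε` and confidence parameters `ζ`, together with a measurable query rule. -/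
structure IsAdaptiveModel {Ω : Type*} [MeasurableSpace Ω] (k : Pt d → Pt d → ℝ) (σ : ℝ≥0)
    (P : Measure Ω) (F : Ω → Path X) (ε ζ : ℕ → Ω → ℝ)
    (sel : (t : ℕ) → (Fin t → ℝ) × (ℕ → ℝ) → X) : Prop where
  measurable_path : Measurable F
  measurable_ε : ∀ t, Measurable (ε t)
  measurable_ζ : ∀ t, Measurable (ζ t)
  measurable_sel : ∀ t, Measurable (sel t)
  isPrior : IsPrior k (P.map F)
  law_eq : ∀ t : ℕ, P.map (fun ω => (F ω, (fun i => ζ i ω, fun i : Fin t => ε i ω))) =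
    (P.map F).prod ((P.map fun ω i => ζ i ω).prod
      (Measure.pi fun _ : Fin t => gaussianReal 0 (σ ^ 2)))

/-- The data available before the query at time `t`: the past observations and the confidence
parameters. -/
def data {Ω : Type*} (F : Ω → Path X) (ε ζ : ℕ → Ω → ℝ)
    (sel : (t : ℕ) → (Fin t → ℝ) × (ℕ → ℝ) → X) (t : ℕ) (ω : Ω) : (Fin t → ℝ) × (ℕ → ℝ) :=
  (observations (predictor sel (F ω, fun i => ζ i ω)) t (fun i => ε i ω), fun i => ζ i ω)

/-- The posterior at `z` given the data `D`. -/
noncomputable def posterior (k : Pt d → Pt d → ℝ) (σ : ℝ≥0)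
    (sel : (t : ℕ) → (Fin t → ℝ) × (ℕ → ℝ) → X) {t : ℕ} (D : (Fin t → ℝ) × (ℕ → ℝ)) (z : X) :
    Measure ℝ :=
  gaussianReal (postMean k σ (fun i => (queries sel D i : Pt d)) D.1 z)
    (postVar k σ (fun i => (queries sel D i : Pt d)) z).toNNReal

section Adaptive

variable {σ : ℝ≥0} {sel : (t : ℕ) → (Fin t → ℝ) × (ℕ → ℝ) → X}

lemma measurable_predictor (hsel : ∀ t, Measurable (sel t)) (t : ℕ) :
    Measurable fun p : (Path X × (ℕ → ℝ)) × (Fin t → ℝ) => predictor sel p.1 t p.2 := by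
  have h : Measurable fun p : (Path X × (ℕ → ℝ)) × (Fin t → ℝ) => sel t (p.2, p.1.2) :=
    (hsel t).comp (measurable_snd.prodMk (measurable_snd.comp measurable_fst))
  exact measurable_eval.comp ((measurable_fst.comp measurable_fst).prodMk h)

lemma measurable_queries (hsel : ∀ t, Measurable (sel t)) (t : ℕ) :
    Measurable fun D : (Fin t → ℝ) × (ℕ → ℝ) => queries sel D :=
  measurable_pi_lambda _ fun i =>
    (hsel i).comp ((measurable_past i measurable_fst).prodMk measurable_snd)

/-- Once `y` and the confidence parameters are fixed, the rule prescribes definite query points. The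
adaptive likelihood is thus that of a fixed design, up to the dependence of the design on `y`. -/
lemma likelihood_predictor (θ : Path X × (ℕ → ℝ)) (t : ℕ) (y : Fin t → ℝ) :
    likelihood (predictor sel θ) (σ ^ 2) t y =
      designLikelihood (queries sel (y, θ.2)) σ y θ.1 := by
  unfold designLikelihood
  rfl

lemma measurable_postMean_queries (hQ : IsPrior k Q) (hσ : 0 < σ)
    (hk : Continuous fun q : X × X => k q.1 q.2) (hsel : ∀ t, Measurable (sel t)) {t : ℕ}
    {ξ : (Fin t → ℝ) × (ℕ → ℝ) → X} (hξ : Measurable ξ) :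
    Measurable fun D => postMean k σ (fun i => (queries sel D i : Pt d)) D.1 (ξ D) :=
  (hQ.continuous_postMean hσ hk).measurable.comp
    (((measurable_queries hsel t).prodMk measurable_fst).prodMk hξ)

lemma measurable_postVar_queries (hQ : IsPrior k Q) (hσ : 0 < σ)
    (hk : Continuous fun q : X × X => k q.1 q.2) (hsel : ∀ t, Measurable (sel t)) {t : ℕ}
    {ξ : (Fin t → ℝ) × (ℕ → ℝ) → X} (hξ : Measurable ξ) :
    Measurable fun D => postVar k σ (fun i => (queries sel D i : Pt d)) (ξ D) :=
  (hQ.continuous_postVar hσ hk).measurable.comp ((measurable_queries hsel t).prodMk hξ)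

lemma measurable_posterior (hQ : IsPrior k Q) (hσ : 0 < σ)
    (hk : Continuous fun q : X × X => k q.1 q.2) (hsel : ∀ t, Measurable (sel t)) {t : ℕ}
    {ξ : (Fin t → ℝ) × (ℕ → ℝ) → X} (hξ : Measurable ξ) :
    Measurable fun D => posterior k σ sel D (ξ D) :=
  measurable_gaussianReal.comp ((measurable_postMean_queries hQ hσ hk hsel hξ).prodMk
    (measurable_postVar_queries hQ hσ hk hsel hξ).real_toNNReal)

/-- The posterior at the point `ξ D`, as a Markov kernel in the data `D`. -/
noncomputable def posteriorKernel (hQ : IsPrior k Q) (hσ : 0 < σ)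
    (hk : Continuous fun q : X × X => k q.1 q.2) (hsel : ∀ t, Measurable (sel t)) {t : ℕ}
    {ξ : (Fin t → ℝ) × (ℕ → ℝ) → X} (hξ : Measurable ξ) : Kernel ((Fin t → ℝ) × (ℕ → ℝ)) ℝ :=
  ⟨fun D => posterior k σ sel D (ξ D), measurable_posterior hQ hσ hk hsel hξ⟩

namespace IsAdaptiveModel

variable {Ω : Type*} [MeasurableSpace Ω] {P : Measure Ω} {F : Ω → Path X} {ε ζ : ℕ → Ω → ℝ}

lemma measurable_data (hM : IsAdaptiveModel k σ P F ε ζ sel) (t : ℕ) :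
    Measurable (data F ε ζ sel t) := by
  have hζ : Measurable fun ω i => ζ i ω := measurable_pi_lambda _ hM.measurable_ζ
  have hε : Measurable fun ω (i : Fin t) => ε i ω := measurable_pi_lambda _ fun i =>
    hM.measurable_ε i
  exact ((measurable_observations (measurable_predictor hM.measurable_sel) t).comp
    ((hM.measurable_path.prodMk hζ).prodMk hε)).prodMk hζ

/-- The path is made the innermost variable, so that the data, and with them the queries, are
constant in the inner integral. -/
lemma lintegral_data [IsProbabilityMeasure P] (hM : IsAdaptiveModel k σ P F ε ζ sel) (hσ : 0 < σ)
    {t : ℕ} {G : Path X → (Fin t → ℝ) × (ℕ → ℝ) → ℝ≥0∞} (hG : Measurable (Function.uncurry G)) :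
    ∫⁻ ω, G (F ω) (data F ε ζ sel t ω) ∂P =
      ∫⁻ c, ∫⁻ y, ∫⁻ φ, G φ (y, c) * designLikelihood (queries sel (y, c)) σ y φ ∂P.map F
        ∂volume ∂(P.map fun ω i => ζ i ω) := by
  have hQ := hM.isPrior.isProbabilityMeasure
  have hv : σ ^ 2 ≠ 0 := by positivity
  have hζ : Measurable fun ω i => ζ i ω := measurable_pi_lambda _ hM.measurable_ζ
  have hε : Measurable fun ω (i : Fin t) => ε i ω := measurable_pi_lambda _ fun i =>
    hM.measurable_ε i
  have : IsProbabilityMeasure (P.map fun ω i => ζ i ω) :=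
    Measure.isProbabilityMeasure_map hζ.aemeasurable
  have hpred := measurable_predictor hM.measurable_sel
  have hobs : Measurable fun p : Path X × (ℕ → ℝ) × (Fin t → ℝ) =>
      observations (predictor sel (p.1, p.2.1)) t p.2.2 :=
    (measurable_observations hpred t).comp ((measurable_fst.prodMk
      (measurable_fst.comp measurable_snd)).prodMk (measurable_snd.comp measurable_snd))
  have hG' : Measurable fun p : Path X × (ℕ → ℝ) × (Fin t → ℝ) =>
      G p.1 (observations (predictor sel (p.1, p.2.1)) t p.2.2, p.2.1) :=
    hG.comp (measurable_fst.prodMk (hobs.prodMk (measurable_fst.comp measurable_snd)))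
  have hlik : Measurable fun p : (Path X × (ℕ → ℝ)) × (Fin t → ℝ) =>
      G p.1.1 (p.2, p.1.2) * designLikelihood (queries sel (p.2, p.1.2)) σ p.2 p.1.1 := by
    simp_rw [← likelihood_predictor]
    refine Measurable.mul ?_ (measurable_likelihood hpred (σ ^ 2) t)
    exact hG.comp ((measurable_fst.comp measurable_fst).prodMk
      (measurable_snd.prodMk (measurable_snd.comp measurable_fst)))
  calc ∫⁻ ω, G (F ω) (data F ε ζ sel t ω) ∂P
      = ∫⁻ p : Path X × (ℕ → ℝ) × (Fin t → ℝ),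
          G p.1 (observations (predictor sel (p.1, p.2.1)) t p.2.2, p.2.1)
          ∂P.map (fun ω => (F ω, (fun i => ζ i ω, fun i : Fin t => ε i ω))) := by
        rw [lintegral_map hG' (hM.measurable_path.prodMk (hζ.prodMk hε))]
        rfl
    _ = ∫⁻ φ, ∫⁻ c, ∫⁻ e, G φ (observations (predictor sel (φ, c)) t e, c)
          ∂(Measure.pi fun _ : Fin t => gaussianReal 0 (σ ^ 2)) ∂(P.map fun ω i => ζ i ω)
          ∂P.map F := by
        rw [hM.law_eq, lintegral_prod _ hG'.aemeasurable]
        refine lintegral_congr fun φ => ?_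
        exact lintegral_prod _ (hG'.comp measurable_prodMk_left).aemeasurable
    _ = ∫⁻ φ, ∫⁻ c, ∫⁻ y, G φ (y, c) * designLikelihood (queries sel (y, c)) σ y φ
          ∂volume ∂(P.map fun ω i => ζ i ω) ∂P.map F := by
        refine lintegral_congr fun φ => lintegral_congr fun c => ?_
        simp_rw [← likelihood_predictor (φ, c)]
        refine lintegral_observations (g := fun y => G φ (y, c)) (fun t => ?_) hv t ?_
        · exact (hpred t).comp measurable_prodMk_left
        · exact hG.comp (measurable_const.prodMk (measurable_id.prodMk measurable_const))
    _ = ∫⁻ c, ∫⁻ φ, ∫⁻ y, G φ (y, c) * designLikelihood (queries sel (y, c)) σ y φ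
          ∂volume ∂P.map F ∂(P.map fun ω i => ζ i ω) := by
        rw [lintegral_lintegral_swap]
        exact (hlik.lintegral_prod_right' (ν := volume)).aemeasurable
    _ = _ := by
        refine lintegral_congr fun c => ?_
        rw [lintegral_lintegral_swap]
        exact (hlik.comp ((measurable_fst.prodMk measurable_const).prodMk
          measurable_snd)).aemeasurable

/-- The law of the value at a point chosen from the data: conditionally on the data it is the
Gaussian posterior, although the queries are adaptive. -/
theorem map_data_prod [IsProbabilityMeasure P] (hM : IsAdaptiveModel k σ P F ε ζ sel) (hσ : 0 < σ)
    (hk : Continuous fun q : X × X => k q.1 q.2) {t : ℕ}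
    {ξ : (Fin t → ℝ) × (ℕ → ℝ) → X} (hξ : Measurable ξ) :
    P.map (fun ω => (data F ε ζ sel t ω, (F ω).1 (ξ (data F ε ζ sel t ω)))) =
      (P.map (data F ε ζ sel t)) ⊗ₘ posteriorKernel hM.isPrior hσ hk hM.measurable_sel hξ := by
  have hQ := hM.isPrior.isProbabilityMeasure
  have hD := hM.measurable_data t
  have : IsMarkovKernel (posteriorKernel hM.isPrior hσ hk hM.measurable_sel hξ) :=
    ⟨fun D => by
      change IsProbabilityMeasure (posterior k σ sel D (ξ D))
      unfold posterior
      infer_instance⟩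
  have hDF : Measurable fun ω => (data F ε ζ sel t ω, (F ω).1 (ξ (data F ε ζ sel t ω))) :=
    hD.prodMk (measurable_eval.comp (hM.measurable_path.prodMk (hξ.comp hD)))
  refine Measure.ext_of_lintegral _ fun g hg => ?_
  rw [Measure.lintegral_compProd hg, lintegral_map hg hDF,
    lintegral_map (hg.lintegral_kernel_prod_right' (κ := posteriorKernel hM.isPrior hσ hk
      hM.measurable_sel hξ)) hD]
  have hev : Measurable fun p : Path X × ((Fin t → ℝ) × (ℕ → ℝ)) => p.1.1 (ξ p.2) :=
    measurable_eval.comp (measurable_fst.prodMk (hξ.comp measurable_snd))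
  rw [hM.lintegral_data hσ (G := fun φ D => g (D, φ.1 (ξ D)))
    (hg.comp (measurable_snd.prodMk hev)),
    hM.lintegral_data hσ (G := fun _ D => ∫⁻ u, g (D, u)
      ∂posteriorKernel hM.isPrior hσ hk hM.measurable_sel hξ D)
    ((hg.lintegral_kernel_prod_right' (κ := posteriorKernel hM.isPrior hσ hk
      hM.measurable_sel hξ)).comp measurable_snd)]
  -- For fixed `c` and `y` both the design and the point `ξ (y, c)` are deterministic, so the
  -- pointwise Bayes rule applies.
  refine lintegral_congr fun c => lintegral_congr fun y => ?_
  rw [hM.isPrior.lintegral_mul_designLikelihood (queries sel (y, c)) (ξ (y, c)) σ hσ y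
    (h := fun u => g ((y, c), u)) (hg.comp measurable_prodMk_left),
    lintegral_const_mul _ (measurable_designLikelihood_const _ _ _), mul_comm]
  rfl

end IsAdaptiveModel

end Adaptive

/-! ### One step of the algorithm -/

/-- Keep the first `t` terms of a sequence. -/
def truncate (t : ℕ) (c : ℕ → ℝ) : ℕ → ℝ := fun i => if i < t then c i else 0

lemma measurable_truncate (t : ℕ) : Measurable (truncate t) := by
  refine measurable_pi_lambda _ fun i => ?_
  unfold truncate
  split_ifs
  · exact measurable_pi_apply i
  · exact measurable_const

/-- The rule `sel` uses at time `t` only the first `t + 1` confidence parameters. -/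
def Nonanticipating (sel : (t : ℕ) → (Fin t → ℝ) × (ℕ → ℝ) → X) : Prop :=
  ∀ (t : ℕ) (h : Fin t → ℝ) (c c' : ℕ → ℝ), (∀ j ≤ t, c j = c' j) → sel t (h, c) = sel t (h, c')

variable {σ : ℝ≥0} {sel : (t : ℕ) → (Fin t → ℝ) × (ℕ → ℝ) → X}

lemma Nonanticipating.sel_truncate (hsel : Nonanticipating sel) {i t : ℕ} (hit : i < t)
    (h : Fin i → ℝ) (c : ℕ → ℝ) : sel i (h, truncate t c) = sel i (h, c) :=
  hsel i h _ _ fun _ hj => if_pos (hj.trans_lt hit)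

lemma Nonanticipating.queries_truncate (hsel : Nonanticipating sel) {t : ℕ} (y : Fin t → ℝ)
    (c : ℕ → ℝ) : queries sel (y, truncate t c) = queries sel (y, c) :=
  funext fun i => hsel.sel_truncate i.2 _ c

lemma Nonanticipating.observations_truncate (hsel : Nonanticipating sel) (φ : Path X) (t : ℕ)
    (c : ℕ → ℝ) {i : ℕ} (hi : i ≤ t) (e : Fin i → ℝ) :
    observations (predictor sel (φ, truncate t c)) i e = observations (predictor sel (φ, c)) i e := by
  induction i with
  | zero => exact Subsingleton.elim _ _
  | succ i ih =>
    have h1 := ih (Nat.le_of_succ_le hi) (Fin.init e)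
    simp only [observations, h1]
    congr 2
    exact congrArg φ.1 (hsel.sel_truncate hi _ c)

namespace IsAdaptiveModel

variable {Ω : Type*} [MeasurableSpace Ω] {P : Measure Ω} {F : Ω → Path X} {ε ζ : ℕ → Ω → ℝ}

/-- The tower property at a point determined by the data. The data include the current confidence
parameter, on which the query depends; being independent of path and noise, it does not alter the
posterior. -/
lemma integral_postMean [IsProbabilityMeasure P] (hM : IsAdaptiveModel k σ P F ε ζ sel) (hσ : 0 < σ)
    (hk : Continuous fun q : X × X => k q.1 q.2) {t : ℕ}
    {ξ : (Fin t → ℝ) × (ℕ → ℝ) → X} (hξ : Measurable ξ)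
    (hint : Integrable (fun ω => (F ω).1 (ξ (data F ε ζ sel t ω))) P) :
    Integrable (fun ω => postMean k σ (fun i => (queries sel (data F ε ζ sel t ω) i : Pt d))
      (data F ε ζ sel t ω).1 (ξ (data F ε ζ sel t ω))) P ∧
    ∫ ω, postMean k σ (fun i => (queries sel (data F ε ζ sel t ω) i : Pt d))
      (data F ε ζ sel t ω).1 (ξ (data F ε ζ sel t ω)) ∂P =
      ∫ ω, (F ω).1 (ξ (data F ε ζ sel t ω)) ∂P := by
  have hD := hM.measurable_data t
  have hDF : Measurable fun ω => (data F ε ζ sel t ω, (F ω).1 (ξ (data F ε ζ sel t ω))) :=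
    hD.prodMk (measurable_eval.comp (hM.measurable_path.prodMk (hξ.comp hD)))
  have hlaw := hM.map_data_prod hσ hk hξ
  set κ := posteriorKernel hM.isPrior hσ hk hM.measurable_sel hξ with hκ
  have : IsMarkovKernel κ :=
    ⟨fun D => by
      change IsProbabilityMeasure (posterior k σ sel D (ξ D))
      unfold posterior
      infer_instance⟩
  have hm := measurable_postMean_queries hM.isPrior hσ hk hM.measurable_sel hξ
  have hmean : ∀ D, ∫ u, u ∂κ D = postMean k σ (fun i => (queries sel D i : Pt d)) D.1 (ξ D) :=
    fun D => integral_id_gaussianReal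
  have hi : Integrable (fun q : ((Fin t → ℝ) × (ℕ → ℝ)) × ℝ => q.2)
      ((P.map (data F ε ζ sel t)) ⊗ₘ κ) := by
    rw [← hlaw, integrable_map_measure measurable_snd.aestronglyMeasurable hDF.aemeasurable]
    exact hint
  have h1 := MeasureTheory.Integrable.integral_compProd
    (κ := Kernel.const Unit (P.map (data F ε ζ sel t))) (η := Kernel.prodMkLeft Unit κ) (a := ()) hi
  have h2 := Measure.integral_compProd hi
  simp only [Kernel.const_apply, Kernel.prodMkLeft_apply, hmean] at h1 h2
  constructor
  · exact (integrable_map_measure hm.aestronglyMeasurable hD.aemeasurable).1 h1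
  · rw [← hlaw, integral_map hDF.aemeasurable measurable_snd.aestronglyMeasurable,
      integral_map hD.aemeasurable hm.aestronglyMeasurable] at h2
    exact h2.symm

/-- The observations before time `t` involve only earlier confidence parameters, so `ζ t` is
independent of them and can be integrated out as a fresh variable. Truncation is needed because
`data` carries the whole sequence `ζ`. -/
lemma lintegral_resample [IsProbabilityMeasure P] (hM : IsAdaptiveModel k σ P F ε ζ sel)
    {t : ℕ} (hsel : Nonanticipating sel)
    (hind : IndepFun (fun ω => truncate t fun i => ζ i ω) (ζ t) P)
    {G : ((Fin t → ℝ) × (ℕ → ℝ)) × ℝ → ℝ≥0∞} (hG : Measurable G) :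
    ∫⁻ ω, G (((data F ε ζ sel t ω).1, truncate t fun i => ζ i ω), ζ t ω) ∂P =
      ∫⁻ ω, ∫⁻ v, G (((data F ε ζ sel t ω).1, truncate t fun i => ζ i ω), v) ∂P.map (ζ t) ∂P := by
  have hQ := hM.isPrior.isProbabilityMeasure
  have hζ : Measurable fun ω i => ζ i ω := measurable_pi_lambda _ hM.measurable_ζ
  have hε : Measurable fun ω (i : Fin t) => ε i ω := measurable_pi_lambda _ fun i =>
    hM.measurable_ε i
  set Z := P.map fun ω i => ζ i ω with hZ
  have hZp : IsProbabilityMeasure Z := Measure.isProbabilityMeasure_map hζ.aemeasurable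
  have hEp : IsProbabilityMeasure (P.map (ζ t)) :=
    Measure.isProbabilityMeasure_map (hM.measurable_ζ t).aemeasurable
  set π := Measure.pi fun _ : Fin t => gaussianReal 0 (σ ^ 2)
  have htr := measurable_truncate t
  have hZt : Z.map (fun c => (truncate t c, c t)) = (Z.map (truncate t)).prod (P.map (ζ t)) := by
    have h := hind.map_prod_eq_prod_map_map (htr.comp hζ).aemeasurable
      (hM.measurable_ζ t).aemeasurable
    rw [hZ, Measure.map_map (htr.prodMk (measurable_pi_apply t)) hζ, Measure.map_map htr hζ]
    exact h
  have hZl : ∀ g : (ℕ → ℝ) × ℝ → ℝ≥0∞, Measurable g →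
      ∫⁻ c, g (truncate t c, c t) ∂Z = ∫⁻ c, ∫⁻ v, g (truncate t c, v) ∂P.map (ζ t) ∂Z := by
    intro g hg
    have h1 : ∫⁻ c, g (truncate t c, c t) ∂Z =
        ∫⁻ q, g q ∂Z.map (fun c => (truncate t c, c t)) :=
      (lintegral_map hg (htr.prodMk (measurable_pi_apply t))).symm
    rw [h1, hZt, lintegral_prod _ hg.aemeasurable, lintegral_map hg.lintegral_prod_right' htr]
  have hobs : Measurable fun p : (Path X × (Fin t → ℝ)) × (ℕ → ℝ) =>
      observations (predictor sel (p.1.1, p.2)) t p.1.2 :=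
    (measurable_observations (measurable_predictor hM.measurable_sel) t).comp
      (((measurable_fst.comp measurable_fst).prodMk measurable_snd).prodMk
        (measurable_snd.comp measurable_fst))
  have hK : Measurable fun p : (Path X × (Fin t → ℝ)) × (ℕ → ℝ) × ℝ =>
      G ((observations (predictor sel (p.1.1, p.2.1)) t p.1.2, p.2.1), p.2.2) :=
    hG.comp (((hobs.comp (measurable_fst.prodMk (measurable_fst.comp measurable_snd))).prodMk
      (measurable_fst.comp measurable_snd)).prodMk (measurable_snd.comp measurable_snd))
  have hexp : ∀ g : (Path X × (Fin t → ℝ)) × (ℕ → ℝ) → ℝ≥0∞, Measurable g →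
      ∫⁻ ω, g ((F ω, fun i : Fin t => ε i ω), fun i => ζ i ω) ∂P =
        ∫⁻ φ, ∫⁻ e, ∫⁻ c, g ((φ, e), c) ∂Z ∂π ∂P.map F := by
    intro g hg
    have hg' : Measurable fun p : Path X × (ℕ → ℝ) × (Fin t → ℝ) => g ((p.1, p.2.2), p.2.1) :=
      hg.comp ((measurable_fst.prodMk (measurable_snd.comp measurable_snd)).prodMk
        (measurable_fst.comp measurable_snd))
    have h1 : ∫⁻ ω, g ((F ω, fun i : Fin t => ε i ω), fun i => ζ i ω) ∂P =
        ∫⁻ p : Path X × (ℕ → ℝ) × (Fin t → ℝ), g ((p.1, p.2.2), p.2.1)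
          ∂P.map (fun ω => (F ω, (fun i => ζ i ω, fun i : Fin t => ε i ω))) :=
      (lintegral_map hg' (hM.measurable_path.prodMk (hζ.prodMk hε))).symm
    rw [h1, hM.law_eq, lintegral_prod _ hg'.aemeasurable]
    refine lintegral_congr fun φ => ?_
    exact lintegral_prod_symm' _ (hg'.comp measurable_prodMk_left)
  have hdata : ∀ ω, (data F ε ζ sel t ω).1 = observations
      (predictor sel (F ω, truncate t fun i => ζ i ω)) t (fun i => ε i ω) := fun ω =>
    (hsel.observations_truncate (F ω) t (fun i => ζ i ω) le_rfl _).symm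
  have hg1 : Measurable fun p : (Path X × (Fin t → ℝ)) × (ℕ → ℝ) =>
      G ((observations (predictor sel (p.1.1, truncate t p.2)) t p.1.2, truncate t p.2), p.2 t) :=
    hK.comp (measurable_fst.prodMk ((htr.comp measurable_snd).prodMk
      ((measurable_pi_apply t).comp measurable_snd)))
  have hg2 : Measurable fun p : (Path X × (Fin t → ℝ)) × (ℕ → ℝ) =>
      ∫⁻ v, G ((observations (predictor sel (p.1.1, truncate t p.2)) t p.1.2, truncate t p.2), v)
        ∂P.map (ζ t) := by
    have h : Measurable fun q : ((Path X × (Fin t → ℝ)) × (ℕ → ℝ)) × ℝ =>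
        G ((observations (predictor sel (q.1.1.1, truncate t q.1.2)) t q.1.1.2,
          truncate t q.1.2), q.2) :=
      hK.comp ((measurable_fst.comp measurable_fst).prodMk
        ((htr.comp (measurable_snd.comp measurable_fst)).prodMk measurable_snd))
    exact h.lintegral_prod_right'
  simp_rw [hdata]
  rw [hexp _ hg1, hexp _ hg2]
  refine lintegral_congr fun φ => lintegral_congr fun e => ?_
  exact hZl (fun q => G ((observations (predictor sel (φ, q.1)) t e, q.1), q.2))
    (hK.comp (measurable_prodMk_left (x := (φ, e))))

/-- The maximum of the path over a finite set is stochastically dominated by the maximum of the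
randomised upper confidence bound. -/
theorem meas_exists_lt_le [IsProbabilityMeasure P] (hM : IsAdaptiveModel k σ P F ε ζ sel)
    (hσ : 0 < σ) (hk : Continuous fun q : X × X => k q.1 q.2) {t : ℕ} (hsel : Nonanticipating sel)
    (hind : IndepFun (fun ω => truncate t fun i => ζ i ω) (ζ t) P) {s : ℝ}
    (hζ : P.map (ζ t) = twoParamExp s (1 / 2)) (S : Finset X)
    (hS : (S.card : ℝ) / 2 ≤ Real.exp (s / 2)) (c : ℝ) :
    P {ω | ∃ z ∈ S, c < (F ω).1 z} ≤ P {ω | ∃ z ∈ S, c <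
      postMean k σ (fun i => (queries sel (data F ε ζ sel t ω) i : Pt d))
        (data F ε ζ sel t ω).1 z +
      √(ζ t ω) * √(postVar k σ (fun i => (queries sel (data F ε ζ sel t ω) i : Pt d)) z)} := by
  have hD := hM.measurable_data t
  have hζm : Measurable fun ω i => ζ i ω := measurable_pi_lambda _ hM.measurable_ζ
  let p (D : (Fin t → ℝ) × (ℕ → ℝ)) : ℝ≥0∞ := ∑ z ∈ S, posterior k σ sel D z (Ioi c)
  have hpm : ∀ z, Measurable fun D : (Fin t → ℝ) × (ℕ → ℝ) => posterior k σ sel D z (Ioi c) :=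
    fun z => (Measure.measurable_coe measurableSet_Ioi).comp
      (measurable_posterior hM.isPrior hσ hk hM.measurable_sel (measurable_const (a := z)))
  have hp : Measurable p := Finset.measurable_sum _ fun z _ => hpm z
  -- On `A` the union bound is trivial and the probability is bounded by 1; off `A` it is used.
  -- Together they give the mean of `min 1 p`, which, unlike `p`, can be compared with a
  -- probability.
  let A : Set ((Fin t → ℝ) × (ℕ → ℝ)) := {D | 1 ≤ p D}
  have hA : MeasurableSet A := measurableSet_le measurable_const hp
  -- conditional union bound
  have hz : ∀ z : X, P {ω | c < (F ω).1 z ∧ data F ε ζ sel t ω ∈ Aᶜ} =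
      ∫⁻ ω in data F ε ζ sel t ⁻¹' Aᶜ, posterior k σ sel (data F ε ζ sel t ω) z (Ioi c) ∂P := by
    intro z
    have hlaw := hM.map_data_prod hσ hk (t := t) (measurable_const (a := z))
    have hDF : Measurable fun ω => (data F ε ζ sel t ω, (F ω).1 z) :=
      hD.prodMk ((measurable_eval_const z).comp hM.measurable_path)
    set κ := posteriorKernel hM.isPrior hσ hk hM.measurable_sel (t := t)
      (measurable_const (a := z)) with hκ
    have : IsMarkovKernel κ :=
      ⟨fun D => by
        change IsProbabilityMeasure (posterior k σ sel D z)
        unfold posterior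
        infer_instance⟩
    have h1 := congrArg (fun μ => μ (Aᶜ ×ˢ Ioi c)) hlaw
    rw [Measure.map_apply hDF (hA.compl.prod measurableSet_Ioi),
      Measure.compProd_apply_prod hA.compl measurableSet_Ioi,
      setLIntegral_map hA.compl (κ.measurable_coe measurableSet_Ioi) hD] at h1
    refine Eq.trans ?_ h1
    congr 1
    ext ω
    exact and_comm
  have hstep1 : P {ω | ∃ z ∈ S, c < (F ω).1 z} ≤ ∫⁻ ω, min 1 (p (data F ε ζ sel t ω)) ∂P := by
    have hsub : {ω | ∃ z ∈ S, c < (F ω).1 z} ⊆ data F ε ζ sel t ⁻¹' A ∪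
        ⋃ z ∈ S, {ω | c < (F ω).1 z ∧ data F ε ζ sel t ω ∈ Aᶜ} := by
      rintro ω ⟨z, hzS, hz⟩
      by_cases hω : data F ε ζ sel t ω ∈ A
      · exact Or.inl hω
      · exact Or.inr (mem_iUnion₂.2 ⟨z, hzS, hz, hω⟩)
    calc P {ω | ∃ z ∈ S, c < (F ω).1 z}
        ≤ P (data F ε ζ sel t ⁻¹' A) +
          ∑ z ∈ S, P {ω | c < (F ω).1 z ∧ data F ε ζ sel t ω ∈ Aᶜ} :=
          (measure_mono hsub).trans ((measure_union_le _ _).trans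
            (add_le_add le_rfl (measure_biUnion_finset_le _ _)))
      _ = (∫⁻ _ in data F ε ζ sel t ⁻¹' A, 1 ∂P) +
          ∫⁻ ω in data F ε ζ sel t ⁻¹' Aᶜ, p (data F ε ζ sel t ω) ∂P := by
          simp_rw [hz]
          rw [setLIntegral_one]
          exact congrArg _ (lintegral_finsetSum _ fun z _ => (hpm z).comp hD).symm
      _ = (∫⁻ ω in data F ε ζ sel t ⁻¹' A, min 1 (p (data F ε ζ sel t ω)) ∂P) +
          ∫⁻ ω in (data F ε ζ sel t ⁻¹' A)ᶜ, min 1 (p (data F ε ζ sel t ω)) ∂P := by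
          congr 1
          · exact setLIntegral_congr_fun (hD hA) fun ω hω => (min_eq_left hω).symm
          · exact setLIntegral_congr_fun (hD hA).compl fun ω hω =>
              (min_eq_right (not_le.1 (show ¬ 1 ≤ p _ from hω)).le).symm
      _ = _ := lintegral_add_compl _ (hD hA)
  refine hstep1.trans ?_
  let B : Set (((Fin t → ℝ) × (ℕ → ℝ)) × ℝ) := {q | ∃ z ∈ S, c <
    postMean k σ (fun i => (queries sel q.1 i : Pt d)) q.1.1 z +
      √q.2 * √(postVar k σ (fun i => (queries sel q.1 i : Pt d)) z)}
  have hB : MeasurableSet B := by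
    have : B = ⋃ z ∈ S, {q | c < postMean k σ (fun i => (queries sel q.1 i : Pt d)) q.1.1 z +
      √q.2 * √(postVar k σ (fun i => (queries sel q.1 i : Pt d)) z)} := by
      ext q; simp [B]
    rw [this]
    refine Finset.measurableSet_biUnion _ fun z _ => measurableSet_lt measurable_const ?_
    have h1 := (measurable_postMean_queries hM.isPrior hσ hk hM.measurable_sel (t := t)
      (measurable_const (a := z))).comp
      (measurable_fst : Measurable fun q : ((Fin t → ℝ) × (ℕ → ℝ)) × ℝ => q.1)
    have h2 := (measurable_postVar_queries hM.isPrior hσ hk hM.measurable_sel (t := t)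
      (measurable_const (a := z))).comp
      (measurable_fst : Measurable fun q : ((Fin t → ℝ) × (ℕ → ℝ)) × ℝ => q.1)
    exact h1.add (measurable_snd.sqrt.mul h2.sqrt)
  have hq : ∀ ω, queries sel ((data F ε ζ sel t ω).1, truncate t fun i => ζ i ω) =
      queries sel (data F ε ζ sel t ω) := fun ω => hsel.queries_truncate _ _
  -- After `ζ t` has been made fresh, the comparison of the union bound with the randomised bound
  -- applies for each value of the data.
  have hres := hM.lintegral_resample hsel hind (measurable_one.indicator hB (f := 1))
  have hlhs : ∫⁻ ω, B.indicator 1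
      (((data F ε ζ sel t ω).1, truncate t fun i => ζ i ω), ζ t ω) ∂P =
      P {ω | ∃ z ∈ S, c <
      postMean k σ (fun i => (queries sel (data F ε ζ sel t ω) i : Pt d))
        (data F ε ζ sel t ω).1 z +
      √(ζ t ω) * √(postVar k σ (fun i => (queries sel (data F ε ζ sel t ω) i : Pt d)) z)} := by
    have hm : Measurable fun ω =>
        (((data F ε ζ sel t ω).1, truncate t fun i => ζ i ω), ζ t ω) :=
      ((measurable_fst.comp hD).prodMk ((measurable_truncate t).comp hζm)).prodMk
        (hM.measurable_ζ t)
    refine (lintegral_indicator_one (hm hB)).trans ?_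
    congr 1
    ext ω
    change (∃ z ∈ S, _) ↔ ∃ z ∈ S, _
    simp only [hq]
  rw [← hlhs, hres]
  refine lintegral_mono fun ω => ?_
  have hpost := min_sum_gaussianReal_le S
    (fun z => postMean k σ (fun i => (queries sel (data F ε ζ sel t ω) i : Pt d))
      (data F ε ζ sel t ω).1 z)
    (fun z => (postVar k σ (fun i => (queries sel (data F ε ζ sel t ω) i : Pt d)) z).toNNReal)
    s c hS
  refine hpost.trans (le_of_eq ?_)
  rw [hζ]
  have hBs : MeasurableSet ((fun v : ℝ =>
      (((data F ε ζ sel t ω).1, truncate t fun i => ζ i ω), v)) ⁻¹' B) :=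
    measurable_prodMk_left hB
  refine Eq.trans ?_ (lintegral_indicator_one hBs).symm
  congr 1
  ext v
  change (∃ z ∈ S, _) ↔ ∃ z ∈ S, _
  simp only [hq, Real.coe_toNNReal _ (hM.isPrior.postVar_nonneg _ _ σ hσ)]

end IsAdaptiveModel

/-! ### The regret on a finite set -/

/-- The query made at time `t`. -/
def query {Ω : Type*} (F : Ω → Path X) (ε ζ : ℕ → Ω → ℝ)
    (sel : (t : ℕ) → (Fin t → ℝ) × (ℕ → ℝ) → X) (t : ℕ) (ω : Ω) : X :=
  sel t (data F ε ζ sel t ω)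

/-- The posterior variance at the query made at time `t`. -/
noncomputable def queryVar {Ω : Type*} (k : Pt d → Pt d → ℝ) (σ : ℝ≥0) (F : Ω → Path X)
    (ε ζ : ℕ → Ω → ℝ) (sel : (t : ℕ) → (Fin t → ℝ) × (ℕ → ℝ) → X) (t : ℕ) (ω : Ω) : ℝ :=
  postVar k σ (fun i => (queries sel (data F ε ζ sel t ω) i : Pt d)) (query F ε ζ sel t ω)

/-- The upper confidence bound used at time `t`. -/
noncomputable def upperBound {Ω : Type*} (k : Pt d → Pt d → ℝ) (σ : ℝ≥0) (F : Ω → Path X)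
    (ε ζ : ℕ → Ω → ℝ) (sel : (t : ℕ) → (Fin t → ℝ) × (ℕ → ℝ) → X) (t : ℕ) (ω : Ω) (z : X) : ℝ :=
  ucb k σ (fun i => (queries sel (data F ε ζ sel t ω) i : Pt d)) (data F ε ζ sel t ω).1 (ζ t ω) z

/-- The mean of the positive part of the two-parameter exponential distribution. -/
noncomputable def posMean (s : ℝ) : ℝ := if 0 ≤ s then 2 + s else 2 * Real.exp (s / 2)

lemma posMean_nonneg (s : ℝ) : 0 ≤ posMean s := by
  unfold posMean
  split_ifs with h
  · linarith
  · positivity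

lemma integrable_and_integral_max {Ω : Type*} [MeasurableSpace Ω] {P : Measure Ω} {Z : Ω → ℝ}
    (hZ : Measurable Z) {s : ℝ} (h : P.map Z = twoParamExp s (1 / 2)) :
    Integrable (fun ω => max (Z ω) 0) P ∧ ∫ ω, max (Z ω) 0 ∂P = posMean s := by
  have h1 : ∫⁻ ω, ENNReal.ofReal (max (Z ω) 0) ∂P = ENNReal.ofReal (posMean s) := by
    have h2 := lintegral_twoParamExp s
    rw [← h] at h2
    refine Eq.trans ?_ ((lintegral_map ENNReal.measurable_ofReal hZ).symm.trans h2)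
    refine lintegral_congr fun ω => ?_
    rw [ENNReal.ofReal_max, ENNReal.ofReal_zero, max_eq_left (zero_le)]
  have h0 : 0 ≤ᵐ[P] fun ω => max (Z ω) 0 := .of_forall fun ω => le_max_right _ _
  have hm : AEStronglyMeasurable (fun ω => max (Z ω) 0) P :=
    (hZ.max measurable_const).aestronglyMeasurable
  constructor
  · exact ⟨hm, (hasFiniteIntegral_iff_ofReal h0).2 (h1 ▸ ENNReal.ofReal_lt_top)⟩
  · rw [integral_eq_lintegral_of_nonneg_ae h0 hm, h1, ENNReal.toReal_ofReal (posMean_nonneg s)]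

namespace IsAdaptiveModel

variable {Ω : Type*} [MeasurableSpace Ω] {P : Measure Ω} {F : Ω → Path X} {ε ζ : ℕ → Ω → ℝ}
  {σ : ℝ≥0} {sel : (t : ℕ) → (Fin t → ℝ) × (ℕ → ℝ) → X}

lemma measurable_query (hM : IsAdaptiveModel k σ P F ε ζ sel) (t : ℕ) :
    Measurable (query F ε ζ sel t) :=
  (hM.measurable_sel t).comp (hM.measurable_data t)

lemma measurable_value (hM : IsAdaptiveModel k σ P F ε ζ sel) (t : ℕ) :
    Measurable fun ω => (F ω).1 (query F ε ζ sel t ω) :=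
  measurable_eval.comp (hM.measurable_path.prodMk (hM.measurable_query t))

lemma measurable_queryVar (hM : IsAdaptiveModel k σ P F ε ζ sel) (hσ : 0 < σ)
    (hk : Continuous fun q : X × X => k q.1 q.2) (t : ℕ) :
    Measurable (queryVar k σ F ε ζ sel t) :=
  (measurable_postVar_queries hM.isPrior hσ hk hM.measurable_sel (hM.measurable_sel t)).comp
    (hM.measurable_data t)

lemma queryVar_nonneg (hM : IsAdaptiveModel k σ P F ε ζ sel) (hσ : 0 < σ) (t : ℕ) (ω : Ω) :
    0 ≤ queryVar k σ F ε ζ sel t ω :=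
  hM.isPrior.postVar_nonneg _ _ σ hσ

lemma queryVar_le (hM : IsAdaptiveModel k σ P F ε ζ sel) (hσ : 0 < σ)
    (hk1 : ∀ z : X, k z z = 1) (t : ℕ) (ω : Ω) : queryVar k σ F ε ζ sel t ω ≤ 1 :=
  (hM.isPrior.postVar_le _ _ σ hσ).trans (hk1 _).le

lemma integrable_queryVar [IsProbabilityMeasure P] (hM : IsAdaptiveModel k σ P F ε ζ sel)
    (hσ : 0 < σ) (hk : Continuous fun q : X × X => k q.1 q.2) (hk1 : ∀ z : X, k z z = 1) (t : ℕ) :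
    Integrable (queryVar k σ F ε ζ sel t) P :=
  Integrable.of_bound (hM.measurable_queryVar hσ hk t).aestronglyMeasurable 1 <|
    .of_forall fun ω => by
      rw [Real.norm_of_nonneg (hM.queryVar_nonneg hσ t ω)]
      exact hM.queryVar_le hσ hk1 t ω

/-- The width of the confidence interval at the query. -/
lemma integrable_width [IsProbabilityMeasure P] (hM : IsAdaptiveModel k σ P F ε ζ sel)
    (hσ : 0 < σ) (hk : Continuous fun q : X × X => k q.1 q.2) (hk1 : ∀ z : X, k z z = 1) {t : ℕ}
    {s : ℝ} (hζ : P.map (ζ t) = twoParamExp s (1 / 2)) :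
    Integrable (fun ω => √(ζ t ω) * √(queryVar k σ F ε ζ sel t ω)) P := by
  refine Integrable.mono' (((integrable_and_integral_max (hM.measurable_ζ t) hζ).1).add
    (hM.integrable_queryVar hσ hk hk1 t))
    ((hM.measurable_ζ t).sqrt.mul (hM.measurable_queryVar hσ hk t).sqrt).aestronglyMeasurable
    (.of_forall fun ω => ?_)
  have hv := Real.sq_sqrt (hM.queryVar_nonneg hσ t ω)
  have hz : √(ζ t ω) ^ 2 = max (ζ t ω) 0 := by
    rcases le_total 0 (ζ t ω) with h | h
    · rw [Real.sq_sqrt h, max_eq_left h]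
    · rw [Real.sqrt_eq_zero_of_nonpos h, max_eq_right h]; simp
  rw [Real.norm_of_nonneg (by positivity)]
  simp only [Pi.add_apply, ← hz]
  nlinarith [sq_nonneg (√(ζ t ω) - √(queryVar k σ F ε ζ sel t ω)), Real.sqrt_nonneg (ζ t ω),
    Real.sqrt_nonneg (queryVar k σ F ε ζ sel t ω),
    mul_nonneg (Real.sqrt_nonneg (ζ t ω)) (Real.sqrt_nonneg (queryVar k σ F ε ζ sel t ω))]

/-- The expected regret of one query against a finite set. -/
theorem integral_sup_sub_query_le [IsProbabilityMeasure P]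
    (hM : IsAdaptiveModel k σ P F ε ζ sel) (hσ : 0 < σ)
    (hk : Continuous fun q : X × X => k q.1 q.2) (hk1 : ∀ z : X, k z z = 1) {t : ℕ}
    (hsel : Nonanticipating sel)
    (hind : IndepFun (fun ω => truncate t fun i => ζ i ω) (ζ t) P) {s : ℝ}
    (hζ : P.map (ζ t) = twoParamExp s (1 / 2)) {S : Finset X} (hne : S.Nonempty)
    (hS : (S.card : ℝ) / 2 ≤ Real.exp (s / 2))
    (hmax : ∀ᵐ ω ∂P, ∀ z, upperBound k σ F ε ζ sel t ω z ≤
      upperBound k σ F ε ζ sel t ω (query F ε ζ sel t ω))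
    (hint : Integrable (fun ω => (F ω).1 (query F ε ζ sel t ω)) P)
    (hintS : Integrable (fun ω => S.sup' hne fun z => (F ω).1 z) P) :
    ∫ ω, S.sup' hne (fun z => (F ω).1 z) ∂P - ∫ ω, (F ω).1 (query F ε ζ sel t ω) ∂P ≤
      ∫ ω, √(ζ t ω) * √(queryVar k σ F ε ζ sel t ω) ∂P := by
  obtain ⟨hmi, hme⟩ := hM.integral_postMean hσ hk (hM.measurable_sel t) hint
  have hw := hM.integrable_width hσ hk hk1 hζ
  rw [sub_le_iff_le_add']
  have hadd := integral_add hmi hw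
  rw [hme] at hadd
  refine le_of_le_of_eq ?_ hadd
  -- The mean of the upper confidence bound at the query is `E f(x_t)` plus the mean width. That
  -- bound dominates its maximum over `S`, which stochastically dominates the maximum of `f`.
  refine integral_le_of_meas_lt_le hintS (hmi.add hw) fun c => ?_
  have h1 : {ω | c < S.sup' hne (fun z => (F ω).1 z)} = {ω | ∃ z ∈ S, c < (F ω).1 z} := by
    ext ω
    exact Finset.lt_sup'_iff (f := fun z => (F ω).1 z) hne
  rw [h1]
  refine (hM.meas_exists_lt_le hσ hk hsel hind hζ S hS c).trans (measure_mono_ae ?_)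
  filter_upwards [hmax] with ω hω
  rintro ⟨z, -, hz⟩
  exact hz.trans_le (hω z)

/-- The expected regret of the best of `T` queries against a finite set. -/
theorem integral_sup_le [IsProbabilityMeasure P]
    (hM : IsAdaptiveModel k σ P F ε ζ sel) (hσ : 0 < σ)
    (hk : Continuous fun q : X × X => k q.1 q.2) (hk1 : ∀ z : X, k z z = 1)
    (hsel : Nonanticipating sel)
    (hind : ∀ t, IndepFun (fun ω => truncate t fun i => ζ i ω) (ζ t) P) {s : ℝ}
    (hζ : ∀ t, P.map (ζ t) = twoParamExp s (1 / 2)) {S : Finset X} (hne : S.Nonempty)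
    (hS : (S.card : ℝ) / 2 ≤ Real.exp (s / 2))
    (hmax : ∀ t, ∀ᵐ ω ∂P, ∀ z, upperBound k σ F ε ζ sel t ω z ≤
      upperBound k σ F ε ζ sel t ω (query F ε ζ sel t ω))
    (hint : ∀ t, Integrable (fun ω => (F ω).1 (query F ε ζ sel t ω)) P)
    (hintS : Integrable (fun ω => S.sup' hne fun z => (F ω).1 z) P)
    {T : ℕ} (hT : 0 < T) {V : ℝ}
    (hV : ∀ ω, ∑ t ∈ Finset.range T, queryVar k σ F ε ζ sel t ω ≤ V) {M : Ω → ℝ}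
    (hMi : Integrable M P) (hMle : ∀ ω, ∀ t < T, (F ω).1 (query F ε ζ sel t ω) ≤ M ω) :
    ∫ ω, S.sup' hne (fun z => (F ω).1 z) ∂P ≤ ∫ ω, M ω ∂P + √(posMean s * V / T) := by
  have hT' : (0 : ℝ) < T := by exact_mod_cast hT
  have hw := fun t => hM.integrable_width hσ hk hk1 (hζ t)
  set W : ℝ := ∑ t ∈ Finset.range T, ∫ ω, √(ζ t ω) * √(queryVar k σ F ε ζ sel t ω) ∂P with hW
  have h1 : T * ∫ ω, S.sup' hne (fun z => (F ω).1 z) ∂P ≤ T * ∫ ω, M ω ∂P + W := by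
    have h : ∑ t ∈ Finset.range T, ∫ ω, S.sup' hne (fun z => (F ω).1 z) ∂P ≤
        ∑ t ∈ Finset.range T, (∫ ω, M ω ∂P +
          ∫ ω, √(ζ t ω) * √(queryVar k σ F ε ζ sel t ω) ∂P) := by
      refine Finset.sum_le_sum fun t ht => ?_
      have h2 := hM.integral_sup_sub_query_le hσ hk hk1 hsel (hind t) (hζ t) hne hS (hmax t)
        (hint t) hintS
      have h3 : ∫ ω, (F ω).1 (query F ε ζ sel t ω) ∂P ≤ ∫ ω, M ω ∂P :=
        integral_mono (hint t) hMi fun ω => hMle ω t (Finset.mem_range.1 ht)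
      linarith
    simpa [Finset.sum_add_distrib, ← hW] using h
  have h2 : W ^ 2 ≤ T * posMean s * V := by
    -- Cauchy-Schwarz in time and probability at once: the sum over `t` of the means of `(θ √ζ_t -
    -- σ(x_t))²` is nonnegative for every `θ`, so the quadratic in `θ` has nonpositive discriminant.
    have hd : discrim (T * posMean s) (-2 * W) V ≤ 0 := by
      refine discrim_le_zero fun θ => ?_
      have hz : ∀ t ω, √(ζ t ω) ^ 2 = max (ζ t ω) 0 := fun t ω => by
        rcases le_total 0 (ζ t ω) with h | h
        · rw [Real.sq_sqrt h, max_eq_left h]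
        · rw [Real.sqrt_eq_zero_of_nonpos h, max_eq_right h]; simp
      have hmx := fun t => integrable_and_integral_max (hM.measurable_ζ t) (hζ t)
      have hqv := fun t => hM.integrable_queryVar hσ hk hk1 t
      have h3 : ∀ t, 0 ≤ θ * θ * posMean s -
          2 * θ * ∫ ω, √(ζ t ω) * √(queryVar k σ F ε ζ sel t ω) ∂P +
          ∫ ω, queryVar k σ F ε ζ sel t ω ∂P := by
        intro t
        have e : ∫ ω, (θ * θ * max (ζ t ω) 0 -
            2 * θ * (√(ζ t ω) * √(queryVar k σ F ε ζ sel t ω)) + queryVar k σ F ε ζ sel t ω) ∂P =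
            ∫ ω, (θ * θ * max (ζ t ω) 0 -
              2 * θ * (√(ζ t ω) * √(queryVar k σ F ε ζ sel t ω))) ∂P +
            ∫ ω, queryVar k σ F ε ζ sel t ω ∂P :=
          integral_add (((hmx t).1.const_mul _).sub ((hw t).const_mul _)) (hqv t)
        rw [← (hmx t).2, ← integral_const_mul, ← integral_const_mul,
          ← integral_sub ((hmx t).1.const_mul _) ((hw t).const_mul _), ← e]
        refine integral_nonneg fun ω => ?_
        have hv := Real.sq_sqrt (hM.queryVar_nonneg hσ t ω)
        rw [← hz]
        simp only [Pi.zero_apply]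
        nlinarith [sq_nonneg (θ * √(ζ t ω) - √(queryVar k σ F ε ζ sel t ω))]
      have h4 : ∑ t ∈ Finset.range T, ∫ ω, queryVar k σ F ε ζ sel t ω ∂P ≤ V := by
        rw [← integral_finsetSum _ fun t _ => hqv t]
        refine (integral_mono (integrable_finsetSum _ fun t _ => hqv t)
          (integrable_const V) hV).trans_eq (by simp)
      have h5 := Finset.sum_nonneg fun t (_ : t ∈ Finset.range T) => h3 t
      rw [Finset.sum_add_distrib, Finset.sum_sub_distrib, ← Finset.mul_sum, ← Finset.mul_sum,
        ← hW] at h5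
      simp only [Finset.sum_const, Finset.card_range, nsmul_eq_mul] at h5
      linarith
    unfold discrim at hd
    linarith
  have h3 : W / T ≤ √(posMean s * V / T) := by
    refine Real.le_sqrt_of_sq_le ?_
    rw [div_pow, div_le_div_iff₀ (by positivity) hT']
    nlinarith
  have h4 : ∫ ω, S.sup' hne (fun z => (F ω).1 z) ∂P ≤ ∫ ω, M ω ∂P + W / T := by
    rw [← mul_le_mul_iff_right₀ hT']
    rw [mul_add, mul_div_cancel₀ _ hT'.ne']
    exact h1
  linarith

end IsAdaptiveModel

/-! ### Information gain of the queries -/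

lemma past_observations (m : (t : ℕ) → (Fin t → ℝ) → ℝ) (t : ℕ) (e : Fin t → ℝ) (i : Fin t) :
    past (observations m t e) i = observations m i (past e i) := by
  induction t with
  | zero => exact i.elim0
  | succ t ih =>
    induction i using Fin.lastCases with
    | last =>
      funext j
      exact Fin.snoc_castSucc (α := fun _ => ℝ) _ _ _
    | cast i =>
      refine Eq.trans ?_ (ih (Fin.init e) i)
      funext j
      exact Fin.snoc_castSucc (α := fun _ => ℝ) _ _ (⟨j, j.2.trans i.2⟩ : Fin t)

lemma queries_data {Ω : Type*} {F : Ω → Path X} {ε ζ : ℕ → Ω → ℝ}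
    {sel : (t : ℕ) → (Fin t → ℝ) × (ℕ → ℝ) → X} (t : ℕ) (ω : Ω) (i : Fin t) :
    queries sel (data F ε ζ sel t ω) i = query F ε ζ sel i ω := by
  simp only [queries, query, data, past_observations]
  rfl

/-- The covariance kernel of a Gaussian process with continuous paths and unit variance is
continuous. -/
lemma IsPrior.continuous_kernel (hQ : IsPrior k Q) (hk1 : ∀ z : X, k z z = 1) :
    Continuous fun q : X × X => k q.1 q.2 := by
  have := hQ.isProbabilityMeasure
  -- The increment is centred Gaussian with variance `2 - 2 k z w`, so the mean of its cosine
  -- determines `k z w`. The cosine is bounded, and path continuity suffices for dominated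
  -- convergence.
  have hcos : ∀ z w : X, ∫ φ, Real.cos (φ.1 z - φ.1 w) ∂Q = Real.exp (k z w - 1) := by
    intro z w
    have hg := (hQ.gaussian.hasGaussianLaw_fun_sub (s := z) (t := w))
    have hm : Measurable fun φ : Path X => φ.1 z - φ.1 w :=
      (measurable_eval_const z).sub (measurable_eval_const w)
    have hmean : ∫ φ, (φ.1 z - φ.1 w) ∂Q = 0 := by
      rw [integral_sub ((hQ.memLp z).integrable one_le_two) ((hQ.memLp w).integrable one_le_two),
        hQ.mean_zero, hQ.mean_zero, sub_zero]
    have hvar : Var[fun φ : Path X => φ.1 z - φ.1 w; Q] = 2 - 2 * k z w := by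
      rw [variance_fun_sub (hQ.memLp z) (hQ.memLp w),
        ← covariance_self (measurable_eval_const z).aemeasurable,
        ← covariance_self (measurable_eval_const w).aemeasurable]
      simp only [hQ.covariance_eq, hk1]
      ring
    have hlaw := hg.map_eq_gaussianReal
    rw [hmean, hvar] at hlaw
    have h0 : 0 ≤ 2 - 2 * k z w := hvar ▸ variance_nonneg _ _
    have hchar := charFun_gaussianReal (μ := 0) (v := (2 - 2 * k z w).toNNReal) 1
    rw [← hlaw, charFun_apply_real, integral_map hm.aemeasurable
      (by fun_prop)] at hchar
    have hre := congrArg Complex.re hchar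
    rw [← Complex.reCLM_apply, ← ContinuousLinearMap.integral_comp_comm] at hre
    · have e1 : ∀ φ : Path X, Complex.reCLM (Complex.exp ((1 : ℝ) * (φ.1 z - φ.1 w : ℝ) *
          Complex.I)) = Real.cos (φ.1 z - φ.1 w) := fun φ => by
        rw [Complex.ofReal_one, one_mul, Complex.reCLM_apply, Complex.exp_ofReal_mul_I_re]
      simp only [e1] at hre
      rw [hre]
      have e2 : (((1 : ℝ) : ℂ) * ((0 : ℝ) : ℂ) * Complex.I -
          (((2 - 2 * k z w).toNNReal : ℝ) : ℂ) * ((1 : ℝ) : ℂ) ^ 2 / 2) =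
          ((k z w - 1 : ℝ) : ℂ) := by
        rw [Real.coe_toNNReal _ h0]
        push_cast
        ring
      rw [e2, Complex.exp_ofReal_re]
    · have hc : Continuous fun u : ℝ => Complex.exp ((1 : ℝ) * (u : ℂ) * Complex.I) := by fun_prop
      refine Integrable.of_bound (C := 1)
        (hc.comp_aestronglyMeasurable hm.aestronglyMeasurable) (.of_forall fun φ => ?_)
      rw [Complex.ofReal_one, one_mul, Complex.norm_exp_ofReal_mul_I]
  have hk : (fun q : X × X => k q.1 q.2) =
      fun q => 1 + Real.log (∫ φ, Real.cos (φ.1 q.1 - φ.1 q.2) ∂Q) := by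
    funext q
    rw [hcos, Real.log_exp]
    ring
  rw [hk]
  refine continuous_const.add (Continuous.log ?_ fun q => by rw [hcos]; positivity)
  refine continuous_of_dominated (bound := fun _ => 1) (fun q => ?_) (fun q => ?_)
    (integrable_const _) (.of_forall fun φ => ?_)
  · exact (Real.continuous_cos.measurable.comp ((measurable_eval_const q.1).sub
      (measurable_eval_const q.2))).aestronglyMeasurable
  · exact .of_forall fun φ => Real.abs_cos_le_one _
  · exact Real.continuous_cos.comp ((φ.2.comp continuous_fst).sub (φ.2.comp continuous_snd))

section Info

variable {σ : ℝ≥0}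

lemma IsPrior.predVar_nonneg (hQ : IsPrior k Q) (hσ : 0 < σ) {n : ℕ} (xs : Fin n → X)
    (i : Fin n) : 0 ≤ predVar k σ xs i :=
  hQ.postVar_nonneg _ _ σ hσ

lemma IsPrior.predVar_le_one (hQ : IsPrior k Q) (hσ : 0 < σ) (hk1 : ∀ z : X, k z z = 1) {n : ℕ}
    (xs : Fin n → X) (i : Fin n) : predVar k σ xs i ≤ 1 :=
  (hQ.postVar_le _ _ σ hσ).trans (hk1 _).le

lemma IsPrior.continuous_designInfo (hQ : IsPrior k Q) (hσ : 0 < σ)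
    (hk : Continuous fun q : X × X => k q.1 q.2) (n : ℕ) :
    Continuous fun xs : Fin n → X => designInfo k σ xs := by
  unfold designInfo
  refine continuous_finsetSum _ fun i _ => continuous_const.mul (Continuous.log ?_ fun xs => ?_)
  · refine continuous_const.add (continuous_const.mul ?_)
    have h : Continuous fun xs : Fin n → X => (past xs i, xs i) :=
      (continuous_pi fun j => continuous_apply _).prodMk (continuous_apply i)
    exact (hQ.continuous_postVar hσ hk).comp h
  · have := hQ.predVar_nonneg hσ xs i
    positivity

lemma IsPrior.designInfo_le (hQ : IsPrior k Q) (hσ : 0 < σ) (hk1 : ∀ z : X, k z z = 1) {n : ℕ}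
    (xs : Fin n → X) : designInfo k σ xs ≤ n * (1 / 2 * Real.log (1 + ((σ : ℝ) ^ 2)⁻¹)) := by
  have h : ∀ i ∈ Finset.univ, 1 / 2 * Real.log (1 + ((σ : ℝ) ^ 2)⁻¹ * predVar k σ xs i) ≤
      1 / 2 * Real.log (1 + ((σ : ℝ) ^ 2)⁻¹) := fun i _ => by
    have h0 := hQ.predVar_nonneg hσ xs i
    have h1 := hQ.predVar_le_one hσ hk1 xs i
    gcongr
    exact mul_le_of_le_one_right (by positivity) h1
  refine (Finset.sum_le_sum h).trans_eq ?_
  simp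

lemma C₁_pos (hσ : 0 < σ) : 0 < C₁ σ := by
  unfold C₁
  have : 0 < Real.log (1 + ((σ : ℝ) ^ 2)⁻¹) := Real.log_pos (by
    have : 0 < ((σ : ℝ) ^ 2)⁻¹ := by positivity
    linarith)
  positivity

/-- The sum of the predictive variances is bounded by the information. -/
lemma IsPrior.sum_predVar_le (hQ : IsPrior k Q) (hσ : 0 < σ) (hk1 : ∀ z : X, k z z = 1) {n : ℕ}
    (xs : Fin n → X) : ∑ i, predVar k σ xs i ≤ C₁ σ * designInfo k σ xs := by
  set c : ℝ := ((σ : ℝ) ^ 2)⁻¹ with hc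
  have hc0 : 0 < c := by positivity
  have hl : 0 < Real.log (1 + c) := Real.log_pos (by linarith)
  -- With `v` the predictive variance, concavity of the logarithm between 1 and `1 + c` gives `v log
  -- (1 + c) ≤ log (1 + c v)` for `v` in `[0, 1]`.
  have h : ∀ i, predVar k σ xs i * Real.log (1 + c) ≤ Real.log (1 + c * predVar k σ xs i) := by
    intro i
    have h0 := hQ.predVar_nonneg hσ xs i
    have h1 := hQ.predVar_le_one hσ hk1 xs i
    have := strictConcaveOn_log_Ioi.concaveOn.2 (mem_Ioi.2 one_pos)
      (mem_Ioi.2 (by linarith : 0 < 1 + c)) (sub_nonneg.2 h1) h0 (by ring)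
    simp only [Real.log_one, smul_eq_mul, mul_zero, zero_add] at this
    refine this.trans_eq ?_
    congr 1
    ring
  unfold C₁ designInfo
  rw [div_mul_eq_mul_div, le_div_iff₀ hl, Finset.sum_mul, Finset.mul_sum]
  refine Finset.sum_le_sum fun i _ => (h i).trans_eq ?_
  ring

/-- Tuples of distinct points are dense. -/
lemma dense_injective (hX : IsCompact X) (hconv : Convex ℝ X) (hnt : X.Nontrivial) (n : ℕ) :
    Dense {xs : Fin n → X | Function.Injective xs} := by
  have : CompactSpace X := isCompact_iff_compactSpace.1 hX
  have : Nontrivial X := hnt.coe_sort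
  have : ConnectedSpace X := isConnected_iff_connectedSpace.1 ⟨hnt.nonempty, hconv.isPreconnected⟩
  have h : {xs : Fin n → X | Function.Injective xs} =
      ⋂ p : {p : Fin n × Fin n // p.1 ≠ p.2}, {xs | xs p.1.1 ≠ xs p.1.2} := by
    ext xs
    refine ⟨fun h => mem_iInter.2 fun p => h.ne p.2, fun h i j hij => ?_⟩
    by_contra hne
    exact (mem_iInter.1 h ⟨(i, j), hne⟩) hij
  rw [h]
  -- Each condition `xs i ≠ xs j` is open. It is dense because a nontrivial convex set has no
  -- isolated points, so a single coordinate can be moved slightly.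
  refine dense_iInter_of_isOpen (fun p => ?_) fun p xs => ?_
  · exact isOpen_ne_fun (continuous_apply _) (continuous_apply _)
  · have hc : Continuous fun z => Function.update xs p.1.1 z := continuous_const.update _ continuous_id
    have := map_mem_closure hc (dense_compl_singleton (xs p.1.2) (xs p.1.1))
      (t := {xs | xs p.1.1 ≠ xs p.1.2}) fun z hz => by
        change Function.update xs p.1.1 z p.1.1 ≠ Function.update xs p.1.1 z p.1.2
        rw [Function.update_self, Function.update_of_ne p.2.symm]
        exact hz
    rwa [Function.update_eq_self] at this

variable {Ω : Type*} [MeasurableSpace Ω] {P : Measure Ω} {f : Ω → Pt d → ℝ}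

lemma IsPrior.maxInfoGain_ne_top (hQ : IsPrior k Q) (hσ : 0 < σ) (hk1 : ∀ z : X, k z z = 1)
    (hlaw : ∀ (n : ℕ) (xs : Fin n → X), P.map (fun ω i => f ω (xs i)) = Q.map (evalAt xs))
    (T : ℕ) : maxInfoGain X f P σ T ≠ ∞ := by
  refine ne_top_of_le_ne_top (ENNReal.ofReal_ne_top
    (r := T * (1 / 2 * Real.log (1 + ((σ : ℝ) ^ 2)⁻¹)))) ?_
  refine iSup_le fun A => iSup_le fun _ => iSup_le fun hA => ?_
  exact (hQ.infoGain_eq (fun i => ⟨A i, hA i⟩) hσ (hlaw T _)).trans_le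
    (ENNReal.ofReal_le_ofReal (hQ.designInfo_le hσ hk1 _))

/-- Repeated queries do not give more information than distinct points. -/
lemma IsPrior.designInfo_le_maxInfoGain (hQ : IsPrior k Q) (hσ : 0 < σ)
    (hk : Continuous fun q : X × X => k q.1 q.2) (hk1 : ∀ z : X, k z z = 1)
    (hlaw : ∀ (n : ℕ) (xs : Fin n → X), P.map (fun ω i => f ω (xs i)) = Q.map (evalAt xs))
    (hX : IsCompact X) (hconv : Convex ℝ X) (hnt : X.Nontrivial) {T : ℕ} (xs : Fin T → X) :
    designInfo k σ xs ≤ (maxInfoGain X f P σ T).toReal := by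
  have hcl : IsClosed {xs : Fin T → X | designInfo k σ xs ≤ (maxInfoGain X f P σ T).toReal} :=
    isClosed_le (hQ.continuous_designInfo hσ hk T) continuous_const
  have hsub : {xs : Fin T → X | Function.Injective xs} ⊆
      {xs | designInfo k σ xs ≤ (maxInfoGain X f P σ T).toReal} := by
    intro xs hxs
    have h : infoGain f P σ (fun i => (xs i : Pt d)) ≤ maxInfoGain X f P σ T :=
      le_iSup_of_le (fun i => (xs i : Pt d)) <| le_iSup_of_le
        (Subtype.val_injective.comp hxs) <| le_iSup_of_le (fun i => (xs i).2) le_rfl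
    rw [hQ.infoGain_eq xs hσ (hlaw T xs)] at h
    exact (ENNReal.ofReal_le_iff_le_toReal (hQ.maxInfoGain_ne_top hσ hk1 hlaw T)).1 h
  exact hcl.closure_subset_iff.2 hsub (dense_injective hX hconv hnt T xs)

/-- The posterior variance does not involve the observed values. For each `ω` the actual queries may
therefore be treated as a fixed design, and the bound holds pathwise. -/
lemma IsAdaptiveModel.sum_queryVar_le [IsProbabilityMeasure P] {F : Ω → Path X} {ε ζ : ℕ → Ω → ℝ}
    {sel : (t : ℕ) → (Fin t → ℝ) × (ℕ → ℝ) → X} (hM : IsAdaptiveModel k σ P F ε ζ sel) (hσ : 0 < σ)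
    (hk1 : ∀ z : X, k z z = 1)
    (hlaw : ∀ (n : ℕ) (xs : Fin n → X), P.map (fun ω i => f ω (xs i)) = (P.map F).map (evalAt xs))
    (hX : IsCompact X) (hconv : Convex ℝ X) (hnt : X.Nontrivial) (T : ℕ) (ω : Ω) :
    ∑ t ∈ Finset.range T, queryVar k σ F ε ζ sel t ω ≤
      C₁ σ * (maxInfoGain X f P σ T).toReal := by
  have h := hM.isPrior.sum_predVar_le hσ hk1 fun i : Fin T => query F ε ζ sel i ω
  have h2 := hM.isPrior.designInfo_le_maxInfoGain hσ (hM.isPrior.continuous_kernel hk1) hk1 hlaw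
    hX hconv hnt fun i : Fin T => query F ε ζ sel i ω
  refine le_trans (le_of_eq ?_) (h.trans (mul_le_mul_of_nonneg_left h2 (C₁_pos hσ).le))
  rw [Finset.sum_range]
  refine Finset.sum_congr rfl fun i _ => ?_
  unfold queryVar predVar
  simp only [queries_data]
  rfl

end Info

/-! ### Discretisation of the domain -/

lemma norm_le_sqrt_mul {z : Pt d} {L : ℝ} (hL : 0 ≤ L) (h : ∀ j, |z j| ≤ L) : ‖z‖ ≤ √d * L := by
  rw [EuclideanSpace.norm_eq]
  refine Real.sqrt_le_iff.2 ⟨by positivity, ?_⟩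
  rw [mul_pow, Real.sq_sqrt (Nat.cast_nonneg d)]
  have : ∑ j, ‖z j‖ ^ 2 ≤ ∑ _j : Fin d, L ^ 2 := Finset.sum_le_sum fun j _ => by
    rw [Real.norm_eq_abs]
    gcongr
    exact h j
  simpa using this

lemma abs_sub_le_of_gradient (hconv : Convex ℝ X) {φ : Pt d → ℝ} {g : Pt d → Pt d}
    (hg : ∀ z ∈ X, HasGradientWithinAt φ (g z) X z) {L : ℝ} (hL : 0 ≤ L)
    (h : ∀ z ∈ X, ∀ j, |g z j| ≤ L) {z w : Pt d} (hz : z ∈ X) (hw : w ∈ X) :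
    |φ z - φ w| ≤ √d * L * ‖z - w‖ := by
  refine hconv.norm_image_sub_le_of_norm_hasFDerivWithin_le (𝕜 := ℝ)
    (fun x hx => (hg x hx).hasFDerivWithinAt) (fun x hx => ?_) hw hz
  rw [LinearIsometryEquiv.norm_map]
  exact norm_le_sqrt_mul hL (h x hx)

/-- The metric projection onto a closed convex set is nonexpansive towards points of the set. -/
lemma exists_projection (hX : IsCompact X) (hconv : Convex ℝ X) (hne : X.Nonempty) (u : Pt d) :
    ∃ v : X, ∀ w : X, ‖(w : Pt d) - v‖ ≤ ‖(w : Pt d) - u‖ := by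
  obtain ⟨v, hv, hmin⟩ := exists_norm_eq_iInf_of_complete_convex hne hX.isComplete hconv u
  have hin := (norm_eq_iInf_iff_real_inner_le_zero hconv hv).1 hmin
  refine ⟨⟨v, hv⟩, fun w => ?_⟩
  have h := hin w w.2
  have e : (w : Pt d) - u = (w - v) - (u - v) := by abel
  have h2 := norm_sub_sq_real ((w : Pt d) - v) (u - v)
  rw [← e, real_inner_comm] at h2
  refine le_of_sq_le_sq ?_ (norm_nonneg _)
  nlinarith [sq_nonneg ‖u - v‖]

/-- A convex subset of the cube has a finite net with at most `n ^ d` points. -/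
lemma exists_net (hX : IsCompact X) (hconv : Convex ℝ X) (hne : X.Nonempty) {r : ℝ} (hr : 0 < r)
    (hcube : ∀ z ∈ X, ∀ j, z j ∈ Icc 0 r) {n : ℕ} (hn : 0 < n) :
    ∃ S : Finset X, S.Nonempty ∧ S.card ≤ n ^ d ∧
      ∀ z : X, ∃ w ∈ S, ‖(z : Pt d) - w‖ ≤ √d * (r / (2 * n)) := by
  classical
  have hn' : (0 : ℝ) < n := by exact_mod_cast hn
  -- Centres of the cells of side `r / n`. They may lie outside `X` and are replaced by their
  -- projections, which are no farther from any point of `X`.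
  let centre (m : Fin d → Fin n) : Pt d := WithLp.toLp 2 fun j => ((m j : ℝ) + 1 / 2) * (r / n)
  choose p hp using fun m => exists_projection hX hconv hne (centre m)
  refine ⟨Finset.univ.image p, ?_, ?_, fun z => ?_⟩
  · have : Nonempty (Fin n) := ⟨⟨0, hn⟩⟩
    exact Finset.univ_nonempty.image p
  · exact Finset.card_image_le.trans_eq (by simp)
  · have hcell : ∀ j, ∃ i : Fin n, |(z : Pt d) j - ((i : ℝ) + 1 / 2) * (r / n)| ≤ r / (2 * n) := by
      intro j
      obtain ⟨h0, h1⟩ := hcube z z.2 j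
      set u := (z : Pt d) j / (r / n) with hu
      have hrn : 0 < r / n := by positivity
      have hu0 : 0 ≤ u := by positivity
      have hun : u ≤ n := by
        rw [hu, div_le_iff₀ hrn]
        rwa [mul_div_cancel₀ _ hn'.ne']
      have hzu : (z : Pt d) j = u * (r / n) := by rw [hu, div_mul_cancel₀ _ hrn.ne']
      suffices ∃ i : Fin n, |u - ((i : ℝ) + 1 / 2)| ≤ 1 / 2 by
        obtain ⟨i, hi⟩ := this
        refine ⟨i, ?_⟩
        rw [hzu, ← sub_mul, abs_mul, abs_of_pos hrn]
        calc _ ≤ 1 / 2 * (r / n) := by gcongr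
          _ = _ := by field_simp
      rcases hun.lt_or_eq with hlt | heq
      · refine ⟨⟨⌊u⌋₊, (Nat.floor_lt hu0).2 hlt⟩, ?_⟩
        have h2 := Nat.floor_le hu0
        have h3 := Nat.lt_floor_add_one u
        rw [abs_le]
        constructor <;> simp only <;> linarith
      -- The upper face `u = n` lies beyond the half-open cells and is assigned to the last one.
      · refine ⟨⟨n - 1, by omega⟩, ?_⟩
        have : ((n - 1 : ℕ) : ℝ) = n - 1 := by rw [Nat.cast_sub hn]; simp
        simp only [this, heq]
        rw [abs_le]
        constructor <;> linarith
    choose m hm using hcell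
    refine ⟨p m, Finset.mem_image_of_mem _ (Finset.mem_univ _), (hp m z).trans ?_⟩
    refine norm_le_sqrt_mul (by positivity) fun j => ?_
    exact hm j

/-! ### Extrema of a path -/

section Extrema

variable [Nonempty X]

/-- The maximum of a path. -/
noncomputable def pathSup (φ : Path X) : ℝ := ⨆ n, φ.1 (TopologicalSpace.denseSeq X n)

/-- The oscillation of a path. -/
noncomputable def pathOsc (φ : Path X) : ℝ :=
  pathSup φ - ⨅ n, φ.1 (TopologicalSpace.denseSeq X n)

/-- The supremum over a dense sequence is countable; for continuous paths it is the maximum. -/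
lemma measurable_pathSup : Measurable (pathSup : Path X → ℝ) :=
  Measurable.iSup fun _ => measurable_eval_const _

lemma measurable_pathOsc : Measurable (pathOsc : Path X → ℝ) :=
  measurable_pathSup.sub (Measurable.iInf fun _ => measurable_eval_const _)

lemma pathSup_le {φ : Path X} {c : ℝ} (h : ∀ z, φ.1 z ≤ c) : pathSup φ ≤ c :=
  ciSup_le fun _ => h _

lemma pathOsc_le {φ : Path X} {c : ℝ} (h : ∀ z w, φ.1 z - φ.1 w ≤ c) : pathOsc φ ≤ c := by
  unfold pathOsc
  have : pathSup φ - c ≤ ⨅ n, φ.1 (TopologicalSpace.denseSeq X n) := le_ciInf fun n => by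
    have : pathSup φ ≤ φ.1 (TopologicalSpace.denseSeq X n) + c :=
      pathSup_le fun z => by linarith [h z (TopologicalSpace.denseSeq X n)]
    linarith
  linarith

variable [CompactSpace X]

lemma le_pathSup (φ : Path X) (z : X) : φ.1 z ≤ pathSup φ := by
  have hb : BddAbove (range fun n => φ.1 (TopologicalSpace.denseSeq X n)) :=
    (isCompact_range φ.2).bddAbove.mono (range_subset_iff.2 fun n => mem_range_self _)
  have hcl : IsClosed {z | φ.1 z ≤ pathSup φ} := isClosed_le φ.2 continuous_const
  refine hcl.closure_subset_iff.2 ?_ (TopologicalSpace.denseRange_denseSeq X z)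
  rintro _ ⟨n, rfl⟩
  exact le_ciSup hb n

lemma sub_le_pathOsc (φ : Path X) (z w : X) : φ.1 z - φ.1 w ≤ pathOsc φ := by
  have hb : BddBelow (range fun n => φ.1 (TopologicalSpace.denseSeq X n)) :=
    (isCompact_range φ.2).bddBelow.mono (range_subset_iff.2 fun n => mem_range_self _)
  have hcl : IsClosed {z | (⨅ n, φ.1 (TopologicalSpace.denseSeq X n)) ≤ φ.1 z} :=
    isClosed_le continuous_const φ.2
  have : (⨅ n, φ.1 (TopologicalSpace.denseSeq X n)) ≤ φ.1 w := by
    refine hcl.closure_subset_iff.2 ?_ (TopologicalSpace.denseRange_denseSeq X w)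
    rintro _ ⟨n, rfl⟩
    exact ciInf_le hb n
  have := le_pathSup φ z
  unfold pathOsc
  linarith

lemma pathOsc_nonneg (φ : Path X) : 0 ≤ pathOsc φ := by
  obtain ⟨z⟩ := ‹Nonempty X›
  simpa using sub_le_pathOsc φ z z

end Extrema

/-! ### Tail bounds -/

/-- A functional of the path that is controlled by the Lipschitz constant is integrable. -/
lemma RegularDomain.integrable_and_integral_le {Ω : Type*} [MeasurableSpace Ω] {P : Measure Ω}
    [IsProbabilityMeasure P] {f : Ω → Pt d → ℝ} {r a b : ℝ} (hX : RegularDomain X f P r a b)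
    {R : Ω → ℝ} (hRm : AEMeasurable R P) (hR0 : 0 ≤ᵐ[P] R) {D : ℝ} (hD : 0 ≤ D)
    (hR : ∀ᵐ ω ∂P, ∀ L : ℝ, 0 ≤ L →
      (∀ z ∈ X, ∀ w ∈ X, |f ω z - f ω w| ≤ √d * L * ‖z - w‖) → R ω ≤ D * L) :
    Integrable R P ∧ ∫ ω, R ω ∂P ≤ D * (b * (√(Real.log (a * d)) + √Real.pi / 2)) := by
  obtain ⟨g, hg, htail⟩ := hX.gradient_tail
  refine integrable_and_integral_le_of_tail hRm hR0 hD hX.b_pos fun L hL => ?_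
  -- If all partial derivatives were at most `L`, the Lipschitz bound would give `R ω ≤ D * L`. The
  -- union over the `d` coordinates turns `a` into `a * d`.
  have hsub : ({ω | D * L < R ω} : Set Ω) ≤ᵐ[P] ⋃ j : Fin d, {ω | ∃ z ∈ X, L < |g ω z j|} := by
    filter_upwards [hg, hR] with ω hgω hRω hlt
    by_contra hcon
    have hle : ∀ z ∈ X, ∀ j, |g ω z j| ≤ L := by
      intro z hz j
      by_contra! hlt'
      exact hcon (mem_iUnion.2 ⟨j, z, hz, hlt'⟩)
    exact absurd (hRω L hL.le fun z hz w hw =>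
      abs_sub_le_of_gradient hX.convex hgω hL.le hle hz hw) (not_le.2 hlt)
  refine (measure_mono_ae hsub).trans ((measure_iUnion_fintype_le _ _).trans ?_)
  refine (Finset.sum_le_sum fun j _ => htail j L hL).trans_eq ?_
  rw [Finset.sum_const, Finset.card_univ, Fintype.card_fin, nsmul_eq_mul,
    ← ENNReal.ofReal_natCast, ← ENNReal.ofReal_mul (Nat.cast_nonneg d)]
  congr 1
  ring

/-! ### The model of a run -/

section Model

variable {Ω : Type*} [MeasurableSpace Ω] {P : Measure Ω} {f : Ω → Pt d → ℝ} {F : Ω → Path X}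

lemma observations_apply (m : (t : ℕ) → (Fin t → ℝ) → ℝ) (t : ℕ) (e : Fin t → ℝ) (i : Fin t) :
    observations m t e i = m i (observations m i (past e i)) + e i := by
  induction t with
  | zero => exact i.elim0
  | succ t ih =>
    induction i using Fin.lastCases with
    | last => exact Fin.snoc_last (α := fun _ => ℝ) _ _
    | cast i => exact (Fin.snoc_castSucc (α := fun _ => ℝ) _ _ i).trans (ih (Fin.init e) i)

/-- A process with almost surely differentiable paths has a modification with continuous paths. -/
lemma exists_path (hf : IsCenteredGP X k f P) {r a b : ℝ} (hX : RegularDomain X f P r a b) :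
    ∃ F : Ω → Path X, Measurable F ∧ ∀ᵐ ω ∂P, ∀ z : X, (F ω).1 z = f ω z := by
  classical
  obtain ⟨g, hg, -⟩ := hX.gradient_tail
  -- The set where differentiability fails need not be measurable. On a measurable null set
  -- containing it the path is replaced by 0.
  obtain ⟨N, hN, hNm, hN0⟩ := exists_measurable_superset_of_null (ae_iff.1 hg)
  have hcont : ∀ ω, ω ∉ N → Continuous fun z : X => f ω z := by
    intro ω hω
    have h : ∀ z ∈ X, HasGradientWithinAt (f ω) (g ω z) X z := by
      by_contra hc
      exact hω (hN hc)
    exact continuousOn_iff_continuous_domRestrict.1 fun z hz =>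
      (h z hz).hasFDerivWithinAt.continuousWithinAt
  refine ⟨fun ω => ⟨fun z => if ω ∈ N then 0 else f ω z, ?_⟩, ?_, ?_⟩
  · by_cases hω : ω ∈ N
    · simpa [hω] using continuous_const
    · simpa [hω] using hcont ω hω
  · refine Measurable.subtype_mk (measurable_pi_lambda _ fun z => ?_)
    exact Measurable.ite hNm measurable_const (hf.measurable z z.2)
  · filter_upwards [measure_eq_zero_iff_ae_notMem.1 hN0] with ω hω z
    exact if_neg hω

lemma isPrior_map [IsProbabilityMeasure P] (hf : IsCenteredGP X k f P) (hF : Measurable F)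
    (hFf : ∀ᵐ ω ∂P, ∀ z : X, (F ω).1 z = f ω z) : IsPrior k (P.map F) := by
  have hz : ∀ z : X, (fun ω => (F ω).1 z) =ᵐ[P] fun ω => f ω z := fun z =>
    hFf.mono fun ω h => h z
  refine ⟨Measure.isProbabilityMeasure_map hF.aemeasurable, ⟨fun I => ⟨?_⟩⟩, fun z => ?_,
    fun z w => ?_⟩
  · have hm : Measurable fun φ : Path X => I.restrict fun z => φ.1 z :=
      measurable_pi_lambda _ fun i => measurable_eval_const i.1
    have hg := (hf.gaussian.congr fun z => (hz z).symm).hasGaussianLaw I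
    have := hg.isGaussian_map
    rw [Measure.map_map hm hF]
    exact this
  · rw [integral_map hF.aemeasurable (measurable_eval_const z).aestronglyMeasurable,
      integral_congr_ae (hz z), hf.mean_zero z z.2]
  · rw [covariance_map_fun (measurable_eval_const z).aestronglyMeasurable
      (measurable_eval_const w).aestronglyMeasurable hF.aemeasurable,
      ← hf.covariance_eq z z.2 w w.2]
    unfold covariance
    rw [integral_congr_ae (hz z), integral_congr_ae (hz w)]
    refine integral_congr_ae ?_
    filter_upwards [hz z, hz w] with ω h1 h2
    rw [h1, h2]

lemma map_eval_eq (hF : Measurable F) (hFf : ∀ᵐ ω ∂P, ∀ z : X, (F ω).1 z = f ω z) {n : ℕ}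
    (xs : Fin n → X) : P.map (fun ω i => f ω (xs i)) = (P.map F).map (evalAt xs) := by
  rw [Measure.map_map (measurable_evalAt xs) hF]
  refine Measure.map_congr (hFf.mono fun ω h => ?_)
  funext i
  exact (h (xs i)).symm

lemma law_eq_prod [IsProbabilityMeasure P] (hF : Measurable F)
    (hFf : ∀ᵐ ω ∂P, ∀ z : X, (F ω).1 z = f ω z) {σ : ℝ≥0} {s lam : ℝ} {ε ζ : ℕ → Ω → ℝ}
    (hN : IsNoiseModel X f P σ s lam ε ζ) (t : ℕ) :
    P.map (fun ω => (F ω, (fun i => ζ i ω, fun i : Fin t => ε i ω))) =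
      (P.map F).prod ((P.map fun ω i => ζ i ω).prod
        (Measure.pi fun _ : Fin t => gaussianReal 0 (σ ^ 2))) := by
  have hζ : Measurable fun ω i => ζ i ω := measurable_pi_lambda _ hN.measurable_ζ
  have hε : Measurable fun ω (i : Fin t) => ε i ω := measurable_pi_lambda _ fun i =>
    hN.measurable_ε i
  have hr : Measurable fun e : ℕ → ℝ => (fun i : Fin t => e i) :=
    measurable_pi_lambda _ fun i => measurable_pi_apply _
  have h1 : IndepFun (fun ω => (F ω).1) (fun ω => (fun i => ζ i ω, fun i : Fin t => ε i ω)) P := by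
    have h := hN.indep_prior.comp (φ := id) (ψ := fun p : (ℕ → ℝ) × (ℕ → ℝ) =>
      (p.2, fun i : Fin t => p.1 i)) measurable_id
      (measurable_snd.prodMk (hr.comp measurable_fst))
    refine h.congr (hFf.mono fun ω h => ?_) (.of_forall fun ω => rfl)
    funext z
    exact (h z).symm
  -- The σ-algebra on `Path X` is pulled back from the product, so independence of the underlying
  -- functions passes to `F`.
  have h2 : IndepFun F (fun ω => (fun i => ζ i ω, fun i : Fin t => ε i ω)) P := by
    rw [indepFun_iff_measure_inter_preimage_eq_mul] at h1 ⊢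
    rintro _ u ⟨v, hv, rfl⟩ hu
    exact h1 v u hv hu
  have h3 : IndepFun (fun ω i => ζ i ω) (fun ω (i : Fin t) => ε i ω) P :=
    hN.indep_noise.symm.comp measurable_id hr
  have h4 : P.map (fun ω (i : Fin t) => ε i ω) =
      Measure.pi fun _ : Fin t => gaussianReal 0 (σ ^ 2) := by
    have h := (iIndepFun_iff_map_fun_eq_pi_map fun i : Fin t =>
      (hN.measurable_ε i).aemeasurable).1 (hN.indep_ε.precomp Fin.val_injective)
    rw [h]
    congr 1
    funext i
    exact (hN.law_ε i).map_eq
  rw [h2.map_prod_eq_prod_map_map hF.aemeasurable (hζ.prodMk hε).aemeasurable,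
    h3.map_prod_eq_prod_map_map hζ.aemeasurable hε.aemeasurable, h4]

lemma indepFun_truncate {ζ : ℕ → Ω → ℝ} (hm : ∀ t, Measurable (ζ t)) (h : iIndepFun ζ P) (t : ℕ) :
    IndepFun (fun ω => truncate t fun i => ζ i ω) (ζ t) P := by
  have h1 := h.indepFun_finset (Finset.range t) {t} (by simp) hm
  have hφ : Measurable fun (c : Finset.range t → ℝ) (i : ℕ) =>
      if hi : i ∈ Finset.range t then c ⟨i, hi⟩ else 0 := by
    refine measurable_pi_lambda _ fun i => ?_
    split_ifs
    · exact measurable_pi_apply _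
    · exact measurable_const
  have hψ : Measurable fun c : ({t} : Finset ℕ) → ℝ => c ⟨t, Finset.mem_singleton_self t⟩ :=
    measurable_pi_apply _
  refine (h1.comp hφ hψ).congr (.of_forall fun ω => ?_) (.of_forall fun ω => rfl)
  funext i
  simp [truncate]

open Classical in
/-- The points outside `X` are sent to `x₀`. -/
noncomputable def toDomain (x₀ : X) (z : Pt d) : X := if h : z ∈ X then ⟨z, h⟩ else x₀

lemma toDomain_of_mem (x₀ : X) {z : Pt d} (h : z ∈ X) : toDomain x₀ z = ⟨z, h⟩ := dif_pos h

lemma measurable_toDomain (hX : MeasurableSet X) (x₀ : X) : Measurable (toDomain x₀) := by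
  classical
  refine (MeasurableEmbedding.subtype_coe hX).measurable_comp_iff.1 ?_
  have : (Subtype.val ∘ toDomain x₀) = fun z => if z ∈ X then z else (x₀ : Pt d) := by
    funext z
    by_cases h : z ∈ X
    · simp [toDomain, h]
    · simp [toDomain, h]
  rw [this]
  exact Measurable.ite hX measurable_id measurable_const

/-- The query rule `select` as a rule with values in `X`. -/
noncomputable def ruleOf (select : (t : ℕ) → (Fin t → ℝ) × (Fin (t + 1) → ℝ) → Pt d) (x₀ : X)
    (t : ℕ) (D : (Fin t → ℝ) × (ℕ → ℝ)) : X :=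
  toDomain x₀ (select t (D.1, fun i => D.2 i))

lemma measurable_ruleOf (hX : MeasurableSet X)
    {select : (t : ℕ) → (Fin t → ℝ) × (Fin (t + 1) → ℝ) → Pt d} (hs : ∀ t, Measurable (select t))
    (x₀ : X) (t : ℕ) : Measurable (ruleOf select x₀ t) :=
  (measurable_toDomain hX x₀).comp ((hs t).comp (measurable_fst.prodMk
    (measurable_pi_lambda _ fun _ => (measurable_pi_apply _).comp measurable_snd)))

lemma nonanticipating_ruleOf (select : (t : ℕ) → (Fin t → ℝ) × (Fin (t + 1) → ℝ) → Pt d)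
    (x₀ : X) : Nonanticipating (ruleOf select x₀) := by
  intro t h c c' hc
  have : (fun i : Fin (t + 1) => c i) = fun i : Fin (t + 1) => c' i :=
    funext fun i => hc i (Nat.lt_succ_iff.1 i.2)
  simp only [ruleOf, this]

end Model

section Run

variable {Ω : Type*} {f : Ω → Pt d → ℝ} {F : Ω → Path X} {σ : ℝ≥0} {ε ζ : ℕ → Ω → ℝ}
  {x : ℕ → Ω → Pt d} {y : ℕ → Ω → ℝ}
  {select : (t : ℕ) → (Fin t → ℝ) × (Fin (t + 1) → ℝ) → Pt d}

/-- Strong induction: the observations before time `t` depend on strictly earlier queries, which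
already agree with the run wherever `F` equals `f` on `X`. -/
lemma query_ruleOf (hmem : ∀ t ω, x t ω ∈ X) (hobs : ∀ t ω, y t ω = f ω (x t ω) + ε t ω)
    (hsel : ∀ t ω, x t ω = select t (fun i : Fin t => y i ω, fun i : Fin (t + 1) => ζ i ω))
    (x₀ : X) {ω : Ω} (hω : ∀ z : X, (F ω).1 z = f ω z) (t : ℕ) :
    (data F ε ζ (ruleOf select x₀) t ω).1 = (fun i : Fin t => y i ω) ∧
      (query F ε ζ (ruleOf select x₀) t ω : Pt d) = x t ω := by
  induction t using Nat.strong_induction_on with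
  | _ t ih =>
    have h1 : (data F ε ζ (ruleOf select x₀) t ω).1 = fun i : Fin t => y i ω := by
      funext i
      have h := observations_apply (predictor (ruleOf select x₀) (F ω, fun i => ζ i ω)) t
        (fun i => ε i ω) i
      refine h.trans ?_
      change (F ω).1 (query F ε ζ (ruleOf select x₀) i ω) + ε i ω = y i ω
      rw [hω, (ih i i.2).2, hobs]
    refine ⟨h1, ?_⟩
    have h2 : select t (fun i : Fin t => y i ω, fun i : Fin (t + 1) => ζ i ω) ∈ X := by
      rw [← hsel]
      exact hmem t ω
    have h3 : query F ε ζ (ruleOf select x₀) t ω =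
        toDomain x₀ (select t (fun i : Fin t => y i ω, fun i : Fin (t + 1) => ζ i ω)) := by
      rw [← h1]
      rfl
    rw [h3, toDomain_of_mem x₀ h2, hsel]

lemma upperBound_le (hrun : IsIRGPUCBRun X k f σ ε ζ x y)
    (hsel : ∀ t ω, x t ω = select t (fun i : Fin t => y i ω, fun i : Fin (t + 1) => ζ i ω))
    (x₀ : X) {ω : Ω} (hω : ∀ z : X, (F ω).1 z = f ω z) (t : ℕ) (z : X) :
    upperBound k σ F ε ζ (ruleOf select x₀) t ω z ≤ upperBound k σ F ε ζ (ruleOf select x₀) t ω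
      (query F ε ζ (ruleOf select x₀) t ω) := by
  have h := fun t => query_ruleOf hrun.mem hrun.observe hsel x₀ hω t
  unfold upperBound
  simp only [queries_data, (h _).1, (h _).2]
  exact hrun.argmax t ω z.2

end Run

/-! ### The regret bound -/

/-- The choice of the number of grid points per axis. -/
lemma le_half_add_sqrt {d : ℕ} (hd : d ≠ 0) {η τ G B s : ℝ} (hη : 0 < η) (hτ : 0 < τ)
    (hs : s = 2 * d * Real.log τ - 2 * Real.log 2) (h1 : B ≤ τ * η / 2)
    (h2 : ∀ n : ℕ, 0 < n → (n : ℝ) ^ d / 2 ≤ Real.exp (s / 2) →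
      B ≤ τ * η / (4 * n) + √(posMean s * G)) :
    B ≤ η / 2 + √((2 + s) * G) := by
  -- The shift satisfies `exp (s / 2) = u / 2`, so the condition on the size of the net reads `n ^ d
  -- ≤ τ ^ d`.
  set u := τ ^ d with hu
  have hu0 : 0 < u := by positivity
  have hlog : s = 2 * Real.log (u / 2) := by
    rw [hs, hu, Real.log_div (by positivity) two_ne_zero, Real.log_pow]
    ring
  have hexp : Real.exp (s / 2) = u / 2 := by
    rw [hlog, mul_div_cancel_left₀ _ two_ne_zero, Real.exp_log (by positivity)]
  -- For `τ ≤ 1` the trivial bound `τ η / 2` is already at most `η / 2`.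
  rcases le_or_gt τ 1 with hτ1 | hτ1
  · have := Real.sqrt_nonneg ((2 + s) * G)
    nlinarith
  rcases le_or_gt 0 s with hs0 | hs0
  -- With `n = ⌊τ⌋` one has `τ < 2 n`, so the discretisation error is at most `η / 2`.
  · have hn1 : 1 ≤ ⌊τ⌋₊ := Nat.one_le_floor_iff τ |>.2 hτ1.le
    have hn1' : (1 : ℝ) ≤ ⌊τ⌋₊ := by exact_mod_cast hn1
    have hnle := Nat.floor_le hτ.le
    have hlt := Nat.lt_floor_add_one τ
    have h := h2 ⌊τ⌋₊ hn1 (by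
      rw [hexp, hu]
      gcongr)
    rw [posMean, if_pos hs0] at h
    have : τ * η / (4 * ⌊τ⌋₊) ≤ η / 2 := by
      rw [div_le_div_iff₀ (by positivity) two_pos]
      nlinarith
    linarith
  -- For negative `s` the one-cell net gives `τ η / 4 + √(u G)`, where `u = 2 exp (s / 2)` is larger
  -- than `2 + s`. Neither this bound nor the trivial one suffices alone.
  · have h := h2 1 one_pos (by
      rw [hexp, Nat.cast_one, one_pow]
      have : 1 ≤ u := one_le_pow₀ hτ1.le
      linarith)
    have hpm : posMean s = u := by
      rw [posMean, if_neg (not_le.2 hs0), hexp]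
      ring
    rw [hpm, Nat.cast_one, mul_one] at h
    have hτu : τ ≤ u := le_self_pow₀ hτ1.le hd
    have hu2 : u < 2 := by
      by_contra! hcon
      have : 0 ≤ Real.log (u / 2) := Real.log_nonneg (by linarith)
      linarith
    -- From `log (u / 2) ≥ 1 - 2 / u`. It shows that `2 + s` is not too small compared with `u`.
    have hw : 4 * (u - 1) ≤ (2 + s) * u := by
      have := Real.one_sub_inv_le_log_of_pos (by positivity : 0 < u / 2)
      have h3 : 4 - 4 / u ≤ 2 + s := by
        rw [hlog]
        have : (u / 2)⁻¹ = 2 / u := by rw [inv_div]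
        have : 4 / u = 2 * (2 / u) := by ring
        linarith
      have h4 := mul_le_mul_of_nonneg_right h3 hu0.le
      rw [sub_mul, div_mul_cancel₀ _ hu0.ne'] at h4
      linarith
    have h2s : 0 ≤ 2 + s := by
      by_contra! hcon
      nlinarith
    -- If the target root is at least `(τ - 1) η / 2`, the trivial bound `τ η / 2` suffices.
    -- Otherwise the root is small, and this absorbs the excess of `√(u G)` over it.
    rcases le_or_gt ((τ - 1) * η / 2) (√((2 + s) * G)) with hc | hc
    · linarith
    rw [Real.sqrt_mul h2s] at hc ⊢
    rw [Real.sqrt_mul hu0.le] at h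
    set p := √G
    set q := √u with hq
    set w := √(2 + s) with hwd
    set m := √(u - 1) with hm
    have hp0 : 0 ≤ p := Real.sqrt_nonneg _
    have hq0 : 0 ≤ q := Real.sqrt_nonneg _
    have hw0 : 0 ≤ w := Real.sqrt_nonneg _
    have hm0 : 0 < m := Real.sqrt_pos.2 (by linarith)
    have hmm : m ^ 2 = u - 1 := Real.sq_sqrt (by linarith)
    have hqq : q ^ 2 = u := Real.sq_sqrt hu0.le
    have hww : w ^ 2 = 2 + s := Real.sq_sqrt h2s
    have hm1 : m ≤ 1 := by nlinarith
    have hwq : 2 * m ≤ w * q := by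
      refine le_of_sq_le_sq ?_ (by positivity)
      rw [mul_pow, mul_pow, hmm, hww, hqq]
      linarith
    -- `α` bounds the ratio of `√(u G)` to the target root. The excess is at most `(α - 1)(τ - 1) η
    -- / 2`, and `(τ - 1) α ≤ τ / 2` is exactly what makes the total at most `η / 2` plus the root.
    set α := u / (2 * m) with hα
    have hαm : α * (2 * m) = u := div_mul_cancel₀ _ (by positivity)
    have hα1 : 1 ≤ α := by
      rw [hα, le_div_iff₀ (by positivity)]
      nlinarith [sq_nonneg (m - 1)]
    have hα2 : (τ - 1) * α ≤ τ / 2 := by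
      rw [hα, mul_div_assoc', div_le_div_iff₀ (by positivity) two_pos]
      have : u * (τ - 1) ≤ τ * m := by nlinarith
      linarith
    have hqp : q * p ≤ α * (w * p) := by
      have : 2 * m * (q * p) ≤ 2 * m * (α * (w * p)) := by
        have e : 2 * m * (α * (w * p)) = w * q * (q * p) := by
          have : w * q * (q * p) = q ^ 2 * (w * p) := by ring
          rw [this, hqq, ← hαm]
          ring
        rw [e]
        gcongr
      exact le_of_mul_le_mul_left this (by positivity)
    have h5 : (α - 1) * (w * p) ≤ (α - 1) * ((τ - 1) * η / 2) :=
      mul_le_mul_of_nonneg_left hc.le (by linarith)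
    nlinarith

-- From finite sets to the whole domain: oscillation, net error, integrability.

lemma RegularDomain.norm_sub_le {Ω : Type*} [MeasurableSpace Ω] {P : Measure Ω}
    {f : Ω → Pt d → ℝ} {r a b : ℝ} (hX : RegularDomain X f P r a b) {z w : Pt d}
    (hz : z ∈ X) (hw : w ∈ X) : ‖z - w‖ ≤ √d * r := by
  refine norm_le_sqrt_mul hX.r_pos.le fun j => ?_
  have h1 := hX.subset_cube z hz j
  have h2 := hX.subset_cube w hw j
  rw [PiLp.sub_apply, abs_le]
  constructor <;> linarith [h1.1, h1.2, h2.1, h2.2]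

lemma measurable_finset_sup' {Ω : Type*} [MeasurableSpace Ω] {F : Ω → Path X} (hF : Measurable F)
    {S : Finset X} (hne : S.Nonempty) : Measurable fun ω => S.sup' hne fun z => (F ω).1 z := by
  have := Finset.measurable_sup' hne (f := fun z ω => (F ω).1 z) fun z _ =>
    (measurable_eval_const z).comp hF
  convert! this using 2
  rw [Finset.sup'_apply]

/-- The largest value of the path at the first `T` queries. -/
noncomputable def bestValue {Ω : Type*} (F : Ω → Path X) (ε ζ : ℕ → Ω → ℝ)
    (sel : (t : ℕ) → (Fin t → ℝ) × (ℕ → ℝ) → X) (T : ℕ) (ω : Ω) : ℝ :=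
  ⨆ t : Fin T, (F ω).1 (query F ε ζ sel t ω)

lemma le_bestValue {Ω : Type*} {F : Ω → Path X} {ε ζ : ℕ → Ω → ℝ}
    {sel : (t : ℕ) → (Fin t → ℝ) × (ℕ → ℝ) → X} {T t : ℕ} (ht : t < T) (ω : Ω) :
    (F ω).1 (query F ε ζ sel t ω) ≤ bestValue F ε ζ sel T ω :=
  le_ciSup (f := fun t : Fin T => (F ω).1 (query F ε ζ sel t ω)) (finite_range _).bddAbove ⟨t, ht⟩

section Regret

variable {Ω : Type*} [MeasurableSpace Ω] {P : Measure Ω} [IsProbabilityMeasure P]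
  {f : Ω → Pt d → ℝ} {F : Ω → Path X} {r a b : ℝ}

variable [CompactSpace X] [Nonempty X]

/-- The Lipschitz bound over the diameter `√d * r` of the cube. It supplies both integrability and
the trivial regret bound. -/
lemma RegularDomain.pathOsc_bound (hX : RegularDomain X f P r a b) (hF : Measurable F)
    (hFf : ∀ᵐ ω ∂P, ∀ z : X, (F ω).1 z = f ω z) :
    Integrable (fun ω => pathOsc (F ω)) P ∧
      ∫ ω, pathOsc (F ω) ∂P ≤ d * r * (b * (√(Real.log (a * d)) + √Real.pi / 2)) := by
  have hr := hX.r_pos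
  refine hX.integrable_and_integral_le (measurable_pathOsc.comp hF).aemeasurable
    (.of_forall fun ω => pathOsc_nonneg _) (by positivity) ?_
  filter_upwards [hFf] with ω hω L hL h
  refine pathOsc_le fun z w => ?_
  rw [hω, hω]
  calc f ω z - f ω w ≤ |f ω z - f ω w| := le_abs_self _
    _ ≤ √d * L * ‖(z : Pt d) - w‖ := h z z.2 w w.2
    _ ≤ √d * L * (√d * r) := by
        gcongr
        exact hX.norm_sub_le z.2 w.2
    _ = √d * √d * r * L := by ring
    _ = d * r * L := by rw [Real.mul_self_sqrt (Nat.cast_nonneg d)]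

/-- As for the oscillation, with the diameter replaced by the mesh of the net. -/
lemma RegularDomain.pathSup_sub_bound (hX : RegularDomain X f P r a b) (hF : Measurable F)
    (hFf : ∀ᵐ ω ∂P, ∀ z : X, (F ω).1 z = f ω z) {n : ℕ} {S : Finset X} (hne : S.Nonempty)
    (hS : ∀ z : X, ∃ w ∈ S, ‖(z : Pt d) - w‖ ≤ √d * (r / (2 * n))) :
    ∫ ω, (pathSup (F ω) - S.sup' hne fun z => (F ω).1 z) ∂P ≤
      d * (r / (2 * n)) * (b * (√(Real.log (a * d)) + √Real.pi / 2)) := by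
  have hr := hX.r_pos
  have hm : Measurable fun ω => pathSup (F ω) - S.sup' hne fun z => (F ω).1 z :=
    (measurable_pathSup.comp hF).sub (measurable_finset_sup' hF hne)
  refine (hX.integrable_and_integral_le hm.aemeasurable (.of_forall fun ω => ?_) (by positivity) ?_).2
  · exact sub_nonneg.2 (Finset.sup'_le _ _ fun z _ => le_pathSup _ z)
  filter_upwards [hFf] with ω hω L hL h
  rw [sub_le_iff_le_add]
  refine pathSup_le fun z => ?_
  obtain ⟨w, hw, hzw⟩ := hS z
  have h1 : (F ω).1 w ≤ S.sup' hne fun z => (F ω).1 z :=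
    Finset.le_sup' (fun z => (F ω).1 z) hw
  have h2 : (F ω).1 z - (F ω).1 w ≤ d * (r / (2 * n)) * L := by
    rw [hω, hω]
    calc f ω z - f ω w ≤ |f ω z - f ω w| := le_abs_self _
      _ ≤ √d * L * ‖(z : Pt d) - w‖ := h z z.2 w w.2
      _ ≤ √d * L * (√d * (r / (2 * n))) := by gcongr
      _ = √d * √d * (r / (2 * n)) * L := by ring
      _ = d * (r / (2 * n)) * L := by rw [Real.mul_self_sqrt (Nat.cast_nonneg d)]
  linarith

/-- A random variable between the extrema of the path is integrable. -/
lemma integrable_of_range (hF : Measurable F) (hQ : IsPrior k (P.map F))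
    (hosc : Integrable (fun ω => pathOsc (F ω)) P) {U : Ω → ℝ} (hU : Measurable U)
    (h : ∀ ω, U ω ≤ pathSup (F ω)) (h' : ∀ ω, ∃ z, (F ω).1 z ≤ U ω) : Integrable U P := by
  obtain ⟨x₀⟩ := ‹Nonempty X›
  have := hQ.isProbabilityMeasure
  have h0 : Integrable (fun ω => (F ω).1 x₀) P :=
    (integrable_map_measure (measurable_eval_const x₀).aestronglyMeasurable hF.aemeasurable).1
      ((hQ.memLp x₀).integrable one_le_two)
  refine (h0.abs.add hosc).mono' hU.aestronglyMeasurable (.of_forall fun ω => ?_)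
  obtain ⟨z, hz⟩ := h' ω
  have h1 := sub_le_pathOsc (F ω) x₀ z
  have h2 : pathSup (F ω) ≤ (F ω).1 x₀ + pathOsc (F ω) :=
    pathSup_le fun w => by linarith [sub_le_pathOsc (F ω) w x₀]
  rw [Real.norm_eq_abs, abs_le, Pi.add_apply]
  constructor
  · linarith [neg_abs_le ((F ω).1 x₀)]
  · linarith [le_abs_self ((F ω).1 x₀), h ω]

variable {σ : ℝ≥0} {ε ζ : ℕ → Ω → ℝ} {sel : (t : ℕ) → (Fin t → ℝ) × (ℕ → ℝ) → X}

lemma integrable_bestValue (hM : IsAdaptiveModel k σ P F ε ζ sel)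
    (hosc : Integrable (fun ω => pathOsc (F ω)) P) {T : ℕ} (hT : 0 < T) :
    Integrable (bestValue F ε ζ sel T) P := by
  have : Nonempty (Fin T) := ⟨⟨0, hT⟩⟩
  exact integrable_of_range hM.measurable_path hM.isPrior hosc
    (Measurable.iSup fun t => hM.measurable_value t) (fun ω => ciSup_le fun t => le_pathSup _ _)
    fun ω => ⟨_, le_bestValue hT ω⟩

lemma integrable_pathSup (hM : IsAdaptiveModel k σ P F ε ζ sel)
    (hosc : Integrable (fun ω => pathOsc (F ω)) P) : Integrable (fun ω => pathSup (F ω)) P := by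
  obtain ⟨x₀⟩ := ‹Nonempty X›
  exact integrable_of_range hM.measurable_path hM.isPrior hosc
    (measurable_pathSup.comp hM.measurable_path) (fun ω => le_rfl) fun ω => ⟨x₀, le_pathSup _ _⟩

/-- The bound for the Bayesian simple regret. -/
theorem integral_regret_le (hX : RegularDomain X f P r a b) (hnt : X.Nontrivial)
    (hM : IsAdaptiveModel k σ P F ε ζ sel) (hFf : ∀ᵐ ω ∂P, ∀ z : X, (F ω).1 z = f ω z)
    (hσ : 0 < σ) (hk1 : ∀ z : X, k z z = 1) (hsel : Nonanticipating sel)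
    (hind : ∀ t, IndepFun (fun ω => truncate t fun i => ζ i ω) (ζ t) P) {η : ℝ} (hη : 0 < η)
    (hζ : ∀ t, P.map (ζ t) = twoParamExp (shift d r a b η) (1 / 2))
    (hmax : ∀ t, ∀ᵐ ω ∂P, ∀ z, upperBound k σ F ε ζ sel t ω z ≤
      upperBound k σ F ε ζ sel t ω (query F ε ζ sel t ω)) {T : ℕ} (hT : 0 < T) :
    ∫ ω, (pathSup (F ω) - bestValue F ε ζ sel T ω) ∂P ≤ η / 2 + widthBound X f P σ r a b η T := by
  have hr := hX.r_pos
  have hb := hX.b_pos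
  have hF := hM.measurable_path
  -- In dimension 0 the space is a single point. The case must be excluded for `τ > 0` and for `τ ≤
  -- τ ^ d`.
  have hd : d ≠ 0 := by
    rintro rfl
    exact not_subsingleton_iff.2 hnt (subsingleton_of_subsingleton)
  have hd' : (0 : ℝ) < d := by exact_mod_cast Nat.pos_of_ne_zero hd
  have hk := hM.isPrior.continuous_kernel hk1
  obtain ⟨hosc, hosc_le⟩ := hX.pathOsc_bound hF hFf
  have hsup := integrable_pathSup hM hosc
  have hbest := integrable_bestValue hM hosc hT
  set c := √(Real.log (a * d)) + √Real.pi / 2 with hc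
  have hc0 : 0 < c := by positivity
  set τ := 2 * b * d * r * c / η with hτ
  have hτ0 : 0 < τ := by positivity
  have hτη : τ * η = 2 * b * d * r * c := div_mul_cancel₀ _ hη.ne'
  set γ := (maxInfoGain X f P σ T).toReal with hγ
  have hwidth : widthBound X f P σ r a b η T =
      √((2 + shift d r a b η) * (C₁ σ * γ / T)) := by
    unfold widthBound
    congr 1
    ring
  rw [hwidth]
  -- Since `τ η = 2 b d r c`, the oscillation bound is `τ η / 2` and the error of a net with `n`
  -- cells per axis is `τ η / (4 n)`.
  refine le_half_add_sqrt hd hη hτ0 rfl ?_ fun n hn hcard => ?_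
  · have h : ∫ ω, (pathSup (F ω) - bestValue F ε ζ sel T ω) ∂P ≤ ∫ ω, pathOsc (F ω) ∂P := by
      refine integral_mono (hsup.sub hbest) hosc fun ω => ?_
      have h1 := le_bestValue (F := F) (ε := ε) (ζ := ζ) (sel := sel) hT ω
      have h2 : pathSup (F ω) ≤ (F ω).1 (query F ε ζ sel 0 ω) + pathOsc (F ω) :=
        pathSup_le fun z => by linarith [sub_le_pathOsc (F ω) z (query F ε ζ sel 0 ω)]
      simp only
      linarith
    rw [hτη]
    linarith
  · obtain ⟨S, hne, hScard, hS⟩ := exists_net hX.compact hX.convex hnt.nonempty hr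
      hX.subset_cube hn
    have hintS : Integrable (fun ω => S.sup' hne fun z => (F ω).1 z) P :=
      integrable_of_range hF hM.isPrior hosc (measurable_finset_sup' hF hne)
        (fun ω => Finset.sup'_le _ _ fun z _ => le_pathSup _ z)
        fun ω => ⟨hne.choose, Finset.le_sup' (fun z => (F ω).1 z) hne.choose_spec⟩
    have hint : ∀ t, Integrable (fun ω => (F ω).1 (query F ε ζ sel t ω)) P := fun t =>
      integrable_of_range hF hM.isPrior hosc (hM.measurable_value t) (fun ω => le_pathSup _ _)
        fun ω => ⟨_, le_rfl⟩
    have hScard' : (S.card : ℝ) / 2 ≤ Real.exp (shift d r a b η / 2) := by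
      refine le_trans ?_ hcard
      gcongr
      exact_mod_cast hScard
    have h1 := hM.integral_sup_le hσ hk hk1 hsel hind hζ hne hScard' hmax hint hintS hT
      (fun ω => hM.sum_queryVar_le hσ hk1 (fun n xs => map_eval_eq hF hFf xs) hX.compact hX.convex
        hnt T ω) hbest fun ω t ht => le_bestValue ht ω
    have h2 := hX.pathSup_sub_bound hF hFf hne hS
    rw [integral_sub hsup hintS, ← hc] at h2
    rw [mul_div_assoc, ← hγ] at h1
    rw [integral_sub hsup hbest]
    have h3 : d * (r / (2 * n)) * (b * c) = τ * η / (4 * n) := by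
      rw [hτη]
      field_simp
      ring
    linarith

end Regret

end GPBandit

-- The bound for an actual run and its consequence for longer runs.

theorem corollary2 {Ω : Type*} [MeasurableSpace Ω] (P : Measure Ω) [IsProbabilityMeasure P]
    (d : ℕ) (X : Set (GPBandit.Pt d)) (k : GPBandit.Pt d → GPBandit.Pt d → ℝ)
    (f : Ω → GPBandit.Pt d → ℝ) (hf : GPBandit.IsCenteredGP X k f P)
    (hstat : GPBandit.IsStationaryOn X k) (hk : ∀ z ∈ X, k z z = 1)
    (r a b : ℝ) (hX : GPBandit.RegularDomain X f P r a b)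
    (η : ℝ) (hη : 0 < η) (σ : ℝ≥0) (hσ : 0 < σ)
    (ε ζ : ℕ → Ω → ℝ)
    (hnoise : GPBandit.IsNoiseModel X f P σ (GPBandit.shift d r a b η) (1 / 2) ε ζ)
    (x : ℕ → Ω → GPBandit.Pt d) (y : ℕ → Ω → ℝ)
    (hrun : GPBandit.IsIRGPUCBRun X k f σ ε ζ x y)
    (xstar : Ω → GPBandit.Pt d)
    (hstar : ∀ᵐ ω ∂P, xstar ω ∈ X ∧ IsMaxOn (f ω) X (xstar ω)) :
    (∀ T : ℕ, 1 ≤ T → GPBandit.maxInfoGain X f P σ T ≠ ∞ ∧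
      Integrable (GPBandit.simpleRegret f xstar x T) P ∧
      GPBandit.BSR f P xstar x T ≤ η / 2 + GPBandit.widthBound X f P σ r a b η T) ∧
    ∀ T : ℕ, 1 ≤ T → GPBandit.widthBound X f P σ r a b η T ≤ η / 2 →
      ∀ n : ℕ, T ≤ n → GPBandit.BSR f P xstar x n ≤ η := by
  classical
  obtain ⟨ω₀⟩ : Nonempty Ω := nonempty_of_isProbabilityMeasure P
  obtain ⟨select, hselm, hsel⟩ := hrun.nonanticipating
  let x₀ : X := ⟨x 0 ω₀, hrun.mem 0 ω₀⟩
  have : Nonempty X := ⟨x₀⟩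
  have : CompactSpace X := isCompact_iff_compactSpace.1 hX.compact
  obtain ⟨F, hF, hFf⟩ := GPBandit.exists_path hf hX
  have hprior := GPBandit.isPrior_map hf hF hFf
  have hk1 : ∀ z : X, k z z = 1 := fun z => hk z z.2
  have hM : GPBandit.IsAdaptiveModel k σ P F ε ζ (GPBandit.ruleOf select x₀) :=
    ⟨hF, hnoise.measurable_ε, hnoise.measurable_ζ,
      GPBandit.measurable_ruleOf hX.compact.measurableSet hselm x₀, hprior,
      GPBandit.law_eq_prod hF hFf hnoise⟩
  have hosc := (hX.pathOsc_bound hF hFf).1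
  have hreg : ∀ T, GPBandit.simpleRegret f xstar x T =ᵐ[P] fun ω =>
      GPBandit.pathSup (F ω) - GPBandit.bestValue F ε ζ (GPBandit.ruleOf select x₀) T ω := by
    intro T
    filter_upwards [hFf, hstar] with ω hω hs
    have h1 : GPBandit.pathSup (F ω) = f ω (xstar ω) := by
      refine le_antisymm (GPBandit.pathSup_le fun z => ?_) ?_
      · rw [hω]
        exact hs.2 z.2
      · exact (hω ⟨_, hs.1⟩).symm.trans_le (GPBandit.le_pathSup _ _)
    unfold GPBandit.simpleRegret GPBandit.bestValue
    rw [h1]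
    congr 1
    refine iSup_congr fun t => ?_
    rw [hω, (GPBandit.query_ruleOf hrun.mem hrun.observe hsel x₀ hω t).2]
  have hint : ∀ T, 0 < T → Integrable (GPBandit.simpleRegret f xstar x T) P := fun T hT =>
    ((GPBandit.integrable_pathSup hM hosc).sub (GPBandit.integrable_bestValue hM hosc hT)).congr
      (hreg T).symm
  have hbound : ∀ T, 0 < T → GPBandit.BSR f P xstar x T ≤
      η / 2 + GPBandit.widthBound X f P σ r a b η T := by
    intro T hT
    unfold GPBandit.BSR
    -- A one-point domain has no `T ≥ 2` distinct points, so approximation by distinct designs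
    -- fails, but the regret is 0.
    rcases X.subsingleton_or_nontrivial with hsub | hnt
    · have : Nonempty (Fin T) := ⟨⟨0, hT⟩⟩
      have h0 : GPBandit.simpleRegret f xstar x T =ᵐ[P] fun _ => (0 : ℝ) := by
        filter_upwards [hstar] with ω hs
        have : ∀ t : Fin T, f ω (x t ω) = f ω (xstar ω) := fun t => by
          rw [hsub (hrun.mem t ω) hs.1]
        simp only [GPBandit.simpleRegret, this, ciSup_const, sub_self]
      rw [integral_congr_ae h0, integral_zero]
      exact add_nonneg (by positivity) (Real.sqrt_nonneg _)
    · rw [integral_congr_ae (hreg T)]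
      exact GPBandit.integral_regret_le hX hnt hM hFf hσ hk1
        (GPBandit.nonanticipating_ruleOf select x₀)
        (GPBandit.indepFun_truncate hnoise.measurable_ζ hnoise.indep_ζ) hη
        (fun t => (hnoise.law_ζ t).map_eq)
        (fun t => hFf.mono fun ω hω => GPBandit.upperBound_le hrun hsel x₀ hω t) hT
  refine ⟨fun T hT => ⟨hprior.maxInfoGain_ne_top hσ hk1
    (fun n xs => GPBandit.map_eval_eq hF hFf xs) T, hint T hT, hbound T hT⟩,
    fun T hT hwidth n hn => ?_⟩
  -- More queries can only increase the best value found, so the regret decreases in `n` and nothing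
  -- about the monotonicity of `γ_T / T` is needed.
  have hmono : GPBandit.BSR f P xstar x n ≤ GPBandit.BSR f P xstar x T := by
    refine integral_mono (hint n (by omega)) (hint T hT) fun ω => ?_
    have : Nonempty (Fin T) := ⟨⟨0, hT⟩⟩
    refine sub_le_sub_left (ciSup_le fun t => ?_) _
    exact le_ciSup (f := fun t : Fin n => f ω (x t ω)) (finite_range _).bddAbove (Fin.castLE hn t)
  linarith [hbound T hT]
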